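/- **Proposition 5.4 (Ricformula).** Let $(M,g)$ be a smooth semi-Riemannian manifold of index $q$, let $V$ be a time distribution on $(M,g)$ (a smooth distribution of rank $q$ all of whose nonzero vectors $v$ satisfy $g(v,v)<0$), let $H$ be its $g$-orthogonal complement, and let $f\colon M\to\mathbb R_{>0}$ be smooth. For $u=u_V+u_H\in V\oplus H=TM$ put $\bar u=fu_V+u_H$. Let $\bar g=\mathrm{stretch}(g,f,V)=(-f^{-2}g_V)\oplus g_H$, where $g_V=-g|_V$ and $g_H=g|_H$; i.e. $\bar g(u,v)=f^{-2}g(u_V,v_V)+g(u_H,v_H)$. Notation. $\nabla$ is the Levi-Civita connection of $g$, and $\mathrm{Ric}(u,v)=\operatorname{trace}(z\mapsto R(z,u)v)$ with $R(x,y)z=\nabla_x\nabla_yz-\nabla_y\nabla_xz-\nabla_{[x,y]}z$. Let $U\in\{V,H\}$, and let $\bot U$ be its orthogonal complement. Then - $\mathrm{tr}_U^a\,T(a,a)=\sum_\nu\varepsilon_\nu T(e_\nu,e_\nu)$ for a $g$-orthonormal basis $(e_\nu)$ of $U_x$, where $\varepsilon_\nu=g(e_\nu,e_\nu)$; and $\langle\alpha,\beta\rangle_U=\mathrm{tr}_U^a\,\alpha(a)\beta(a)$;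 - for $u,v\in U$ and $w\in\bot U$, extending $u,v$ to sections in $U$: $\mathrm{Tw}_U(u,v,w)=g([u,v],w)$ and $\mathrm{Sw}_U(u,v,w)=g(\nabla_uv,w)+g(\nabla_vu,w)$; - for $v\in\bot U$, extended to a section in $\bot U$: $\mathrm{div}^U(v)=\mathrm{tr}_U^a\,g(\nabla_av,a)$; - $\Delta_U(f)=\mathrm{tr}_U^a\,g(\nabla_a(\mathrm{grad}_gf)_U,a)$, where $(\cdot)_U$ denotes the $U$-component; $\mathrm{Hess}(f)=\nabla df$; - for arbitrary $x,y$ and for $z\in U$, $w\in\bot U$: $Q^U(x,y,z,w)=(\nabla_yS_U)(x,z,w)$, where $S_U(x,z,w)=g(\nabla_xz,w)$ (with $z$ extended to a section in $U$) is differentiated with the connection $\nabla$ in the slot $x$ and with the projections of $\nabla$ to $U$ and $\bot U$ in the slots $z$ and $w$; i.e., for a vector field $x$ and sections $z$ in $U$, $w$ in $\bot U$, $$Q^U(x,y,z,w)=y\big(g(\nabla_xz,w)\big)-S_U(\nabla_yx,z,w)-S_U\big(x,(\nabla_yz)_U,w\big)-S_U\big(x,z,(\nabla_yw)_{\bot U}\big).$$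 Then the Ricci tensor of $\bar g$ is given as follows. (HH) If $u,v\in H$, then $$\begin{aligned} \mathrm{Ric}_{\bar g}(\bar u,\bar v)={}&\mathrm{Ric}_g(u,v)+\tfrac qf\mathrm{Hess}(f)(u,v)-\tfrac{2q}{f^2}df(u)df(v)+\tfrac{q(1-f^2)+2f^2}{2f}\langle\mathrm{Sw}_H(u,v,\cdot),df\rangle_V\\ &+\tfrac1f\mathrm{div}^V(v)df(u)+\tfrac1f\mathrm{div}^V(u)df(v)-\tfrac{f^2(1-f^2)}4\mathrm{tr}_V^a\mathrm{tr}_V^b\mathrm{Tw}_V(a,b,u)\mathrm{Tw}_V(a,b,v)\\ &-\tfrac{1-f^2}2\mathrm{tr}_V^a\big(Q^H(u,a,v,a)+Q^H(v,a,u,a)\big)-\tfrac{1-f^2}2\langle\mathrm{Sw}_H(u,v,\cdot),\mathrm{div}^H\rangle_V\\ &-\tfrac{1-f^2}4\mathrm{tr}_V^a\mathrm{tr}_V^b\mathrm{Sw}_V(a,b,u)\mathrm{Sw}_V(a,b,v)\\ &-\tfrac{1-f^2}4\mathrm{tr}_V^a\mathrm{tr}_V^b\big(\mathrm{Sw}_V(a,b,u)\mathrm{Tw}_V(a,b,v)+\mathrm{Sw}_V(a,b,v)\mathrm{Tw}_V(a,b,u)\big)\\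 &+\tfrac{1-f^2}4\mathrm{tr}_V^a\mathrm{tr}_H^b\big(\mathrm{Sw}_H(u,b,a)\mathrm{Tw}_H(v,b,a)+\mathrm{Sw}_H(v,b,a)\mathrm{Tw}_H(u,b,a)\big)\\ &-\tfrac{1-f^2}{2f^2}\mathrm{tr}_V^a\mathrm{tr}_H^b\mathrm{Tw}_H(u,b,a)\mathrm{Tw}_H(v,b,a). \end{aligned}$$ (VV) If $u,v\in V$, then $$\begin{aligned} \mathrm{Ric}_{\bar g}(\bar u,\bar v)={}&f^2\mathrm{Ric}_g(u,v)+(q-2)f\,\mathrm{Hess}(f)(u,v)+f\Delta_V(f)g(u,v)+\tfrac1f\Delta_H(f)g(u,v)\\ &+\tfrac1f\langle\mathrm{div}^V,df\rangle_Hg(u,v)+f\langle\mathrm{div}^H,df\rangle_Vg(u,v)-f\,\mathrm{div}^H(v)df(u)-f\,\mathrm{div}^H(u)df(v)\\ &-\tfrac1f\langle\mathrm{Sw}_V(u,v,\cdot),df\rangle_H-(q-1)\langle df,df\rangle_Vg(u,v)-\tfrac{q+1}{f^2}\langle df,df\rangle_Hg(u,v)\\ &-\tfrac{(q-2)(1-f^2)}{2f}\langle\mathrm{Sw}_V(u,v,\cdot),df\rangle_H+\tfrac{1-f^2}2\langle\mathrm{Sw}_V(u,v,\cdot),\mathrm{div}^V\rangle_H\\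 &-\tfrac{1-f^2}2\mathrm{tr}_H^a\big(Q^H(v,a,a,u)+Q^H(u,a,a,v)\big)\\ &-\tfrac{1-f^2}4\mathrm{tr}_H^a\mathrm{tr}_V^b\big(\mathrm{Sw}_V(u,b,a)\mathrm{Tw}_V(v,b,a)+\mathrm{Sw}_V(v,b,a)\mathrm{Tw}_V(u,b,a)\big)\\ &+\tfrac{1-f^2}4\mathrm{tr}_H^a\mathrm{tr}_H^b\mathrm{Sw}_H(a,b,u)\mathrm{Sw}_H(a,b,v)\\ &+\tfrac{1-f^2}4\mathrm{tr}_H^a\mathrm{tr}_H^b\big(\mathrm{Sw}_H(a,b,u)\mathrm{Tw}_H(a,b,v)+\mathrm{Sw}_H(a,b,v)\mathrm{Tw}_H(a,b,u)\big)\\ &+\tfrac{f^2(1-f^2)}2\mathrm{tr}_H^a\mathrm{tr}_V^b\mathrm{Tw}_V(u,b,a)\mathrm{Tw}_V(v,b,a)+\tfrac{1-f^2}{4f^2}\mathrm{tr}_H^a\mathrm{tr}_H^b\mathrm{Tw}_H(a,b,v)\mathrm{Tw}_H(a,b,u). \end{aligned}$$ (VH) If $u\in V$ and $v\in H$, then $$\begin{aligned}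 \mathrm{Ric}_{\bar g}(\bar u,\bar v)={}&f\,\mathrm{Ric}_g(u,v)+\tfrac{1-f^2}{2f}\mathrm{tr}_H^a\big(Q^H(a,a,v,u)-Q^H(v,a,a,u)\big)+\tfrac{f(1-f^2)}2\mathrm{tr}_V^a\big(Q^V(u,a,a,v)-Q^V(a,a,u,v)\big)\\ &-\tfrac12\langle\mathrm{Sw}_H(v,\cdot,u),df\rangle_H+\tfrac12\langle\mathrm{Sw}_V(u,\cdot,v),df\rangle_V+(q-1)\mathrm{Hess}(f)(u,v)-\tfrac{q-1}fdf(u)df(v)\\ &+\mathrm{div}^V(v)df(u)-\mathrm{div}^H(u)df(v)-\tfrac{(q-1)(1-f^2)+3f^2}2\langle\mathrm{Tw}_V(u,\cdot,v),df\rangle_V\\ &+\tfrac{(q-1)(1-f^2)+3}{2f^2}\langle\mathrm{Tw}_H(v,\cdot,u),df\rangle_H+\tfrac{1-f^2}{4f}\langle\mathrm{Sw}_V(u,\cdot,v),\mathrm{div}^H\rangle_V\\ &-\tfrac{(1-f^2)(1-2f^2)}{4f}\langle\mathrm{Tw}_V(u,\cdot,v),\mathrm{div}^H\rangle_V-\tfrac{f(1-f^2)}4\langle\mathrm{Sw}_H(\cdot,v,u),\mathrm{div}^V\rangle_H\\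 &+\tfrac{(1-f^2)(2-f^2)}{4f}\langle\mathrm{Tw}_H(\cdot,v,u),\mathrm{div}^V\rangle_H\\ &+\tfrac{(1-f^2)^2}{8f}\mathrm{tr}_V^a\mathrm{tr}_H^b\big(3\,\mathrm{Tw}_H(v,b,a)\mathrm{Tw}_V(u,a,b)+\mathrm{Sw}_H(v,b,a)\mathrm{Sw}_V(u,a,b)\big)\\ &+\tfrac{1-f^4}{8f}\mathrm{tr}_V^a\mathrm{tr}_H^b\big(\mathrm{Tw}_H(v,b,a)\mathrm{Sw}_V(u,a,b)-\mathrm{Sw}_H(v,b,a)\mathrm{Tw}_V(u,a,b)\big). \end{aligned}$$ -/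

import Mathlib

open scoped Manifold ContDiff

noncomputable section

/-! ## Bilinear forms on a finite-dimensional vector space -/

section Algebra

variable {F : Type*} [AddCommGroup F] [Module ℝ F] [TopologicalSpace F]

/-- The orthogonal subspace `{v | ∀ w ∈ U, B v w = 0}` of `U` with respect to `B`. -/
def perp (B : F →L[ℝ] F →L[ℝ] ℝ) (U : Submodule ℝ F) : Submodule ℝ F where
  carrier := {v | ∀ w ∈ U, B v w = 0}
  add_mem' := by
    intro a b ha hb w hw
    simp [ha w hw, hb w hw]
  zero_mem' := by
    intro w _
    simp
  smul_mem' := by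
    intro c v hv w hw
    simp [hv w hw]

/-- The pullback `(u, v) ↦ B(A u, A v)` of a bilinear form. -/
def pullForm {F' : Type*} [AddCommGroup F'] [Module ℝ F'] [TopologicalSpace F']
    (B : F →L[ℝ] F →L[ℝ] ℝ) (A : F' →L[ℝ] F) : F' →L[ℝ] F' →L[ℝ] ℝ :=
  (ContinuousLinearMap.precomp ℝ A).comp (B.comp A)

/-- The index of a symmetric bilinear form is `q`: the largest dimension of a subspace on which the
form is negative definite is `q`. -/
def HasIndex (B : F →L[ℝ] F →L[ℝ] ℝ) (q : ℕ) : Prop :=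
  IsGreatest {k : ℕ | ∃ W : Submodule ℝ F, Module.Finite ℝ W ∧ Module.finrank ℝ W = k ∧
    ∀ w ∈ W, w ≠ 0 → B w w < 0} q

open Classical in
/-- The `B`-orthogonal projection of the whole space onto `U`, that is, the projection onto `U`
along `perp B U`. It exists and is unique when `B` is nondegenerate on the finite-dimensional
subspace `U`. (Otherwise the value is irrelevant.) -/
def orthProj (B : F →L[ℝ] F →L[ℝ] ℝ) (U : Submodule ℝ F) : F →L[ℝ] F :=
  if h : ∃ P : F →L[ℝ] F, ∀ u, P u ∈ U ∧ ∀ w ∈ U, B (u - P u) w = 0 then h.choose else 0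

/-- `e` is a `B`-orthonormal basis of the subspace `U`. -/
def IsOrthonormalBasis (B : F →L[ℝ] F →L[ℝ] ℝ) (U : Submodule ℝ F) {r : ℕ}
    (e : Module.Basis (Fin r) ℝ U) : Prop :=
  (∀ i, |B (e i) (e i)| = 1) ∧ ∀ i j, i ≠ j → B (e i) (e j) = 0

open Classical in
/-- The trace `∑ ν, ε_ν T(e_ν, e_ν)`, `ε_ν = B(e_ν, e_ν)`, over the subspace `U` with respect to
`B`, where `(e_ν)` is a `B`-orthonormal basis of `U`. The argument is the quadratic expression
`a ↦ T(a, a)`; the sum does not depend on the orthonormal basis (see `trOn_eq`). -/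
def trOn (B : F →L[ℝ] F →L[ℝ] ℝ) (U : Submodule ℝ F) (T : F → ℝ) : ℝ :=
  if h : ∃ e : Module.Basis (Fin (Module.finrank ℝ U)) ℝ U, IsOrthonormalBasis B U e then
    ∑ ν, B (h.choose ν) (h.choose ν) * T (h.choose ν)
  else 0

/-- `trOn` is independent of the choice of the orthonormal basis. -/
theorem trOn_eq (B : F →L[ℝ] F →L[ℝ] ℝ) (U : Submodule ℝ F) (β : F →ₗ[ℝ] F →ₗ[ℝ] ℝ)
    (hB : ∀ u v, B u v = B v u) (e : Module.Basis (Fin (Module.finrank ℝ U)) ℝ U)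
    (he : IsOrthonormalBasis B U e) :
    trOn B U (fun a => β a a) = ∑ ν, B (e ν) (e ν) * β (e ν) (e ν) := by
  classical
  have sq : ∀ {b : Module.Basis (Fin (Module.finrank ℝ U)) ℝ U}, IsOrthonormalBasis B U b →
      ∀ i, B (b i) (b i) * B (b i) (b i) = 1 := by
    intro b hb i
    rw [← abs_mul_abs_self, hb.1 i, one_mul]
  have expand : ∀ {b : Module.Basis (Fin (Module.finrank ℝ U)) ℝ U}, IsOrthonormalBasis B U b →
      ∀ w : U, (w : F) = ∑ i, (B (b i) (b i) * B w (b i)) • (b i : F) := by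
    intro b hb w
    have hw : (w : F) = ∑ i, b.repr w i • (b i : F) := by
      conv_lhs => rw [← b.sum_repr w]
      push_cast
      rfl
    have hc : ∀ i, B w (b i) = b.repr w i * B (b i) (b i) := by
      intro i
      rw [hw]
      simp only [map_sum, map_smul, _root_.sum_apply, _root_.smul_apply,
        smul_eq_mul]
      rw [Finset.sum_eq_single i]
      · intro j _ hj
        rw [hb.2 j i hj, mul_zero]
      · simp
    conv_lhs => rw [hw]
    refine Finset.sum_congr rfl fun i _ => ?_
    rw [hc i, mul_left_comm, sq hb i, mul_one]
  have key : ∀ {b c : Module.Basis (Fin (Module.finrank ℝ U)) ℝ U}, IsOrthonormalBasis B U b →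
      IsOrthonormalBasis B U c →
      ∑ i, B (b i) (b i) * β (b i) (b i) =
        ∑ i, ∑ j, B (b i) (b i) * B (c j) (c j) * B (b i) (c j) * β (c j) (b i) := by
    intro b c hb hc
    refine Finset.sum_congr rfl fun i _ => ?_
    have h1 : β (b i) (b i) = ∑ j, B (c j) (c j) * B (b i) (c j) * β (c j) (b i) := by
      conv_lhs => rw [show β (b i) = ∑ j, (B (c j) (c j) * B (b i) (c j)) • β (c j) by
        conv_lhs => rw [expand hc (b i)]
        simp only [map_sum, map_smul]]
      simp [LinearMap.sum_apply]
    rw [h1, Finset.mul_sum]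
    refine Finset.sum_congr rfl fun j _ => by ring
  have key' : ∀ {b c : Module.Basis (Fin (Module.finrank ℝ U)) ℝ U}, IsOrthonormalBasis B U b →
      IsOrthonormalBasis B U c →
      ∑ j, B (c j) (c j) * β (c j) (c j) =
        ∑ i, ∑ j, B (b i) (b i) * B (c j) (c j) * B (b i) (c j) * β (c j) (b i) := by
    intro b c hb hc
    rw [Finset.sum_comm]
    refine Finset.sum_congr rfl fun j _ => ?_
    have h1 : β (c j) (c j) = ∑ i, B (b i) (b i) * B (c j) (b i) * β (c j) (b i) := by
      conv_lhs => arg 2; rw [expand hb (c j)]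
      simp only [map_sum, map_smul, smul_eq_mul]
    rw [h1, Finset.mul_sum]
    refine Finset.sum_congr rfl fun i _ => ?_
    rw [hB (c j) (b i)]
    ring
  have h : ∃ e : Module.Basis (Fin (Module.finrank ℝ U)) ℝ U, IsOrthonormalBasis B U e := ⟨e, he⟩
  unfold trOn
  rw [dif_pos h, key h.choose_spec he, ← key' h.choose_spec he]

end Algebra

/-! ## Semi-Riemannian geometry on an open set of a vector space

`G y` is the metric at the point `y` of a finite-dimensional vector space `E`, and `U y ⊆ E` is the
fibre at `y` of a distribution. All notions depend only on the germs of `G` and `U` at `y`. -/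

namespace Coord

variable {E : Type*} [NormedAddCommGroup E] [NormedSpace ℝ E]

/-- The Christoffel symbol `Γ_y(v, w)` of the Levi-Civita connection of `G`: the vector such that
`2 G(Γ(v, w), z) = (D_v G)(w, z) + (D_w G)(v, z) - (D_z G)(v, w)` for all `z`.
(`ContinuousLinearMap.inverse (G y)` is the inverse of `E → E*`, `v ↦ G_y(v, ·)`.) -/
def christoffel (G : E → E →L[ℝ] E →L[ℝ] ℝ) (y v w : E) : E :=
  ContinuousLinearMap.inverse (G y)
    ((1 / 2 : ℝ) • (fderiv ℝ G y v w + fderiv ℝ G y w v - ((fderiv ℝ G y).flip v).flip w))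

/-- The Levi-Civita covariant derivative `∇_v Y` at `y` of a vector field `Y`. -/
def nabla (G : E → E →L[ℝ] E →L[ℝ] ℝ) (Y : E → E) (y v : E) : E :=
  fderiv ℝ Y y v + christoffel G y v (Y y)

/-- The curvature `R(u, v)w = ∇_u ∇_v w - ∇_v ∇_u w` at `y`, where `u, v, w` are extended to
constant vector fields (so that `[u, v] = 0`). -/
def curvature (G : E → E →L[ℝ] E →L[ℝ] ℝ) (y u v w : E) : E :=
  nabla G (fun y' => nabla G (fun _ => w) y' v) y u -
    nabla G (fun y' => nabla G (fun _ => w) y' u) y v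

/-- The Ricci tensor `Ric(u, v) = trace (z ↦ R(z, u)v)` at `y`; in terms of an orthonormal basis,
`Ric(u, v) = ∑ k, ε_k G(R(u, e_k)e_k, v)`. -/
def ricci [FiniteDimensional ℝ E] (G : E → E →L[ℝ] E →L[ℝ] ℝ) (y u v : E) : ℝ :=
  ∑ i, (Module.finBasis ℝ E).coord i (curvature G y (Module.finBasis ℝ E i) u v)

/-- The Hessian `(∇ df)(u, v)` at `y`. -/
def hess (G : E → E →L[ℝ] E →L[ℝ] ℝ) (f : E → ℝ) (y u v : E) : ℝ :=
  fderiv ℝ (fderiv ℝ f) y u v - fderiv ℝ f y (christoffel G y u v)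

/-- The section `y ↦ pr_{U_y}(u)` in the distribution `U`; it extends every vector `u` of `U`. -/
def sec (G : E → E →L[ℝ] E →L[ℝ] ℝ) (U : E → Submodule ℝ E) (u : E) : E → E :=
  fun y => orthProj (G y) (U y) u

/-- The section `y ↦ u - pr_{U_y}(u)` in the orthogonal distribution `⊥U`; it extends every vector
`u` of `⊥U`. -/
def secPerp (G : E → E →L[ℝ] E →L[ℝ] ℝ) (U : E → Submodule ℝ E) (u : E) : E → E :=
  fun y => u - orthProj (G y) (U y) u

/-- The tensor `S_U(x, z, w) = G(∇_x ẑ, w)` at `y`, for `x` arbitrary, `z ∈ U`, `w ∈ ⊥U`, where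
`ẑ` is a section in `U` which extends `z`. -/
def sff (G : E → E →L[ℝ] E →L[ℝ] ℝ) (U : E → Submodule ℝ E) (y x z w : E) : ℝ :=
  G y (nabla G (sec G U z) y x) w

/-- `Tw_U(u, v, w) = G([û, v̂], w)` at `y`, for `u, v ∈ U` and `w ∈ ⊥U`. -/
def tw (G : E → E →L[ℝ] E →L[ℝ] ℝ) (U : E → Submodule ℝ E) (y u v w : E) : ℝ :=
  G y (VectorField.lieBracket ℝ (sec G U u) (sec G U v) y) w

/-- `Sw_U(u, v, w) = G(∇_u v̂, w) + G(∇_v û, w)` at `y`, for `u, v ∈ U` and `w ∈ ⊥U`. -/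
def sw (G : E → E →L[ℝ] E →L[ℝ] ℝ) (U : E → Submodule ℝ E) (y u v w : E) : ℝ :=
  G y (nabla G (sec G U v) y u) w + G y (nabla G (sec G U u) y v) w

/-- The tensor `Q_U(x, η, z, w) = (∇_η S_U)(x, z, w)` at `y`, for `x, η` arbitrary, `z ∈ U`,
`w ∈ ⊥U`. Here `S_U` is differentiated with the Levi-Civita connection in the slot `x` and with the
projected connections `pr_U ∇` on `U` and `pr_{⊥U} ∇` on `⊥U` in the slots `z` and `w`. -/
def quiem (G : E → E →L[ℝ] E →L[ℝ] ℝ) (U : E → Submodule ℝ E) (y x η z w : E) : ℝ :=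
  fderiv ℝ (fun y' => G y' (nabla G (sec G U z) y' x) (secPerp G U w y')) y η
    - sff G U y (nabla G (fun _ => x) y η) z w
    - sff G U y x (sec G U (nabla G (sec G U z) y η) y) w
    - sff G U y x z (secPerp G U (nabla G (secPerp G U w) y η) y)

/-- The divergence `div^U(v) = tr_U^a G(∇_a v̂, a)` at `y`, for `v ∈ ⊥U`, where `v̂` is a section in
`⊥U` which extends `v`. This function is the summand `a ↦ G(∇_a v̂, a)`. -/
def divArg (G : E → E →L[ℝ] E →L[ℝ] ℝ) (U : E → Submodule ℝ E) (y v a : E) : ℝ :=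
  G y (nabla G (secPerp G U v) y a) a

/-- The gradient of `f` at `y`, defined by `G(grad f, ·) = df`. -/
def grad (G : E → E →L[ℝ] E →L[ℝ] ℝ) (f : E → ℝ) (y : E) : E :=
  ContinuousLinearMap.inverse (G y) (fderiv ℝ f y)

/-- The partial Laplacian is `Δ_U(f) = tr_U^a G(∇_a (pr_U grad f), a)` at `y`. This function is the
summand `a ↦ G(∇_a (pr_U grad f), a)`. -/
def laplaceArg (G : E → E →L[ℝ] E →L[ℝ] ℝ) (U : E → Submodule ℝ E) (f : E → ℝ) (y a : E) : ℝ :=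
  G y (nabla G (fun y' => orthProj (G y') (U y') (grad G f y')) y a) a

end Coord

/-! ## Semi-Riemannian geometry on a manifold -/

section Manifold

variable (E : Type*) [NormedAddCommGroup E] [NormedSpace ℝ E]
  (M : Type*) [TopologicalSpace M] [ChartedSpace E M]

/-- A field of bilinear forms on the tangent spaces of `M`. -/
abbrev BilinField := ∀ x : M,
  TangentSpace 𝓘(ℝ, E) x →L[ℝ] TangentSpace 𝓘(ℝ, E) x →L[ℝ] ℝ

/-- A field of subspaces of the tangent spaces of `M`. -/
abbrev SubspaceField := ∀ x : M, Submodule ℝ (TangentSpace 𝓘(ℝ, E) x)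

/-- A smooth semi-Riemannian metric of index `q` on `M`. -/
structure SemiRiemannianMetric [IsManifold 𝓘(ℝ, E) ∞ M] (q : ℕ) where
  /-- the metric as a field of bilinear forms -/
  form : BilinField E M
  symm : ∀ x u v, form x u v = form x v u
  nondegenerate : ∀ x u, (∀ v, form x u v = 0) → u = 0
  index : ∀ x, HasIndex (form x) q
  smooth : ContMDiff 𝓘(ℝ, E) (𝓘(ℝ, E).prod 𝓘(ℝ, E →L[ℝ] E →L[ℝ] ℝ)) ∞
    (fun x => Bundle.TotalSpace.mk' (E →L[ℝ] E →L[ℝ] ℝ)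
      (E := fun x : M => TangentSpace 𝓘(ℝ, E) x →L[ℝ] TangentSpace 𝓘(ℝ, E) x →L[ℝ] ℝ) x (form x))

/-- A smooth `p`-plane distribution on `M`: a field of `p`-dimensional subspaces of the tangent
spaces which is locally spanned by `p` smooth vector fields. -/
structure PlaneDistribution [IsManifold 𝓘(ℝ, E) ∞ M] (p : ℕ) where
  /-- the fibres of the distribution -/
  fibre : SubspaceField E M
  finrank_eq : ∀ x, Module.finrank ℝ (fibre x) = p
  smooth : ∀ x : M, ∃ O : Set M, IsOpen O ∧ x ∈ O ∧
    ∃ s : Fin p → ∀ y : M, TangentSpace 𝓘(ℝ, E) y,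
      (∀ i, ContMDiffOn 𝓘(ℝ, E) 𝓘(ℝ, E).tangent ∞
        (fun y => (⟨y, s i y⟩ : TangentBundle 𝓘(ℝ, E) M)) O) ∧
      ∀ y ∈ O, fibre y = Submodule.span ℝ (Set.range fun i => s i y)

variable {E M}

/-- `V` is a time distribution on `(M, g)`: its rank is the index of `g`, and every nonzero vector in
`V` is timelike. -/
def IsTimeDistribution [IsManifold 𝓘(ℝ, E) ∞ M] {q : ℕ} (g : SemiRiemannianMetric E M q)
    (V : PlaneDistribution E M q) : Prop :=
  ∀ x, ∀ v ∈ V.fibre x, v ≠ 0 → g.form x v v < 0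

/-- The `g`-orthogonal distribution of `V`. -/
def perpField (g : BilinField E M) (V : SubspaceField E M) : SubspaceField E M :=
  fun x => perp (g x) (V x)

/-- The metric `stretch(g, f, V) = (-f⁻² g_V) ⊕ g_H` with `H = ⊥V`, where `g_V = -g|V`, `g_H = g|H`:
its value at `(u, v)` is `f⁻² g(u_V, v_V) + g(u_H, v_H)`. -/
def stretch (g : BilinField E M) (f : M → ℝ) (V : SubspaceField E M) : BilinField E M := fun x =>
  (1 / f x ^ 2) • pullForm (g x) (orthProj (g x) (V x)) +
    pullForm (g x) (ContinuousLinearMap.id ℝ _ - orthProj (g x) (V x))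

/-- The vector `f u_V + u_H` for `u = u_V + u_H ∈ V ⊕ ⊥V`. -/
def stretchVec (g : BilinField E M) (f : M → ℝ) (V : SubspaceField E M) (x : M)
    (u : TangentSpace 𝓘(ℝ, E) x) : TangentSpace 𝓘(ℝ, E) x :=
  f x • orthProj (g x) (V x) u + (u - orthProj (g x) (V x) u)

/-! ### Coordinate representations in the preferred chart at a point

The tensors below are independent of charts, so each of them is computed at `x` in the preferred
chart at `x`. -/

/-- The differential at `y` of the inverse of the preferred chart at `x`. -/
def dChartSymm (x : M) (y : E) :
    E →L[ℝ] TangentSpace 𝓘(ℝ, E) ((extChartAt 𝓘(ℝ, E) x).symm y) :=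
  mfderiv 𝓘(ℝ, E) 𝓘(ℝ, E) (extChartAt 𝓘(ℝ, E) x).symm y

/-- The differential at `x` of the preferred chart at `x`. -/
def dChart (x : M) : TangentSpace 𝓘(ℝ, E) x →L[ℝ] E :=
  mfderiv 𝓘(ℝ, E) 𝓘(ℝ, E) (extChartAt 𝓘(ℝ, E) x) x

/-- A field of bilinear forms in the preferred chart at `x`. -/
def chartForm (g : BilinField E M) (x : M) : E → E →L[ℝ] E →L[ℝ] ℝ := fun y =>
  pullForm (g ((extChartAt 𝓘(ℝ, E) x).symm y)) (dChartSymm x y)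

/-- A distribution in the preferred chart at `x`. -/
def chartDist (U : SubspaceField E M) (x : M) : E → Submodule ℝ E := fun y =>
  (U ((extChartAt 𝓘(ℝ, E) x).symm y)).comap (dChartSymm x y).toLinearMap

/-- A function in the preferred chart at `x`. -/
def chartFun (f : M → ℝ) (x : M) : E → ℝ := fun y => f ((extChartAt 𝓘(ℝ, E) x).symm y)

/-- The Ricci tensor `Ric_g(u, v)`. -/
def Ric [FiniteDimensional ℝ E] (g : BilinField E M) (x : M) (u v : TangentSpace 𝓘(ℝ, E) x) : ℝ :=
  Coord.ricci (chartForm g x) (extChartAt 𝓘(ℝ, E) x x) (dChart x u) (dChart x v)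

/-- The differential `df(u)`. -/
def dfun (f : M → ℝ) (x : M) (u : TangentSpace 𝓘(ℝ, E) x) : ℝ :=
  mfderiv 𝓘(ℝ, E) 𝓘(ℝ, ℝ) f x u

/-- The Hessian `Hess_g(f)(u, v)`. -/
def Hess (g : BilinField E M) (f : M → ℝ) (x : M) (u v : TangentSpace 𝓘(ℝ, E) x) : ℝ :=
  Coord.hess (chartForm g x) (chartFun f x) (extChartAt 𝓘(ℝ, E) x x) (dChart x u) (dChart x v)

/-- `Tw_{g,U}(u, v, w)` for `u, v ∈ U` and `w ∈ ⊥U`. -/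
def Tw (g : BilinField E M) (U : SubspaceField E M) (x : M)
    (u v w : TangentSpace 𝓘(ℝ, E) x) : ℝ :=
  Coord.tw (chartForm g x) (chartDist U x) (extChartAt 𝓘(ℝ, E) x x)
    (dChart x u) (dChart x v) (dChart x w)

/-- `Sw_{g,U}(u, v, w)` for `u, v ∈ U` and `w ∈ ⊥U`. -/
def Sw (g : BilinField E M) (U : SubspaceField E M) (x : M)
    (u v w : TangentSpace 𝓘(ℝ, E) x) : ℝ :=
  Coord.sw (chartForm g x) (chartDist U x) (extChartAt 𝓘(ℝ, E) x x)
    (dChart x u) (dChart x v) (dChart x w)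

/-- `Q_g^U(u, v, z, w)` for `u, v` arbitrary, `z ∈ U` and `w ∈ ⊥U`. -/
def Quiem (g : BilinField E M) (U : SubspaceField E M) (x : M)
    (u v z w : TangentSpace 𝓘(ℝ, E) x) : ℝ :=
  Coord.quiem (chartForm g x) (chartDist U x) (extChartAt 𝓘(ℝ, E) x x)
    (dChart x u) (dChart x v) (dChart x z) (dChart x w)

/-- The trace `tr_{g,U}^a T(a, a)`; the argument is `a ↦ T(a, a)`. -/
def tr (g : BilinField E M) (U : SubspaceField E M) (x : M)
    (T : TangentSpace 𝓘(ℝ, E) x → ℝ) : ℝ :=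
  trOn (g x) (U x) T

/-- The partial divergence `div_g^U(v)` for `v ∈ ⊥U`. -/
def divg (g : BilinField E M) (U : SubspaceField E M) (x : M) (v : TangentSpace 𝓘(ℝ, E) x) : ℝ :=
  tr g U x fun a => Coord.divArg (chartForm g x) (chartDist U x) (extChartAt 𝓘(ℝ, E) x x)
    (dChart x v) (dChart x a)

/-- The partial Laplacian `Δ_{g,U}^U(f)`, the trace over `U` of the covariant derivative of the
`U`-component of the gradient of `f`. -/
def laplace (g : BilinField E M) (U : SubspaceField E M) (f : M → ℝ) (x : M) : ℝ :=
  tr g U x fun a => Coord.laplaceArg (chartForm g x) (chartDist U x) (chartFun f x)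
    (extChartAt 𝓘(ℝ, E) x x) (dChart x a)

/-- The pairing `⟨α, β⟩_{g,U} = tr_{g,U}^a α(a) β(a)` of two one-forms on `U` at `x`. -/
def pair (g : BilinField E M) (U : SubspaceField E M) (x : M)
    (α β : TangentSpace 𝓘(ℝ, E) x → ℝ) : ℝ :=
  tr g U x fun a => α a * β a

end Manifold

end

/-! Let `P` be the `g`-orthogonal projection onto `V`. The stretched metric is `g'(u, v) = g(u, v) +
λ g(P u, v)` with `λ = 1 / f² - 1`. Since `∇g = 0`, the tensors `∇g'` and `∇²g'` are explicit
expressions in `∇P`, `∇²P`, `df` and `Hess f` (`covForm_stretchForm`, `covTri_stretchForm`).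

The Levi-Civita connections of `g` and `g'` differ by a tensor `A`, which the Koszul formula
expresses through `∇g'`. The curvatures differ by the antisymmetrised `∇A` plus the antisymmetrised
square of `A`. Taking the trace, `Ric_g' - Ric_g` becomes a sum over a `g'`-orthogonal frame of
terms linear in `∇²g'` and quadratic in `∇g'` (`ricci_sub_ricci`). The curvature of `g` itself is
never evaluated.

The tensors in the statement are components of derivatives of `P`. For `z ∈ V` and `w ∈ H`, `S_V(x,
z, w) = g((∇_x P) z, w)`, so `Sw` and `Tw` are its symmetric and antisymmetric parts, the
divergences are its traces, and `Q^V` is the mixed block of `∇²P`. For `H` the projection is `1 -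
P`, so the same quantities appear with the opposite sign. Differentiating `P² = P` once shows that
`∇P` exchanges `V` and `H`; differentiating twice shows that the diagonal blocks of `∇²P` are
quadratic in `∇P` (`covEnd_idem`, `covBilin_idem`). Hence only mixed components of `∇P` and `∇²P`
remain, together with `df` and `Hess f`.

What is left is finite algebra, isolated in the structure `Frame`. The difference of the Ricci
tensors is split into sums over `V` and `H` (`ricciDiff_eq`), and both sides of each formula are
reduced to a few elementary sums (`ricciDiff_HH`, `ricciDiff_VV`, `ricciDiff_VH`). The rank `q`
enters as the trace of `P`.

On the manifold everything is computed in the preferred chart at `x`, whose differential at `x` is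
the identity. Definiteness of `g` on `V` makes the Gram matrix of a local frame of `V` invertible,
so that `P` is smooth (`contDiffAt_orthProj`). The bases hidden in the definition of the traces are
used as the frame (`exists_frame`), so every trace in the statement is literally a sum over it. -/

open scoped Topology
open ContinuousLinearMap (inverse)

noncomputable section

/-! ### Levi-Civita connection in coordinates, and covariant derivatives of a projection. -/

section

set_option maxSynthPendingDepth 3

namespace Coord

variable {E : Type*} [NormedAddCommGroup E] [NormedSpace ℝ E]

/-- `G` is smooth at `y`, and `G y` is symmetric and nondegenerate. -/
structure MetricAt (G : E → E →L[ℝ] E →L[ℝ] ℝ) (y : E) : Prop where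
  smooth : ContDiffAt ℝ ∞ G y
  symm : ∀ u v, G y u v = G y v u
  inv : (G y).IsInvertible

/-- The trilinear form `(v, w, z) ↦ (D(v, w, z) + D(w, v, z) - D(z, v, w)) / 2`, linearly in `D`. -/
def koszul : (E →L[ℝ] E →L[ℝ] E →L[ℝ] ℝ) →L[ℝ] (E →L[ℝ] E →L[ℝ] E →L[ℝ] ℝ) :=
  let F := ((ContinuousLinearMap.flipₗᵢ ℝ E E (E →L[ℝ] ℝ)).toContinuousLinearEquiv :
    (E →L[ℝ] E →L[ℝ] E →L[ℝ] ℝ) →L[ℝ] (E →L[ℝ] E →L[ℝ] E →L[ℝ] ℝ))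
  let F' := ((ContinuousLinearMap.flipₗᵢ ℝ E E ℝ).toContinuousLinearEquiv :
    (E →L[ℝ] E →L[ℝ] ℝ) →L[ℝ] (E →L[ℝ] E →L[ℝ] ℝ))
  (1 / 2 : ℝ) • (ContinuousLinearMap.id ℝ _ + F -
    (ContinuousLinearMap.compL ℝ E (E →L[ℝ] E →L[ℝ] ℝ) (E →L[ℝ] E →L[ℝ] ℝ) F').comp F)

/-- The Christoffel symbol as a continuous bilinear map. -/
def christoffelL (G : E → E →L[ℝ] E →L[ℝ] ℝ) (y : E) : E →L[ℝ] E →L[ℝ] E :=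
  (ContinuousLinearMap.compL ℝ E (E →L[ℝ] ℝ) E (inverse (G y))).comp (koszul (fderiv ℝ G y))

theorem christoffelL_apply (G : E → E →L[ℝ] E →L[ℝ] ℝ) (y v w : E) :
    christoffelL G y v w = christoffel G y v w := by
  simp only [christoffelL, christoffel, ContinuousLinearMap.comp_apply,
    ContinuousLinearMap.compL_apply]
  congr 1

theorem nabla_eq (G : E → E →L[ℝ] E →L[ℝ] ℝ) (Y : E → E) (y v : E) :
    nabla G Y y v = fderiv ℝ Y y v + christoffelL G y v (Y y) := by
  rw [christoffelL_apply]; rfl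

theorem nabla_const (G : E → E →L[ℝ] E →L[ℝ] ℝ) (w y v : E) :
    nabla G (fun _ => w) y v = christoffelL G y v w := by
  simp [nabla_eq]

section

variable {G : E → E →L[ℝ] E →L[ℝ] ℝ} {y : E}

theorem apply_inverse {A : E →L[ℝ] E →L[ℝ] ℝ} (hA : A.IsInvertible) (α : E →L[ℝ] ℝ) :
    A (inverse A α) = α := by
  obtain ⟨e, rfl⟩ := hA
  simp

theorem eq_of_form_eq {A : E →L[ℝ] E →L[ℝ] ℝ} (hA : A.IsInvertible) {u v : E}
    (h : ∀ z, A u z = A v z) : u = v := by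
  obtain ⟨e, rfl⟩ := hA
  exact e.injective (ContinuousLinearMap.ext h)

/-- Lowering the index cancels the inverse metric; all later computations use Christoffel symbols
only in this form. -/
theorem MetricAt.christoffelL_form (hG : MetricAt G y) (v w z : E) :
    G y (christoffelL G y v w) z =
      (fderiv ℝ G y v w z + fderiv ℝ G y w v z - fderiv ℝ G y z v w) / 2 := by
  rw [christoffelL_apply, christoffel, apply_inverse hG.inv]
  simp
  ring

theorem fderiv_apply_congr {f₁ f₂ : E → ℝ} (h : f₁ =ᶠ[𝓝 y] f₂) (z : E) :
    fderiv ℝ f₁ y z = fderiv ℝ f₂ y z := by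
  rw [h.fderiv_eq]

theorem fderiv_apply_apply {F' : Type*} [NormedAddCommGroup F'] [NormedSpace ℝ F']
    {F : E → E →L[ℝ] E →L[ℝ] F'} (hF : DifferentiableAt ℝ F y) {X Y : E → E}
    (hX : DifferentiableAt ℝ X y) (hY : DifferentiableAt ℝ Y y) (z : E) :
    fderiv ℝ (fun y' => F y' (X y') (Y y')) y z =
      fderiv ℝ F y z (X y) (Y y) + F y (fderiv ℝ X y z) (Y y) + F y (X y) (fderiv ℝ Y y z) := by
  rw [fderiv_clm_apply (hF.clm_apply hX) hY, fderiv_clm_apply hF hX]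
  simp
  abel

theorem MetricAt.differentiableAt (hG : MetricAt G y) : DifferentiableAt ℝ G y :=
  hG.smooth.differentiableAt (by simp)

theorem fderiv_form_symm (hG : ∀ᶠ y' in 𝓝 y, MetricAt G y') (x u v : E) :
    fderiv ℝ G y x u v = fderiv ℝ G y x v u := by
  have hd := hG.self_of_nhds.differentiableAt
  have h : (fun y' => G y' u v) =ᶠ[𝓝 y] fun y' => G y' v u := hG.mono fun y' h => h.symm u v
  have h1 := fderiv_apply_congr h x
  rw [fderiv_apply_apply hd (differentiableAt_const _) (differentiableAt_const _),
    fderiv_apply_apply hd (differentiableAt_const _) (differentiableAt_const _)] at h1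
  simpa using h1

theorem christoffelL_symm (hG : ∀ᶠ y' in 𝓝 y, MetricAt G y') (v w : E) :
    christoffelL G y v w = christoffelL G y w v := by
  refine eq_of_form_eq hG.self_of_nhds.inv fun z => ?_
  rw [hG.self_of_nhds.christoffelL_form, hG.self_of_nhds.christoffelL_form,
    fderiv_form_symm hG z v w]
  ring

/-- The Levi-Civita connection is metric. -/
theorem fderiv_form (hG : ∀ᶠ y' in 𝓝 y, MetricAt G y') {X Y : E → E}
    (hX : DifferentiableAt ℝ X y) (hY : DifferentiableAt ℝ Y y) (z : E) :
    fderiv ℝ (fun y' => G y' (X y') (Y y')) y z =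
      G y (nabla G X y z) (Y y) + G y (X y) (nabla G Y y z) := by
  have hs := hG.self_of_nhds
  rw [fderiv_apply_apply hs.differentiableAt hX hY, nabla_eq, nabla_eq, map_add, map_add,
    _root_.add_apply, hs.symm (X y) (christoffelL G y z (Y y)), hs.christoffelL_form,
    hs.christoffelL_form, fderiv_form_symm hG z (Y y) (X y), fderiv_form_symm hG (X y) z (Y y),
    fderiv_form_symm hG (Y y) z (X y)]
  ring

theorem contDiffAt_inverse [FiniteDimensional ℝ E] (hG : MetricAt G y) :
    ContDiffAt ℝ ∞ (fun y' => inverse (G y')) y := by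
  have := FiniteDimensional.complete ℝ E
  obtain ⟨e, he⟩ := hG.inv
  exact (he ▸ contDiffAt_map_inverse (n := ∞) e : ContDiffAt ℝ ∞ inverse (G y)).comp y hG.smooth

theorem contDiffAt_christoffelL [FiniteDimensional ℝ E] (hG : MetricAt G y) :
    ContDiffAt ℝ ∞ (christoffelL G) y := by
  have h1 : ContDiffAt ℝ ∞ (fderiv ℝ G) y := hG.smooth.fderiv_right (m := ∞) (by simp)
  have h2 : ContDiffAt ℝ ∞ (fun y' => koszul (fderiv ℝ G y')) y :=
    (koszul (E := E)).contDiff.contDiffAt.comp y h1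
  exact ((ContinuousLinearMap.compL ℝ E (E →L[ℝ] ℝ) E).contDiff.contDiffAt.comp y
    (contDiffAt_inverse hG)).clm_comp h2

/-- The covariant derivative `∇_x P` of a field of endomorphisms. -/
def covEnd (G : E → E →L[ℝ] E →L[ℝ] ℝ) (P : E → E →L[ℝ] E) (y : E) : E →L[ℝ] E →L[ℝ] E :=
  fderiv ℝ P y + ((ContinuousLinearMap.compL ℝ E E E).flip (P y)).comp (christoffelL G y) -
    ((ContinuousLinearMap.compL ℝ E E E) (P y)).comp (christoffelL G y)

theorem covEnd_apply (G : E → E →L[ℝ] E →L[ℝ] ℝ) (P : E → E →L[ℝ] E) (y x u : E) :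
    covEnd G P y x u =
      fderiv ℝ P y x u + christoffelL G y x (P y u) - P y (christoffelL G y x u) := by
  simp [covEnd]

/-- The covariant derivative `∇_η K` of a field of vector-valued bilinear maps. -/
def covBilin (G : E → E →L[ℝ] E →L[ℝ] ℝ) (K : E → E →L[ℝ] E →L[ℝ] E) (y η x u : E) : E :=
  fderiv ℝ K y η x u + christoffelL G y η (K y x u) - K y (christoffelL G y η x) u -
    K y x (christoffelL G y η u)

/-- This Leibniz rule is the reason for the two Christoffel terms in `covEnd`. -/
theorem nabla_clm_apply {P : E → E →L[ℝ] E} (hP : DifferentiableAt ℝ P y) {X : E → E}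
    (hX : DifferentiableAt ℝ X y) (v : E) :
    nabla G (fun y' => P y' (X y')) y v = covEnd G P y v (X y) + P y (nabla G X y v) := by
  rw [nabla_eq, nabla_eq, covEnd_apply, fderiv_clm_apply hP hX]
  simp
  abel

theorem nabla_bilin_apply {K : E → E →L[ℝ] E →L[ℝ] E} (hK : DifferentiableAt ℝ K y) {X Y : E → E}
    (hX : DifferentiableAt ℝ X y) (hY : DifferentiableAt ℝ Y y) (v : E) :
    nabla G (fun y' => K y' (X y') (Y y')) y v =
      covBilin G K y v (X y) (Y y) + K y (nabla G X y v) (Y y) + K y (X y) (nabla G Y y v) := by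
  rw [nabla_eq, nabla_eq, nabla_eq, covBilin, fderiv_apply_apply hK hX hY]
  simp
  abel

theorem nabla_add {X Y : E → E} (hX : DifferentiableAt ℝ X y) (hY : DifferentiableAt ℝ Y y)
    (v : E) : nabla G (fun y' => X y' + Y y') y v = nabla G X y v + nabla G Y y v := by
  rw [nabla_eq, nabla_eq, nabla_eq, fderiv_fun_add hX hY]
  simp
  abel

theorem nabla_sub {X Y : E → E} (hX : DifferentiableAt ℝ X y) (hY : DifferentiableAt ℝ Y y)
    (v : E) : nabla G (fun y' => X y' - Y y') y v = nabla G X y v - nabla G Y y v := by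
  rw [nabla_eq, nabla_eq, nabla_eq, fderiv_fun_sub hX hY]
  simp
  abel

theorem nabla_congr {X Y : E → E} (h : X =ᶠ[𝓝 y] Y) (v : E) : nabla G X y v = nabla G Y y v := by
  rw [nabla, nabla, h.fderiv_eq, h.self_of_nhds]

theorem contDiffAt_covEnd [FiniteDimensional ℝ E] (hG : MetricAt G y) {P : E → E →L[ℝ] E}
    (hP : ContDiffAt ℝ ∞ P y) : ContDiffAt ℝ ∞ (covEnd G P) y := by
  have h1 : ContDiffAt ℝ ∞ (fderiv ℝ P) y := hP.fderiv_right (m := ∞) (by simp)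
  have h2 := contDiffAt_christoffelL hG
  refine (h1.add (ContDiffAt.clm_comp ?_ h2)).sub (ContDiffAt.clm_comp ?_ h2)
  · exact ((ContinuousLinearMap.compL ℝ E E E).flip).contDiff.contDiffAt.comp y hP
  · exact (ContinuousLinearMap.compL ℝ E E E).contDiff.contDiffAt.comp y hP

/-- `P` is smooth at `y`, and `P y` is an idempotent endomorphism which is self-adjoint with respect
to `G y`. -/
structure ProjAt (G : E → E →L[ℝ] E →L[ℝ] ℝ) (P : E → E →L[ℝ] E) (y : E) : Prop where
  smooth : ContDiffAt ℝ ∞ P y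
  idem : ∀ u, P y (P y u) = P y u
  selfAdj : ∀ u v, G y (P y u) v = G y u (P y v)

variable {P : E → E →L[ℝ] E}

theorem ProjAt.differentiableAt (hP : ProjAt G P y) : DifferentiableAt ℝ P y :=
  hP.smooth.differentiableAt (by simp)

/-- Differentiate `g(P u, w) = g(u, P w)` with a metric connection; the terms in which `u` or `w` is
differentiated cancel because `P` is self-adjoint. -/
theorem covEnd_selfAdj (hG : ∀ᶠ y' in 𝓝 y, MetricAt G y') (hP : ∀ᶠ y' in 𝓝 y, ProjAt G P y')
    (x u w : E) : G y (covEnd G P y x u) w = G y u (covEnd G P y x w) := by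
  have hd := hP.self_of_nhds.differentiableAt
  have hc : ∀ u : E, DifferentiableAt ℝ (fun _ : E => u) y := fun u => differentiableAt_const _
  have h : (fun y' => G y' (P y' u) w) =ᶠ[𝓝 y] fun y' => G y' u (P y' w) :=
    hP.mono fun y' h => h.selfAdj u w
  have h1 := fderiv_apply_congr h x
  rw [fderiv_form hG (hd.clm_apply (hc u)) (hc w), fderiv_form hG (hc u) (hd.clm_apply (hc w)),
    nabla_clm_apply hd (hc u), nabla_clm_apply hd (hc w)] at h1
  simp only [map_add, _root_.add_apply] at h1
  rw [hP.self_of_nhds.selfAdj, hP.self_of_nhds.selfAdj] at h1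
  linarith

/-- The derivative of `P² = P`. Consequently `∇_x P` maps the range of `P` into its kernel and the
kernel into the range. -/
theorem covEnd_idem (hP : ∀ᶠ y' in 𝓝 y, ProjAt G P y') (x u : E) :
    covEnd G P y x (P y u) + P y (covEnd G P y x u) = covEnd G P y x u := by
  have hd := hP.self_of_nhds.differentiableAt
  have hc : DifferentiableAt ℝ (fun _ : E => u) y := differentiableAt_const _
  have h : (fun y' => P y' (P y' u)) =ᶠ[𝓝 y] fun y' => P y' u := hP.mono fun y' h => h.idem u
  have h1 := nabla_congr (G := G) h x
  rw [nabla_clm_apply hd (hd.clm_apply hc), nabla_clm_apply hd hc, map_add,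
    hP.self_of_nhds.idem] at h1
  rw [← add_assoc] at h1
  exact add_right_cancel h1

theorem covEnd_smooth [FiniteDimensional ℝ E] (hG : ∀ᶠ y' in 𝓝 y, MetricAt G y')
    (hP : ∀ᶠ y' in 𝓝 y, ProjAt G P y') : DifferentiableAt ℝ (covEnd G P) y :=
  (contDiffAt_covEnd hG.self_of_nhds hP.self_of_nhds.smooth).differentiableAt (by simp)

variable [FiniteDimensional ℝ E]

theorem covBilin_selfAdj (hG : ∀ᶠ y' in 𝓝 y, MetricAt G y') (hP : ∀ᶠ y' in 𝓝 y, ProjAt G P y')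
    (η x u w : E) : G y (covBilin G (covEnd G P) y η x u) w =
      G y u (covBilin G (covEnd G P) y η x w) := by
  have hd := covEnd_smooth hG hP
  have hc : ∀ u : E, DifferentiableAt ℝ (fun _ : E => u) y := fun u => differentiableAt_const _
  have h : (fun y' => G y' (covEnd G P y' x u) w) =ᶠ[𝓝 y] fun y' => G y' u (covEnd G P y' x w) := by
    filter_upwards [hG.eventually_nhds, hP.eventually_nhds] with y' h1 h2
    exact covEnd_selfAdj h1 h2 x u w
  have h1 := fderiv_apply_congr h η
  rw [fderiv_form hG ((hd.clm_apply (hc x)).clm_apply (hc u)) (hc w),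
    fderiv_form hG (hc u) ((hd.clm_apply (hc x)).clm_apply (hc w)),
    nabla_bilin_apply hd (hc x) (hc u), nabla_bilin_apply hd (hc x) (hc w)] at h1
  simp only [map_add, _root_.add_apply] at h1
  simp only [covEnd_selfAdj hG hP] at h1
  linarith

/-- The second derivative of `P² = P`. Restricted to the range or to the kernel of `P`, it makes the
diagonal blocks of `∇²P` quadratic in `∇P`. -/
theorem covBilin_idem (hG : ∀ᶠ y' in 𝓝 y, MetricAt G y') (hP : ∀ᶠ y' in 𝓝 y, ProjAt G P y')
    (η x u : E) : covBilin G (covEnd G P) y η x (P y u) + covEnd G P y x (covEnd G P y η u) +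
      covEnd G P y η (covEnd G P y x u) + P y (covBilin G (covEnd G P) y η x u) =
      covBilin G (covEnd G P) y η x u := by
  have hd := hP.self_of_nhds.differentiableAt
  have hk := covEnd_smooth hG hP
  have hc : ∀ u : E, DifferentiableAt ℝ (fun _ : E => u) y := fun u => differentiableAt_const _
  have hpu := hd.clm_apply (hc u)
  have hku := (hk.clm_apply (hc x)).clm_apply (hc u)
  have h : (fun y' => covEnd G P y' x (P y' u) + P y' (covEnd G P y' x u)) =ᶠ[𝓝 y]
      fun y' => covEnd G P y' x u :=
    hP.eventually_nhds.mono fun y' h => covEnd_idem h x u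
  have h1 := nabla_congr (G := G) h η
  rw [nabla_add ((hk.clm_apply (hc x)).clm_apply hpu) (hd.clm_apply hku),
    nabla_bilin_apply hk (hc x) hpu, nabla_clm_apply hd hku, nabla_bilin_apply hk (hc x) (hc u),
    nabla_clm_apply hd (hc u)] at h1
  -- The terms in which the constant fields `x` and `u` are differentiated reproduce the first-order
  -- identity at the arguments `∇_η x` and `∇_η u`, and are subtracted.
  have e1 := covEnd_idem hP (nabla G (fun _ => x) y η) u
  have e2 := covEnd_idem hP x (nabla G (fun _ => u) y η)
  simp only [map_add] at h1
  linear_combination (norm := module) h1 - e1 - e2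

end

end Coord

end

/-! ### Comparison of the Ricci tensors of two metrics. -/

section

set_option maxSynthPendingDepth 3

namespace Coord

variable {E : Type*} [NormedAddCommGroup E] [NormedSpace ℝ E]

/-- The covariant derivative `(∇_x B)(u, v)` of a field of bilinear forms. -/
def covForm (G B : E → E →L[ℝ] E →L[ℝ] ℝ) (y x u v : E) : ℝ :=
  fderiv ℝ B y x u v - B y (christoffelL G y x u) v - B y u (christoffelL G y x v)

/-- The covariant derivative `(∇_η T)(x, u, v)` of a field of trilinear forms. -/
def covTri (G : E → E →L[ℝ] E →L[ℝ] ℝ) (T : E → E → E → E → ℝ) (y η x u v : E) : ℝ :=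
  fderiv ℝ (fun y' => T y' x u v) y η - T y (christoffelL G y η x) u v -
    T y x (christoffelL G y η u) v - T y x u (christoffelL G y η v)

/-- The expression `(T(x, y, z) + T(y, x, z) - T(z, x, y)) / 2`. -/
def firstKind (T : E → E → E → ℝ) (x y z : E) : ℝ := (T x y z + T y x z - T z x y) / 2

variable {G G' : E → E →L[ℝ] E →L[ℝ] ℝ} {y : E}

theorem curvature_eq (hΓ : DifferentiableAt ℝ (christoffelL G) y) (u v w : E) :
    curvature G y u v w = fderiv ℝ (christoffelL G) y u v w +
      christoffelL G y u (christoffelL G y v w) - fderiv ℝ (christoffelL G) y v u w -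
      christoffelL G y v (christoffelL G y u w) := by
  have hc : ∀ u : E, DifferentiableAt ℝ (fun _ : E => u) y := fun u => differentiableAt_const _
  simp only [curvature, nabla_const]
  rw [nabla_eq, nabla_eq, fderiv_apply_apply hΓ (hc v) (hc w), fderiv_apply_apply hΓ (hc u) (hc w)]
  simp
  abel

/-- Substitute `Γ' = Γ + A` into the coordinate formula of the curvature. The terms `A(Γ(u, v), w)`
in the two covariant derivatives of `A` cancel because `Γ` is symmetric. -/
theorem curvature_sub (hΓ : DifferentiableAt ℝ (christoffelL G) y)
    (hΓ' : DifferentiableAt ℝ (christoffelL G') y) (hs : ∀ u v, christoffelL G y u v =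
      christoffelL G y v u) (u v w : E) :
    curvature G' y u v w - curvature G y u v w =
      covBilin G (christoffelL G' - christoffelL G) y u v w -
      covBilin G (christoffelL G' - christoffelL G) y v u w +
      (christoffelL G' - christoffelL G) y u ((christoffelL G' - christoffelL G) y v w) -
      (christoffelL G' - christoffelL G) y v ((christoffelL G' - christoffelL G) y u w) := by
  rw [curvature_eq hΓ, curvature_eq hΓ', covBilin, covBilin, fderiv_sub hΓ' hΓ, hs v u]
  simp
  abel

theorem covForm_symm (hG' : ∀ᶠ y' in 𝓝 y, MetricAt G' y') (x u v : E) :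
    covForm G G' y x u v = covForm G G' y x v u := by
  rw [covForm, covForm, fderiv_form_symm hG', hG'.self_of_nhds.symm u, hG'.self_of_nhds.symm _ v]
  ring

/-- This is the Koszul formula of `G'` with the partial derivatives of `G'` replaced by covariant
ones with respect to `G`; the superfluous Christoffel terms cancel by symmetry. -/
theorem christoffelL_sub_form (hG : ∀ᶠ y' in 𝓝 y, MetricAt G y')
    (hG' : ∀ᶠ y' in 𝓝 y, MetricAt G' y') (v w z : E) :
    G' y ((christoffelL G' - christoffelL G) y v w) z = firstKind (covForm G G' y) v w z := by
  have hs := hG'.self_of_nhds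
  simp only [Pi.sub_apply, _root_.sub_apply, map_sub, hs.christoffelL_form, firstKind, covForm]
  rw [christoffelL_symm hG w v, christoffelL_symm hG z v, christoffelL_symm hG z w,
    hs.symm w, hs.symm v]
  ring

theorem contDiffAt_covForm [FiniteDimensional ℝ E] (hG : MetricAt G y) (hG' : MetricAt G' y)
    (x u v : E) : ContDiffAt ℝ ∞ (fun y' => covForm G G' y' x u v) y := by
  have h1 : ContDiffAt ℝ ∞ (fderiv ℝ G') y := hG'.smooth.fderiv_right (m := ∞) (by simp)
  have h2 := contDiffAt_christoffelL hG
  have hc : ∀ u : E, ContDiffAt ℝ ∞ (fun _ : E => u) y := fun u => contDiffAt_const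
  refine ((((h1.clm_apply (hc x)).clm_apply (hc u)).clm_apply (hc v)).sub
    ((hG'.smooth.clm_apply ((h2.clm_apply (hc x)).clm_apply (hc u))).clm_apply (hc v))).sub
    ((hG'.smooth.clm_apply (hc u)).clm_apply ((h2.clm_apply (hc x)).clm_apply (hc v)))

theorem covTri_symm (hG' : ∀ᶠ y' in 𝓝 y, MetricAt G' y') (η x u v : E) : covTri G (covForm G G') y η x u v = covTri G (covForm G G') y η x v u := by
  have h : (fun y' => covForm G G' y' x u v) =ᶠ[𝓝 y] fun y' => covForm G G' y' x v u :=
    hG'.eventually_nhds.mono fun y' h => covForm_symm h x u v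
  rw [covTri, covTri, fderiv_apply_congr h, covForm_symm hG' _ v u,
    covForm_symm hG' _ _ u, covForm_symm hG' _ v]
  ring

/-- The weights `wt` allow for a basis that is orthogonal but not normalised: a `g`-orthonormal
frame adapted to `V` is only orthogonal for the stretched metric. -/
theorem basis_repr_eq {J : Type*} [Fintype J] [DecidableEq J] (b : Module.Basis J ℝ E)
    (wt : J → ℝ) {B : E →L[ℝ] E →L[ℝ] ℝ}
    (hb : ∀ z z', wt z * B (b z') (b z) = if z' = z then 1 else 0) (x : E) (z : J) :
    b.repr x z = wt z * B x (b z) := by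
  have h : B x (b z) = ∑ i, b.repr x i * B (b i) (b z) := by
    conv_lhs => rw [← b.sum_repr x]
    rw [map_sum, _root_.sum_apply]
    exact Finset.sum_congr rfl fun i _ => by rw [map_smul, _root_.smul_apply, smul_eq_mul]
  rw [h, Finset.mul_sum, Finset.sum_eq_single z]
  · rw [mul_left_comm, hb]; simp
  · intro i _ hi; rw [mul_left_comm, hb]; simp [hi]
  · simp

theorem sum_expand {J : Type*} [Fintype J] [DecidableEq J] (b : Module.Basis J ℝ E) (wt : J → ℝ)
    {B : E →L[ℝ] E →L[ℝ] ℝ} (hb : ∀ z z', wt z * B (b z') (b z) = if z' = z then 1 else 0)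
    (x : E) : x = ∑ z, (wt z * B x (b z)) • b z := by
  conv_lhs => rw [← b.sum_repr x]
  simp only [basis_repr_eq b wt hb]

variable [FiniteDimensional ℝ E]

/-- Differentiate the Koszul identity for `A` with the connection of `G`. Since `G'` is not parallel
for this connection, its derivative contributes the last term. -/
theorem covBilin_christoffelL_sub_form (hG : ∀ᶠ y' in 𝓝 y, MetricAt G y')
    (hG' : ∀ᶠ y' in 𝓝 y, MetricAt G' y') (η v w z : E) :
    G' y (covBilin G (christoffelL G' - christoffelL G) y η v w) z =
      firstKind (covTri G (covForm G G') y η) v w z -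
        covForm G G' y η ((christoffelL G' - christoffelL G) y v w) z := by
  set A := christoffelL G' - christoffelL G with hA
  have hc : ∀ u : E, DifferentiableAt ℝ (fun _ : E => u) y := fun u => differentiableAt_const _
  have hdA : DifferentiableAt ℝ A y :=
    ((contDiffAt_christoffelL hG'.self_of_nhds).sub
      (contDiffAt_christoffelL hG.self_of_nhds)).differentiableAt (by simp)
  have hT : ∀ x u v, DifferentiableAt ℝ (fun y' => covForm G G' y' x u v) y := fun x u v =>
    (contDiffAt_covForm hG.self_of_nhds hG'.self_of_nhds x u v).differentiableAt (by simp)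
  have h : (fun y' => G' y' (A y' v w) z) =ᶠ[𝓝 y] fun y' => (1 / 2 : ℝ) *
      (covForm G G' y' v w z + covForm G G' y' w v z - covForm G G' y' z v w) := by
    filter_upwards [hG.eventually_nhds, hG'.eventually_nhds] with y' h1 h2
    rw [hA, christoffelL_sub_form h1 h2, firstKind]
    ring
  have h1 := fderiv_apply_congr h η
  rw [fderiv_const_mul (((hT v w z).fun_add (hT w v z)).fun_sub (hT z v w)),
    fderiv_fun_sub ((hT v w z).fun_add (hT w v z)) (hT z v w), fderiv_fun_add (hT v w z) (hT w v z),
    fderiv_apply_apply hG'.self_of_nhds.differentiableAt ((hdA.clm_apply (hc v)).clm_apply (hc w))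
      (hc z), fderiv_apply_apply hdA (hc v) (hc w)] at h1
  -- Covariant differentiation of the constant arguments yields a Christoffel term in each slot; the
  -- undifferentiated identity at these arguments removes them.
  have e1 := christoffelL_sub_form hG hG' (christoffelL G y η v) w z
  have e2 := christoffelL_sub_form hG hG' v (christoffelL G y η w) z
  have e3 := christoffelL_sub_form hG hG' v w (christoffelL G y η z)
  simp only [← hA, firstKind] at e1 e2 e3
  simp only [fderiv_fun_const, Pi.zero_apply, _root_.zero_apply, map_zero, add_zero,
    _root_.smul_apply, _root_.add_apply, _root_.sub_apply, smul_eq_mul] at h1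
  simp only [covBilin, firstKind, covTri, map_sub, map_add, _root_.sub_apply, _root_.add_apply,
    covForm] at *
  linarith

/-- Both sides are the basis-independent trace of `L`. This passes from the arbitrary basis in the
definition of `ricci` to the adapted one. -/
theorem sum_coord_eq {J : Type*} [Fintype J] [DecidableEq J] (b : Module.Basis J ℝ E) (wt : J → ℝ)
    {B : E →L[ℝ] E →L[ℝ] ℝ} (hb : ∀ z z', wt z * B (b z') (b z) = if z' = z then 1 else 0)
    (L : E →ₗ[ℝ] E) :
    ∑ i, (Module.finBasis ℝ E).coord i (L (Module.finBasis ℝ E i)) =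
      ∑ z, wt z * B (L (b z)) (b z) := by
  have h1 : ∑ i, (Module.finBasis ℝ E).coord i (L (Module.finBasis ℝ E i)) =
      LinearMap.trace ℝ E L := by
    rw [LinearMap.trace_eq_matrix_trace ℝ (Module.finBasis ℝ E), Matrix.trace]
    simp [LinearMap.toMatrix_apply]
  rw [h1, LinearMap.trace_eq_matrix_trace ℝ b, Matrix.trace]
  simp [LinearMap.toMatrix_apply, basis_repr_eq b wt hb]

/-- The difference of the Ricci tensors of two metrics, in terms of the covariant derivatives of the
one with respect to the Levi-Civita connection of the other, in an orthogonal basis. -/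
theorem ricci_sub_ricci (hG : ∀ᶠ y' in 𝓝 y, MetricAt G y') (hG' : ∀ᶠ y' in 𝓝 y, MetricAt G' y')
    {J : Type*} [Fintype J] [DecidableEq J] (b : Module.Basis J ℝ E) (wt : J → ℝ)
    (hb : ∀ z z', wt z * G' y (b z') (b z) = if z' = z then 1 else 0)
    {T : E → E → E → ℝ} (hT : ∀ x u v, covForm G G' y x u v = T x u v)
    {D : E → E → E → E → ℝ} (hD : ∀ η x u v, covTri G (covForm G G') y η x u v = D η x u v)
    (u w : E) :
    ricci G' y u w - ricci G y u w =
      ∑ z, wt z * ((D (b z) u w (b z) + D (b z) w u (b z) - D (b z) (b z) u w -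
        D u w (b z) (b z)) / 2) +
      ∑ x, wt x * (firstKind T u w (b x) *
        ∑ z, wt z * (T (b x) (b z) (b z) / 2 - T (b z) (b x) (b z))) +
      ∑ z, wt z * ∑ x, wt x * (firstKind T (b z) w (b x) * firstKind T u (b z) (b x)) := by
  have hΓ : DifferentiableAt ℝ (christoffelL G) y :=
    (contDiffAt_christoffelL hG.self_of_nhds).differentiableAt (by simp)
  have hΓ' : DifferentiableAt ℝ (christoffelL G') y :=
    (contDiffAt_christoffelL hG'.self_of_nhds).differentiableAt (by simp)
  obtain rfl : covForm G G' y = T := by ext; apply hT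
  obtain rfl : covTri G (covForm G G') y = D := by ext; apply hD
  set A := christoffelL G' - christoffelL G with hA
  set T := covForm G G' y with hT'
  set D := covTri G (covForm G G') y with hD'
  have hs' := hG'.self_of_nhds
  have hAf : ∀ v w z, G' y (A y v w) z = firstKind T v w z := christoffelL_sub_form hG hG'
  have hTs : ∀ x u v, T x u v = T x v u := covForm_symm hG'
  have hDs : ∀ η x u v, D η x u v = D η x v u := covTri_symm hG'
  have hT1 : ∀ (c : J → ℝ) (u v : E), T (∑ x, c x • b x) u v = ∑ x, c x * T (b x) u v := by
    intro c u v
    simp only [hT', covForm, map_sum, map_smul, _root_.sum_apply, _root_.smul_apply, smul_eq_mul,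
      mul_sub, Finset.sum_sub_distrib]
  have hT2 : ∀ (c : J → ℝ) (u v : E), T u (∑ x, c x • b x) v = ∑ x, c x * T u (b x) v := by
    intro c u v
    simp only [hT', covForm, map_sum, map_smul, _root_.sum_apply, _root_.smul_apply, smul_eq_mul,
      mul_sub, Finset.sum_sub_distrib]
  let L : E →ₗ[ℝ] E :=
    { toFun := fun z => curvature G' y z u w - curvature G y z u w
      map_add' := by intro a c; simp [curvature_eq hΓ, curvature_eq hΓ']; abel
      map_smul' := by intro a c; simp [curvature_eq hΓ, curvature_eq hΓ', smul_sub] }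
  have h1 : ricci G' y u w - ricci G y u w = ∑ z, wt z * G' y (L (b z)) (b z) := by
    rw [← sum_coord_eq b wt hb L, ricci, ricci, ← Finset.sum_sub_distrib]
    simp [L]
  have hX : A y u w = ∑ x, (wt x * firstKind T u w (b x)) • b x := by
    simp only [← hAf]; exact sum_expand b wt hb _
  -- Contracting the `A(z, A(u, w))` term with `z` leaves `T(A(u, w), z, z) / 2`. The term `T(u,
  -- A(z, w), z)` coming from `∇_u A` combines with `-A(u, A(z, w))` to `G'(A(u, z), A(z, w))`,
  -- which is `h3`.
  have h2 : ∀ z, G' y (L z) z = (D z u w z + D z w u z - D z z u w - D u w z z) / 2 +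
      (T (A y u w) z z / 2 - T z (A y u w) z) + ∑ x, wt x * (firstKind T z w (b x) *
        firstKind T u z (b x)) := by
    intro z
    have h3 : G' y (A y u z) (A y z w) = ∑ x, wt x * (firstKind T z w (b x) *
        firstKind T u z (b x)) := by
      have h4 : A y z w = ∑ x, (wt x * firstKind T z w (b x)) • b x := by
        simp only [← hAf]; exact sum_expand b wt hb _
      rw [h4, map_sum]
      exact Finset.sum_congr rfl fun x _ => by rw [map_smul, smul_eq_mul, hAf, mul_assoc]
    change G' y (curvature G' y z u w - curvature G y z u w) z = _
    rw [curvature_sub hΓ hΓ' (christoffelL_symm hG), ← h3]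
    simp only [← hA, map_add, map_sub, _root_.add_apply, _root_.sub_apply, hAf]
    rw [covBilin_christoffelL_sub_form hG hG', covBilin_christoffelL_sub_form hG hG']
    simp only [← hA, ← hT', ← hD', firstKind]
    rw [hDs u z w z, hTs u z, hTs z z]
    ring
  rw [h1]
  simp only [h2, mul_add, Finset.sum_add_distrib]
  congr 1
  congr 1
  -- Expanding `A(u, w)` in the basis and exchanging the sums isolates the trace over `z`, which
  -- depends on `b x` only.
  rw [hX]
  simp only [hT1, hT2, Finset.mul_sum, Finset.sum_div, ← Finset.sum_sub_distrib]
  rw [Finset.sum_comm]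
  refine Finset.sum_congr rfl fun x _ => Finset.sum_congr rfl fun z _ => ?_
  ring

end Coord

end

/-! ### Covariant derivatives of the stretched metric. -/

section

set_option maxSynthPendingDepth 3

namespace Coord

variable {E : Type*} [NormedAddCommGroup E] [NormedSpace ℝ E]

theorem differentiableAt_constFun (y u : E) : DifferentiableAt ℝ (fun _ : E => u) y :=
  differentiableAt_const _

/-- The form `G(u, v) + lam G(P u, v)`. -/
def stretchForm (G : E → E →L[ℝ] E →L[ℝ] ℝ) (P : E → E →L[ℝ] E) (lam : E → ℝ) (y : E) :
    E →L[ℝ] E →L[ℝ] ℝ :=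
  G y + lam y • (G y).comp (P y)

theorem stretchForm_apply (G : E → E →L[ℝ] E →L[ℝ] ℝ) (P : E → E →L[ℝ] E) (lam : E → ℝ) (y u v : E) :
    stretchForm G P lam y u v = G y u v + lam y * G y (P y u) v := by
  simp [stretchForm]

theorem isInvertible_of_nondegenerate [FiniteDimensional ℝ E] {B : E →L[ℝ] E →L[ℝ] ℝ}
    (h : ∀ u, (∀ v, B u v = 0) → u = 0) : B.IsInvertible := by
  have hinj : Function.Injective B.toLinearMap := by
    rw [← LinearMap.ker_eq_bot, LinearMap.ker_eq_bot']
    intro u hu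
    refine h u fun v => ?_
    exact DFunLike.congr_fun (F := E →L[ℝ] ℝ) hu v
  have hrank : Module.finrank ℝ E = Module.finrank ℝ (E →L[ℝ] ℝ) := by
    rw [← (LinearMap.toContinuousLinearMap (𝕜 := ℝ) (E := E) (F' := ℝ)).finrank_eq]
    exact (Subspace.dual_finrank_eq (K := ℝ) (V := E)).symm
  exact ⟨(LinearEquiv.ofInjectiveOfFinrankEq B.toLinearMap hinj hrank).toContinuousLinearEquiv, by
    ext; rfl⟩

variable {G : E → E →L[ℝ] E →L[ℝ] ℝ} {y : E} {P : E → E →L[ℝ] E} {lam : E → ℝ}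

/-- If `u` is in the kernel of the new form, then `u + λ P u = 0`; applying `P` gives `(1 + λ) P u =
0`, so `P u = 0` and `u = 0`. -/
theorem MetricAt.stretchForm [FiniteDimensional ℝ E] (hG : MetricAt G y) (hP : ProjAt G P y)
    (hl : ContDiffAt ℝ ∞ lam y) (h1 : 1 + lam y ≠ 0) : MetricAt (stretchForm G P lam) y where
  smooth := hG.smooth.add (hl.smul (hG.smooth.clm_comp hP.smooth))
  symm u v := by
    rw [stretchForm_apply, stretchForm_apply, hG.symm u v, hP.selfAdj, hG.symm u]
  inv := by
    refine isInvertible_of_nondegenerate fun u hu => ?_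
    have h2 : u + lam y • P y u = 0 := by
      refine eq_of_form_eq hG.inv fun z => ?_
      simpa [stretchForm_apply] using hu z
    have h3 := congrArg (P y) h2
    have h4 : (1 + lam y) • P y u = 0 := by
      rw [add_smul, one_smul]
      simpa [hP.idem] using h3
    rw [smul_eq_zero_iff_right h1] at h4
    simpa [h4] using h2

theorem covForm_eq {B : E → E →L[ℝ] E →L[ℝ] ℝ} (hB : DifferentiableAt ℝ B y) (x u v : E) :
    covForm G B y x u v = fderiv ℝ (fun y' => B y' u v) y x - B y (christoffelL G y x u) v -
      B y u (christoffelL G y x v) := by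
  rw [covForm, fderiv_apply_apply hB (differentiableAt_constFun y u) (differentiableAt_constFun y v)]
  simp

/-- As `G` is parallel, only the factor `λ` and the projection `P` are differentiated. -/
theorem covForm_stretchForm (hG : ∀ᶠ y' in 𝓝 y, MetricAt G y') (hP : ∀ᶠ y' in 𝓝 y, ProjAt G P y')
    (hl : ContDiffAt ℝ ∞ lam y) (x u v : E) :
    covForm G (stretchForm G P lam) y x u v =
      fderiv ℝ lam y x * G y (P y u) v + lam y * G y (covEnd G P y x u) v := by
  have hg := hG.self_of_nhds.differentiableAt
  have hp := hP.self_of_nhds.differentiableAt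
  have hl' : DifferentiableAt ℝ lam y := hl.differentiableAt (by simp)
  have hc := differentiableAt_constFun y
  rw [covForm_eq (show DifferentiableAt ℝ (stretchForm G P lam) y from
    hg.add (hl'.smul (hg.clm_comp hp)))]
  simp only [stretchForm_apply]
  have hguv : DifferentiableAt ℝ (fun y' => G y' u v) y := (hg.clm_apply (hc u)).clm_apply (hc v)
  have hgpuv : DifferentiableAt ℝ (fun y' => G y' (P y' u) v) y :=
    (hg.clm_apply (hp.clm_apply (hc u))).clm_apply (hc v)
  rw [fderiv_fun_add hguv (hl'.fun_mul hgpuv), fderiv_fun_mul hl' hgpuv]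
  simp only [_root_.add_apply, _root_.smul_apply, smul_eq_mul]
  rw [fderiv_form hG (hc u) (hc v), fderiv_form hG (hp.clm_apply (hc u)) (hc v),
    nabla_clm_apply hp (hc u), nabla_const, nabla_const, map_add, _root_.add_apply]
  ring

theorem fderiv_fderiv_apply (hl : ContDiffAt ℝ ∞ lam y) (x η : E) :
    fderiv ℝ (fun y' => fderiv ℝ lam y' x) y η = fderiv ℝ (fderiv ℝ lam) y η x := by
  have h1 : DifferentiableAt ℝ (fderiv ℝ lam) y :=
    (hl.fderiv_right (m := ∞) (by simp)).differentiableAt (by simp)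
  rw [fderiv_clm_apply h1 (differentiableAt_constFun y x)]
  simp

/-- The product rule applied to the first derivative near `y`. The correction in the slot `x` turns
the second derivative of `λ` into its Hessian and that of `P` into `∇²P`. -/
theorem covTri_stretchForm [FiniteDimensional ℝ E] (hG : ∀ᶠ y' in 𝓝 y, MetricAt G y')
    (hP : ∀ᶠ y' in 𝓝 y, ProjAt G P y')
    (hl : ∀ᶠ y' in 𝓝 y, ContDiffAt ℝ ∞ lam y') (η x u v : E) :
    covTri G (covForm G (stretchForm G P lam)) y η x u v =
      hess G lam y η x * G y (P y u) v + fderiv ℝ lam y x * G y (covEnd G P y η u) v +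
      fderiv ℝ lam y η * G y (covEnd G P y x u) v +
      lam y * G y (covBilin G (covEnd G P) y η x u) v := by
  have hg := hG.self_of_nhds.differentiableAt
  have hp := hP.self_of_nhds.differentiableAt
  have hk := covEnd_smooth hG hP
  have hls := hl.self_of_nhds
  have hl' : DifferentiableAt ℝ lam y := hls.differentiableAt (by simp)
  have hdl : DifferentiableAt ℝ (fun y' => fderiv ℝ lam y' x) y :=
    ((hls.fderiv_right (m := ∞) (by simp)).differentiableAt (by simp)).clm_apply
      (differentiableAt_constFun y x)
  have hc := differentiableAt_constFun y
  have h : (fun y' => covForm G (stretchForm G P lam) y' x u v) =ᶠ[𝓝 y]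
      fun y' => fderiv ℝ lam y' x * G y' (P y' u) v + lam y' * G y' (covEnd G P y' x u) v := by
    filter_upwards [hG.eventually_nhds, hP.eventually_nhds, hl] with y' h1 h2 h3
    exact covForm_stretchForm h1 h2 h3 x u v
  have hgpuv : DifferentiableAt ℝ (fun y' => G y' (P y' u) v) y :=
    (hg.clm_apply (hp.clm_apply (hc u))).clm_apply (hc v)
  have hku : DifferentiableAt ℝ (fun y' => covEnd G P y' x u) y :=
    (hk.clm_apply (hc x)).clm_apply (hc u)
  have hgkuv : DifferentiableAt ℝ (fun y' => G y' (covEnd G P y' x u) v) y :=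
    (hg.clm_apply hku).clm_apply (hc v)
  rw [covTri, fderiv_apply_congr h, fderiv_fun_add (hdl.fun_mul hgpuv) (hl'.fun_mul hgkuv),
    fderiv_fun_mul hl' hgkuv, fderiv_fun_mul hdl hgpuv]
  simp only [_root_.add_apply, _root_.smul_apply, smul_eq_mul]
  rw [fderiv_form hG (hp.clm_apply (hc u)) (hc v), fderiv_form hG hku (hc v),
    nabla_clm_apply hp (hc u), nabla_bilin_apply hk (hc x) (hc u), fderiv_fderiv_apply hls]
  simp only [nabla_const, covForm_stretchForm hG hP hls, hess, map_add, _root_.add_apply,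
    ← christoffelL_apply]
  ring

/-! ### Tensors of a distribution in terms of its projection. -/

section Distribution

variable {U : E → Submodule ℝ E}

theorem sec_eventuallyEq (hU : ∀ᶠ y' in 𝓝 y, orthProj (G y') (U y') = P y') (z : E) :
    sec G U z =ᶠ[𝓝 y] fun y' => P y' z := by
  filter_upwards [hU] with y' h
  rw [sec, h]

theorem secPerp_eventuallyEq (hU : ∀ᶠ y' in 𝓝 y, orthProj (G y') (U y') = P y') (z : E) :
    secPerp G U z =ᶠ[𝓝 y] fun y' => z - P y' z := by
  filter_upwards [hU] with y' h
  rw [secPerp, h]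

theorem nabla_sec (hU : ∀ᶠ y' in 𝓝 y, orthProj (G y') (U y') = P y')
    (hP : ∀ᶠ y' in 𝓝 y, ProjAt G P y') (z x : E) :
    nabla G (sec G U z) y x = covEnd G P y x z + P y (christoffelL G y x z) := by
  rw [nabla_congr (sec_eventuallyEq hU z),
    nabla_clm_apply hP.self_of_nhds.differentiableAt (differentiableAt_constFun y z), nabla_const]

theorem nabla_secPerp (hU : ∀ᶠ y' in 𝓝 y, orthProj (G y') (U y') = P y')
    (hP : ∀ᶠ y' in 𝓝 y, ProjAt G P y') (z x : E) :
    nabla G (secPerp G U z) y x =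
      christoffelL G y x z - covEnd G P y x z - P y (christoffelL G y x z) := by
  have hp := hP.self_of_nhds.differentiableAt
  have hc := differentiableAt_constFun y z
  rw [nabla_congr (secPerp_eventuallyEq hU z), nabla_sub hc (hp.clm_apply hc),
    nabla_clm_apply hp hc, nabla_const]
  abel

theorem ProjAt.form_proj (hP : ProjAt G P y) (u : E) {w : E} (hw : P y w = 0) :
    G y (P y u) w = 0 := by
  rw [hP.selfAdj, hw, map_zero]

/-- The section extending `z` is `P z` with `z` constant, and `∇_x (P z) = (∇_x P) z + P (∇_x z)`;
the last term is orthogonal to `w`. -/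
theorem sff_eq (hU : ∀ᶠ y' in 𝓝 y, orthProj (G y') (U y') = P y')
    (hP : ∀ᶠ y' in 𝓝 y, ProjAt G P y') (x z : E) {w : E} (hw : P y w = 0) :
    sff G U y x z w = G y (covEnd G P y x z) w := by
  rw [sff, nabla_sec hU hP, map_add, _root_.add_apply, hP.self_of_nhds.form_proj _ hw, add_zero]

theorem sw_eq (hU : ∀ᶠ y' in 𝓝 y, orthProj (G y') (U y') = P y')
    (hP : ∀ᶠ y' in 𝓝 y, ProjAt G P y') (u v : E) {w : E} (hw : P y w = 0) :
    sw G U y u v w = G y (covEnd G P y u v) w + G y (covEnd G P y v u) w := by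
  rw [← sff_eq hU hP u v hw, ← sff_eq hU hP v u hw]
  rfl

/-- The connection is torsion-free, so the bracket is a difference of covariant derivatives. Here `P
u = u` and `P v = v` are needed because the bracket involves the values of the sections at `y`. -/
theorem tw_eq (hG : ∀ᶠ y' in 𝓝 y, MetricAt G y')
    (hU : ∀ᶠ y' in 𝓝 y, orthProj (G y') (U y') = P y')
    (hP : ∀ᶠ y' in 𝓝 y, ProjAt G P y') {u v w : E} (hu : P y u = u) (hv : P y v = v)
    (hw : P y w = 0) :
    tw G U y u v w = G y (covEnd G P y u v) w - G y (covEnd G P y v u) w := by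
  have hu' : sec G U u y = u := (sec_eventuallyEq hU u).self_of_nhds.trans hu
  have hv' : sec G U v y = v := (sec_eventuallyEq hU v).self_of_nhds.trans hv
  rw [← sff_eq hU hP u v hw, ← sff_eq hU hP v u hw, sff, sff, tw, VectorField.lieBracket,
    nabla_eq, nabla_eq, hu', hv', christoffelL_symm hG u v]
  simp

theorem covEnd_range (hP : ∀ᶠ y' in 𝓝 y, ProjAt G P y') (x : E) {z : E} (hz : P y z = z) :
    P y (covEnd G P y x z) = 0 := by
  have h := covEnd_idem hP x z
  rw [hz] at h
  simpa using h

/-- Near `y` the tensor `S_U` is given by `∇P`, so its derivative contains `∇²P`. The projected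
connections in the slots `z` and `w` discard only components on which `g((∇_x P) ·, ·)` vanishes. -/
theorem quiem_eq [FiniteDimensional ℝ E] (hG : ∀ᶠ y' in 𝓝 y, MetricAt G y')
    (hU : ∀ᶠ y' in 𝓝 y, orthProj (G y') (U y') = P y')
    (hP : ∀ᶠ y' in 𝓝 y, ProjAt G P y') (x η : E) {z w : E} (hz : P y z = z) (hw : P y w = 0) :
    quiem G U y x η z w = G y (covBilin G (covEnd G P) y η x z) w := by
  have hp := hP.self_of_nhds
  have hpd := hp.differentiableAt
  have hk := covEnd_smooth hG hP
  have hc := differentiableAt_constFun y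
  have hkz : DifferentiableAt ℝ (fun y' => covEnd G P y' x z) y :=
    (hk.clm_apply (hc x)).clm_apply (hc z)
  have h : (fun y' => G y' (nabla G (sec G U z) y' x) (secPerp G U w y')) =ᶠ[𝓝 y]
      fun y' => G y' (covEnd G P y' x z) (w - P y' w) := by
    filter_upwards [hU.eventually_nhds, hP.eventually_nhds] with y' h1 h2
    rw [nabla_sec h1 h2, (secPerp_eventuallyEq h1 w).self_of_nhds, map_add, _root_.add_apply,
      h2.self_of_nhds.form_proj (w := w - P y' w), add_zero]
    rw [map_sub, h2.self_of_nhds.idem, sub_self]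
  have hsp : ∀ v, P y (secPerp G U v y) = 0 := by
    intro v
    rw [(secPerp_eventuallyEq hU v).self_of_nhds, map_sub, hp.idem, sub_self]
  rw [quiem, fderiv_apply_congr h, fderiv_form hG hkz ((hc w).fun_sub (hpd.clm_apply (hc w))),
    nabla_bilin_apply hk (hc x) (hc z), sff_eq hU hP _ _ hw, sff_eq hU hP _ _ hw,
    sff_eq hU hP _ _ (hsp _), (secPerp_eventuallyEq hU _).self_of_nhds,
    nabla_congr (secPerp_eventuallyEq hU w), (sec_eventuallyEq hU _).self_of_nhds,
    nabla_sec hU hP]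
  simp only [hw, sub_zero, nabla_const, map_add, map_sub, _root_.add_apply, covEnd_range hP _ hz,
    hp.idem, zero_add]
  -- `(∇_x P) z` is orthogonal to `U`, so the `U`-component of the derivative of `w` drops out.
  have e1 : G y (covEnd G P y x z) (P y (nabla G (fun y' => w - P y' w) y η)) = 0 := by
    rw [← hp.selfAdj, covEnd_range hP _ hz, map_zero, _root_.zero_apply]
  -- `∇_x P` sends the complementary component of the derivative of `z` into `U`, which is
  -- orthogonal to `w`.
  have e2 : G y (covEnd G P y x (christoffelL G y η z)) w =
      G y (covEnd G P y x (P y (christoffelL G y η z))) w := by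
    conv_lhs => rw [← covEnd_idem hP]
    rw [map_add, _root_.add_apply, hp.form_proj _ hw, add_zero]
  rw [e1, e2]
  ring

/-- Differentiating `v - P v` and pairing with `a ∈ U`, the projected and unprojected Christoffel
terms agree and cancel; only the derivative of `-P` survives. -/
theorem divArg_eq (hG : ∀ᶠ y' in 𝓝 y, MetricAt G y')
    (hU : ∀ᶠ y' in 𝓝 y, orthProj (G y') (U y') = P y')
    (hP : ∀ᶠ y' in 𝓝 y, ProjAt G P y') (v : E) {a : E} (ha : P y a = a) :
    divArg G U y v a = - G y (covEnd G P y a a) v := by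
  rw [divArg, nabla_secPerp hU hP, map_sub, map_sub, _root_.sub_apply, _root_.sub_apply,
    hP.self_of_nhds.selfAdj, ha, covEnd_selfAdj hG hP, hG.self_of_nhds.symm v]
  ring

theorem grad_form (hG : MetricAt G y) (w : E) : G y (grad G lam y) w = fderiv ℝ lam y w := by
  rw [grad, apply_inverse hG.inv]

/-- Apply the Leibniz rule to `P grad f`. Moving `∇_a P` and `P` to the other side of `G` leaves
`df((∇_a P) a)` and, since `P a = a`, the Hessian. -/
theorem laplaceArg_eq [FiniteDimensional ℝ E] (hG : ∀ᶠ y' in 𝓝 y, MetricAt G y')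
    (hU : ∀ᶠ y' in 𝓝 y, orthProj (G y') (U y') = P y')
    (hP : ∀ᶠ y' in 𝓝 y, ProjAt G P y') (hl : ContDiffAt ℝ ∞ lam y) {a : E} (ha : P y a = a) :
    laplaceArg G U lam y a = hess G lam y a a + fderiv ℝ lam y (covEnd G P y a a) := by
  have hp := hP.self_of_nhds
  have hc := differentiableAt_constFun y
  have hdl := hl.fderiv_right (m := ∞) (by simp)
  have hgr : DifferentiableAt ℝ (grad G lam) y :=
    ((contDiffAt_inverse hG.self_of_nhds).clm_apply hdl).differentiableAt (by simp)
  have h : (fun y' => G y' (grad G lam y') a) =ᶠ[𝓝 y] fun y' => fderiv ℝ lam y' a :=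
    hG.mono fun y' h => grad_form h a
  have h1 := fderiv_apply_congr h a
  rw [fderiv_form hG hgr (hc a), fderiv_fderiv_apply hl, nabla_const,
    grad_form hG.self_of_nhds] at h1
  have h2 : (fun y' => orthProj (G y') (U y') (grad G lam y')) =ᶠ[𝓝 y]
      fun y' => P y' (grad G lam y') := by
    filter_upwards [hU] with y' h
    rw [h]
  rw [laplaceArg, nabla_congr h2, nabla_clm_apply hp.differentiableAt hgr, map_add,
    _root_.add_apply, covEnd_selfAdj hG hP, grad_form hG.self_of_nhds, hp.selfAdj, ha, hess,
    ← christoffelL_apply]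
  linarith

end Distribution

/-! ### The complementary projection -/

/-- The field of complementary projections `u ↦ u - P u`. -/
def compl (P : E → E →L[ℝ] E) (y : E) : E →L[ℝ] E := ContinuousLinearMap.id ℝ E - P y

theorem compl_apply (P : E → E →L[ℝ] E) (y u : E) : compl P y u = u - P y u := rfl

theorem ProjAt.compl (hP : ProjAt G P y) : ProjAt G (compl P) y where
  smooth := contDiffAt_const.sub hP.smooth
  idem u := by simp [compl_apply, hP.idem]
  selfAdj u v := by simp [compl_apply, hP.selfAdj]

/-- The identity endomorphism is parallel; hence the tensors of `⊥U` are those of `U` with the sign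
reversed. -/
theorem covEnd_compl : covEnd G (compl P) y = - covEnd G P y := by
  ext x u
  have h : fderiv ℝ (compl P) y = - fderiv ℝ P y := by
    change fderiv ℝ (fun y => ContinuousLinearMap.id ℝ E - P y) y = _
    rw [fderiv_const_sub]
  simp only [covEnd_apply, h, compl_apply, _root_.neg_apply, map_sub]
  abel

theorem covBilin_compl (η x u : E) :
    covBilin G (covEnd G (compl P)) y η x u = - covBilin G (covEnd G P) y η x u := by
  have h : covEnd G (compl P) = fun y' => - covEnd G P y' := funext fun y' => covEnd_compl
  rw [covBilin, covBilin, h, fderiv_fun_neg]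
  simp only [_root_.neg_apply, map_neg]
  abel

/-! ### The function `1 / f² - 1` -/

variable {f : E → ℝ}

theorem contDiffAt_lam (hf : ContDiffAt ℝ ∞ f y) (h0 : f y ≠ 0) :
    ContDiffAt ℝ ∞ (fun y' => 1 / f y' ^ 2 - 1) y :=
  (contDiffAt_const.div (hf.pow 2) (pow_ne_zero 2 h0)).sub contDiffAt_const

theorem fderiv_lam (hf : ContDiffAt ℝ ∞ f y) (h0 : f y ≠ 0) (x : E) :
    fderiv ℝ (fun y' => 1 / f y' ^ 2 - 1) y x = -2 / f y ^ 3 * fderiv ℝ f y x := by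
  have h1 := (hf.differentiableAt (by simp)).hasFDerivAt
  have h2 := ((((hasDerivAt_pow 2 (f y)).fun_inv (pow_ne_zero 2 h0)).sub_const 1).comp_hasFDerivAt y h1)
  have h3 : (fun y' => 1 / f y' ^ 2 - 1) = (fun x => (x ^ 2)⁻¹ - 1) ∘ f := by
    ext; simp
  rw [h3, h2.fderiv]
  simp only [_root_.smul_apply, smul_eq_mul]
  field_simp
  push_cast
  ring

theorem hess_lam (hf : ∀ᶠ y' in 𝓝 y, ContDiffAt ℝ ∞ f y') (h0 : ∀ᶠ y' in 𝓝 y, f y' ≠ 0) (u v : E) :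
    hess G (fun y' => 1 / f y' ^ 2 - 1) y u v =
      -2 / f y ^ 3 * hess G f y u v + 6 / f y ^ 4 * (fderiv ℝ f y u * fderiv ℝ f y v) := by
  have hfs := hf.self_of_nhds
  have hz := h0.self_of_nhds
  have h : (fun y' => fderiv ℝ (fun y' => 1 / f y' ^ 2 - 1) y' v) =ᶠ[𝓝 y]
      fun y' => -2 * (f y' ^ 3)⁻¹ * fderiv ℝ f y' v := by
    filter_upwards [hf, h0] with y' h1 h2
    rw [fderiv_lam h1 h2, div_eq_mul_inv]
  have h1 := (hfs.differentiableAt (by simp)).hasFDerivAt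
  have h2 := ((((hasDerivAt_pow 3 (f y)).fun_inv (pow_ne_zero 3 hz)).const_mul (-2)).comp_hasFDerivAt y h1)
  have hdf : DifferentiableAt ℝ (fun y' => fderiv ℝ f y' v) y :=
    ((hfs.fderiv_right (m := ∞) (by simp)).differentiableAt (by simp)).clm_apply
      (differentiableAt_constFun y v)
  rw [hess, hess, ← fderiv_fderiv_apply (contDiffAt_lam hfs hz), fderiv_apply_congr h,
    fderiv_lam hfs hz, ← fderiv_fderiv_apply hfs]
  have h4 := (h2.mul hdf.hasFDerivAt).fderiv
  have h3 : (fun y' => -2 * (f y' ^ 3)⁻¹ * fderiv ℝ f y' v) =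
      ((fun x => -2 * (x ^ 3)⁻¹) ∘ f) * fun y' => fderiv ℝ f y' v := by
    ext; simp
  rw [h3, h4]
  simp
  field_simp
  ring

end Coord

end

/-! ### The abstract frame and the splitting of the Ricci difference. -/

section

namespace Coord

/-- The first and second covariant derivatives of a projection `P` onto a subspace along its
orthogonal complement, and of a function `f`, in an orthonormal frame. -/
structure Frame (E ι κ : Type*) [Fintype ι] [Fintype κ] [DecidableEq ι] [DecidableEq κ] where
  V : Set E
  H : Set E
  e : ι → E
  h : κ → E
  ε : ι → ℝ
  δ : κ → ℝ
  /-- the form `g(P u, v)` -/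
  p : E → E → ℝ
  /-- the form `g((∇_x P) u, v)` -/
  k : E → E → E → ℝ
  /-- the form `g((∇²_{η, x} P) u, v)` -/
  N : E → E → E → E → ℝ
  /-- the differential of `f` -/
  df : E → ℝ
  /-- the Hessian of `f` -/
  hs : E → E → ℝ
  e_mem : ∀ a, e a ∈ V
  h_mem : ∀ i, h i ∈ H
  eps_sq : ∀ a, ε a * ε a = 1
  p_symm : ∀ u v, p u v = p v u
  p_frame : ∀ a b, p (e a) (e b) = if a = b then ε a else 0
  p_perp : ∀ u ∈ H, ∀ v, p u v = 0
  k_symm : ∀ x u v, k x u v = k x v u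
  k_V : ∀ x, ∀ u ∈ V, ∀ v ∈ V, k x u v = 0
  k_H : ∀ x, ∀ u ∈ H, ∀ v ∈ H, k x u v = 0
  N_symm : ∀ η x u v, N η x u v = N η x v u
  N_V : ∀ η x, ∀ u ∈ V, ∀ v ∈ V, N η x u v =
    -∑ i, δ i * (k x u (h i) * k η v (h i) + k η u (h i) * k x v (h i))
  N_H : ∀ η x, ∀ u ∈ H, ∀ v ∈ H, N η x u v =
    ∑ a, ε a * (k x u (e a) * k η v (e a) + k η u (e a) * k x v (e a))
  hs_symm : ∀ u v, hs u v = hs v u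
  df_expand : ∀ u ∈ V, ∑ a, ε a * (p u (e a) * df (e a)) = df u
  p_expand : ∀ u ∈ V, ∀ w, ∑ a, ε a * (p u (e a) * p w (e a)) = p u w
  hs_expand : ∀ u ∈ V, ∀ x, ∑ a, ε a * (p u (e a) * hs (e a) x) = hs u x
  k_expand₁ : ∀ u ∈ V, ∀ x y, ∑ a, ε a * (p u (e a) * k (e a) x y) = k u x y
  k_expand₂ : ∀ u ∈ V, ∀ x y, ∑ a, ε a * (p u (e a) * k x (e a) y) = k x u y

namespace Frame

variable {E ι κ : Type*} [Fintype ι] [Fintype κ] [DecidableEq ι] [DecidableEq κ]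
  (F : Frame E ι κ) (r : ℝ)

/-- The covariant derivative of the stretched metric. -/
def T (x u v : E) : ℝ := -2 / r ^ 3 * F.df x * F.p u v + (1 / r ^ 2 - 1) * F.k x u v

/-- The second covariant derivative of the stretched metric. -/
def D (η x u v : E) : ℝ :=
  (-2 / r ^ 3 * F.hs η x + 6 / r ^ 4 * (F.df η * F.df x)) * F.p u v +
    -2 / r ^ 3 * F.df x * F.k η u v + -2 / r ^ 3 * F.df η * F.k x u v +
    (1 / r ^ 2 - 1) * F.N η x u v

/-- The frame vectors. -/
def b : ι ⊕ κ → E := Sum.elim F.e F.h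

/-- The weights of the frame vectors with respect to the stretched metric. -/
def wt : ι ⊕ κ → ℝ := Sum.elim (fun a => r ^ 2 * F.ε a) F.δ

/-- The difference between the Ricci tensors of the stretched and of the original metric. -/
def ricciDiff (u w : E) : ℝ :=
  ∑ z, F.wt r z * ((F.D r (F.b z) u w (F.b z) + F.D r (F.b z) w u (F.b z) -
      F.D r (F.b z) (F.b z) u w - F.D r u w (F.b z) (F.b z)) / 2) +
    ∑ x, F.wt r x * (firstKind (F.T r) u w (F.b x) *
      ∑ z, F.wt r z * (F.T r (F.b x) (F.b z) (F.b z) / 2 - F.T r (F.b z) (F.b x) (F.b z))) +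
    ∑ z, F.wt r z * ∑ x, F.wt r x *
      (firstKind (F.T r) (F.b z) w (F.b x) * firstKind (F.T r) u (F.b z) (F.b x))

/-- `div^V(v)` -/
def divV (v : E) : ℝ := ∑ a, F.ε a * (-F.k (F.e a) (F.e a) v)

/-- `div^H(v)` -/
def divH (v : E) : ℝ := ∑ i, F.δ i * F.k (F.h i) (F.h i) v

theorem p_perp' {v : E} (hv : v ∈ F.H) (u : E) : F.p u v = 0 := by
  rw [F.p_symm, F.p_perp v hv]

/-- The trace of `P` is the rank of `V`; this is how `q` enters the formulas. -/
theorem sum_eps_p_frame (c : ℝ) : ∑ a, F.ε a * (c * F.p (F.e a) (F.e a)) = Fintype.card ι * c := by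
  have : ∀ a, F.ε a * (c * F.p (F.e a) (F.e a)) = c := by
    intro a
    rw [F.p_frame, if_pos rfl, mul_left_comm, F.eps_sq, mul_one]
  simp [this]

/-- The stretch does not change the metric on `H`, and `∇P` has no `H`-`H` block. -/
theorem T_HH {u v : E} (hu : u ∈ F.H) (hv : v ∈ F.H) (x : E) : F.T r x u v = 0 := by
  rw [T, F.p_perp u hu, F.k_H x u hu v hv]; ring

theorem T_VV {u v : E} (hu : u ∈ F.V) (hv : v ∈ F.V) (x : E) :
    F.T r x u v = -2 / r ^ 3 * F.df x * F.p u v := by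
  rw [T, F.k_V x u hu v hv]; ring

theorem T_VH (u : E) {v : E} (hv : v ∈ F.H) (x : E) :
    F.T r x u v = (1 / r ^ 2 - 1) * F.k x u v := by
  rw [T, F.p_perp' hv]; ring

theorem T_HV {u : E} (hu : u ∈ F.H) (v : E) (x : E) :
    F.T r x u v = (1 / r ^ 2 - 1) * F.k x v u := by
  rw [T, F.p_perp u hu, F.k_symm]; ring

/-- The trace of `T(x, ·, ·) / 2` contributes `-q / r df(x)`. The contraction of `T(·, x, ·)` over
`V` reproduces `df(x)` with the factor `2 / r`, which turns `q` into `q - 2`. -/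
theorem trace_T_V (hr : r ≠ 0) {x : E} (hx : x ∈ F.V) :
    ∑ z, F.wt r z * (F.T r x (F.b z) (F.b z) / 2 - F.T r (F.b z) x (F.b z)) =
      -(Fintype.card ι - 2) / r * F.df x - (1 / r ^ 2 - 1) * F.divH x := by
  simp only [Fintype.sum_sum_type, wt, b, Sum.elim_inl, Sum.elim_inr]
  have h1 : ∑ a, r ^ 2 * F.ε a * (F.T r x (F.e a) (F.e a) / 2 - F.T r (F.e a) x (F.e a)) =
      ∑ a, F.ε a * (-1 / r * F.df x * F.p (F.e a) (F.e a)) +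
      2 / r * ∑ a, F.ε a * (F.p x (F.e a) * F.df (F.e a)) := by
    rw [Finset.mul_sum, ← Finset.sum_add_distrib]
    refine Finset.sum_congr rfl fun a _ => ?_
    rw [F.T_VV r (F.e_mem a) (F.e_mem a), F.T_VV r hx (F.e_mem a)]
    field_simp
    ring
  have h2 : ∑ i, F.δ i * (F.T r x (F.h i) (F.h i) / 2 - F.T r (F.h i) x (F.h i)) =
      -((1 / r ^ 2 - 1) * F.divH x) := by
    rw [divH, Finset.mul_sum, ← Finset.sum_neg_distrib]
    refine Finset.sum_congr rfl fun i _ => ?_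
    rw [F.T_HH r (F.h_mem i) (F.h_mem i), F.T_VH r x (F.h_mem i), F.k_symm _ x]
    ring
  rw [h1, h2, F.sum_eps_p_frame, F.df_expand x hx]
  ring

/-- For `x ∈ H` the form `p x ·` vanishes, so `q` is not shifted by 2; `∇P` is traced over `V` and
gives `div^V`. -/
theorem trace_T_H (hr : r ≠ 0) {x : E} (hx : x ∈ F.H) :
    ∑ z, F.wt r z * (F.T r x (F.b z) (F.b z) / 2 - F.T r (F.b z) x (F.b z)) =
      -Fintype.card ι / r * F.df x + (1 - r ^ 2) * F.divV x := by
  simp only [Fintype.sum_sum_type, wt, b, Sum.elim_inl, Sum.elim_inr]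
  have h1 : ∑ a, r ^ 2 * F.ε a * (F.T r x (F.e a) (F.e a) / 2 - F.T r (F.e a) x (F.e a)) =
      ∑ a, F.ε a * (-1 / r * F.df x * F.p (F.e a) (F.e a)) + (1 - r ^ 2) * F.divV x := by
    rw [divV, Finset.mul_sum, ← Finset.sum_add_distrib]
    refine Finset.sum_congr rfl fun a _ => ?_
    rw [F.T_VV r (F.e_mem a) (F.e_mem a), F.T_HV r hx]
    field_simp
    ring
  have h2 : ∑ i, F.δ i * (F.T r x (F.h i) (F.h i) / 2 - F.T r (F.h i) x (F.h i)) = 0 := by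
    refine Finset.sum_eq_zero fun i _ => ?_
    rw [F.T_HH r (F.h_mem i) (F.h_mem i), F.T_HH r hx (F.h_mem i)]
    ring
  rw [h1, h2, F.sum_eps_p_frame]
  ring

/-- Both indices run over `V` and `H` separately, and the inner traces are evaluated. The two mixed
quadratic sums are merged with `V` as the outer index, so that they can be compared with other mixed
sums termwise. -/
theorem ricciDiff_eq (hr : r ≠ 0) (u w : E) : F.ricciDiff r u w =
    ∑ a, r ^ 2 * F.ε a * ((F.D r (F.e a) u w (F.e a) + F.D r (F.e a) w u (F.e a) -
      F.D r (F.e a) (F.e a) u w - F.D r u w (F.e a) (F.e a)) / 2) +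
    ∑ i, F.δ i * ((F.D r (F.h i) u w (F.h i) + F.D r (F.h i) w u (F.h i) -
      F.D r (F.h i) (F.h i) u w - F.D r u w (F.h i) (F.h i)) / 2) +
    ∑ a, r ^ 2 * F.ε a * (firstKind (F.T r) u w (F.e a) *
      (-(Fintype.card ι - 2) / r * F.df (F.e a) - (1 / r ^ 2 - 1) * F.divH (F.e a))) +
    ∑ i, F.δ i * (firstKind (F.T r) u w (F.h i) *
      (-Fintype.card ι / r * F.df (F.h i) + (1 - r ^ 2) * F.divV (F.h i))) +
    ∑ a, F.ε a * ∑ b, F.ε b * (r ^ 4 *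
      (firstKind (F.T r) (F.e a) w (F.e b) * firstKind (F.T r) u (F.e a) (F.e b))) +
    ∑ a, F.ε a * ∑ i, F.δ i * (r ^ 2 *
      (firstKind (F.T r) (F.e a) w (F.h i) * firstKind (F.T r) u (F.e a) (F.h i) +
       firstKind (F.T r) (F.h i) w (F.e a) * firstKind (F.T r) u (F.h i) (F.e a))) +
    ∑ i, F.δ i * ∑ j, F.δ j *
      (firstKind (F.T r) (F.h i) w (F.h j) * firstKind (F.T r) u (F.h i) (F.h j)) := by
  have hV : ∀ a, ∑ z, F.wt r z * (F.T r (F.e a) (F.b z) (F.b z) / 2 -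
      F.T r (F.b z) (F.e a) (F.b z)) = _ := fun a => F.trace_T_V r hr (F.e_mem a)
  have hH : ∀ i, ∑ z, F.wt r z * (F.T r (F.h i) (F.b z) (F.b z) / 2 -
      F.T r (F.b z) (F.h i) (F.b z)) = _ := fun i => F.trace_T_H r hr (F.h_mem i)
  have hb : ∀ (X Y : ι → κ → ℝ), ∑ a, F.ε a * ∑ i, F.δ i * (r ^ 2 * (X a i + Y a i)) =
      ∑ a, r ^ 2 * F.ε a * (∑ i, F.δ i * X a i) +
        ∑ i, F.δ i * (∑ a, r ^ 2 * F.ε a * Y a i) := by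
    intro X Y
    simp only [Finset.mul_sum]
    rw [Finset.sum_comm (s := Finset.univ (α := κ)), ← Finset.sum_add_distrib]
    refine Finset.sum_congr rfl fun a _ => ?_
    rw [← Finset.sum_add_distrib]
    refine Finset.sum_congr rfl fun i _ => ?_
    ring
  have ha : ∀ (X : ι → ι → ℝ), ∑ a, F.ε a * ∑ b, F.ε b * (r ^ 4 * X a b) =
      ∑ a, r ^ 2 * F.ε a * (∑ b, r ^ 2 * F.ε b * X a b) := by
    intro X
    simp only [Finset.mul_sum]
    refine Finset.sum_congr rfl fun a _ => Finset.sum_congr rfl fun b _ => ?_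
    ring
  rw [hb, ha, ricciDiff, Fintype.sum_sum_type, Fintype.sum_sum_type, Fintype.sum_sum_type]
  simp only [b, wt, Sum.elim_inl, Sum.elim_inr] at hV hH ⊢
  simp only [hV, hH]
  simp only [Fintype.sum_sum_type, Sum.elim_inl, Sum.elim_inr, mul_add, Finset.sum_add_distrib]
  ring

end Frame

end Coord

end

/-! ### The algebraic identity for two arguments in `H`. -/

section

namespace Coord

namespace Frame

variable {E ι κ : Type*} [Fintype ι] [Fintype κ] [DecidableEq ι] [DecidableEq κ]
  (F : Frame E ι κ) (r : ℝ)

/-- `Sw_V(u, v, w)` -/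
def swV (u v w : E) : ℝ := F.k u v w + F.k v u w

/-- `Tw_V(u, v, w)` -/
def twV (u v w : E) : ℝ := F.k u v w - F.k v u w

/-- `Sw_H(u, v, w)` -/
def swH (u v w : E) : ℝ := -F.k u v w - F.k v u w

/-- `Tw_H(u, v, w)` -/
def twH (u v w : E) : ℝ := F.k v u w - F.k u v w

theorem sum_swap (X : ι → κ → ℝ) :
    ∑ i, F.δ i * ∑ a, F.ε a * X a i = ∑ a, F.ε a * ∑ i, F.δ i * X a i := by
  simp only [Finset.mul_sum]
  rw [Finset.sum_comm]
  exact Finset.sum_congr rfl fun a _ => Finset.sum_congr rfl fun i _ => by ring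

theorem sum_swap_VV (X : ι → ι → ℝ) :
    ∑ a, F.ε a * ∑ b, F.ε b * X b a = ∑ a, F.ε a * ∑ b, F.ε b * X a b := by
  simp only [Finset.mul_sum]
  rw [Finset.sum_comm]
  exact Finset.sum_congr rfl fun a _ => Finset.sum_congr rfl fun i _ => by ring

theorem sum_swap_HH (X : κ → κ → ℝ) :
    ∑ a, F.δ a * ∑ b, F.δ b * X b a = ∑ a, F.δ a * ∑ b, F.δ b * X a b := by
  simp only [Finset.mul_sum]
  rw [Finset.sum_comm]
  exact Finset.sum_congr rfl fun a _ => Finset.sum_congr rfl fun i _ => by ring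

/-- `p` is diagonal in the frame and the signs square to 1, so a double sum containing it collapses.
-/
theorem sum_p_frame (X : ι → ι → ℝ) :
    ∑ a, F.ε a * ∑ b, F.ε b * (F.p (F.e a) (F.e b) * X a b) = ∑ a, F.ε a * X a a := by
  refine Finset.sum_congr rfl fun a _ => ?_
  rw [Finset.sum_eq_single a]
  · rw [F.p_frame, if_pos rfl, ← mul_assoc (F.ε a) (F.ε a), F.eps_sq, one_mul]
  · intro b _ hb
    rw [F.p_frame, if_neg (Ne.symm hb)]
    ring
  · simp

/-- `∇²P` survives only in `N(e, u, w, e)` and `N(e, w, u, e)`, which pair `H` with `V` and give the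
`Q^H` terms; its diagonal blocks become products of components of `∇P`. Each of the seven sums of
`ricciDiff_eq` and each trace on the right is written in the same elementary sums. -/
theorem ricciDiff_HH (hr : r ≠ 0) {u w : E} (hu : u ∈ F.H) (hw : w ∈ F.H) :
    F.ricciDiff r u w =
      Fintype.card ι / r * F.hs u w - 2 * Fintype.card ι / r ^ 2 * (F.df u * F.df w)
      + (Fintype.card ι * (1 - r ^ 2) + 2 * r ^ 2) / (2 * r) *
          ∑ a, F.ε a * (F.swH u w (F.e a) * F.df (F.e a))
      + 1 / r * (F.divV w * F.df u)
      - r ^ 2 * (1 - r ^ 2) / 4 *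
          ∑ a, F.ε a * ∑ b, F.ε b * (F.twV (F.e a) (F.e b) u * F.twV (F.e a) (F.e b) w)
      + 1 / r * (F.divV u * F.df w)
      - (1 - r ^ 2) / 2 *
          ∑ a, F.ε a * (-F.N (F.e a) u w (F.e a) + -F.N (F.e a) w u (F.e a))
      - (1 - r ^ 2) / 2 * ∑ a, F.ε a * (F.swH u w (F.e a) * F.divH (F.e a))
      - (1 - r ^ 2) / 4 *
          ∑ a, F.ε a * ∑ b, F.ε b * (F.swV (F.e a) (F.e b) u * F.swV (F.e a) (F.e b) w)
      - (1 - r ^ 2) / 4 *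
          ∑ a, F.ε a * ∑ b, F.ε b * (F.swV (F.e a) (F.e b) u * F.twV (F.e a) (F.e b) w +
            F.swV (F.e a) (F.e b) w * F.twV (F.e a) (F.e b) u)
      + (1 - r ^ 2) / 4 *
          ∑ a, F.ε a * ∑ i, F.δ i * (F.swH u (F.h i) (F.e a) * F.twH w (F.h i) (F.e a) +
            F.swH w (F.h i) (F.e a) * F.twH u (F.h i) (F.e a))
      - (1 - r ^ 2) / (2 * r ^ 2) *
          ∑ a, F.ε a * ∑ i, F.δ i * (F.twH u (F.h i) (F.e a) * F.twH w (F.h i) (F.e a)) := by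
  have hpu := F.p_perp u hu
  have hpw := F.p_perp w hw
  have hpu' := F.p_perp' hu
  have hpw' := F.p_perp' hw
  -- The elementary sums are made opaque, so that the final identity is rational in `r` and
  -- polynomial in these names.
  obtain ⟨P1, hP1⟩ : ∃ P1, P1 = ∑ a, F.ε a * ∑ b, F.ε b *
    (F.k (F.e a) (F.e b) u * F.k (F.e a) (F.e b) w) := ⟨_, rfl⟩
  obtain ⟨P2, hP2⟩ : ∃ P2, P2 = ∑ a, F.ε a * ∑ b, F.ε b *
    (F.k (F.e a) (F.e b) u * F.k (F.e b) (F.e a) w) := ⟨_, rfl⟩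
  -- The same sums with the two indices exchanged; termwise comparison of double sums over `V` needs
  -- both orders.
  have hP1' : P1 = ∑ a, F.ε a * ∑ b, F.ε b *
    (F.k (F.e b) (F.e a) u * F.k (F.e b) (F.e a) w) := by
    rw [hP1, ← F.sum_swap_VV]
  have hP2' : P2 = ∑ a, F.ε a * ∑ b, F.ε b *
    (F.k (F.e b) (F.e a) u * F.k (F.e a) (F.e b) w) := by
    rw [hP2, ← F.sum_swap_VV]
  obtain ⟨M1, hM1⟩ : ∃ M1, M1 = ∑ a, F.ε a * ∑ i, F.δ i *
    (F.k u (F.h i) (F.e a) * F.k w (F.h i) (F.e a)) := ⟨_, rfl⟩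
  obtain ⟨M2, hM2⟩ : ∃ M2, M2 = ∑ a, F.ε a * ∑ i, F.δ i *
    (F.k u (F.h i) (F.e a) * F.k (F.h i) w (F.e a)) := ⟨_, rfl⟩
  obtain ⟨M3, hM3⟩ : ∃ M3, M3 = ∑ a, F.ε a * ∑ i, F.δ i *
    (F.k (F.h i) u (F.e a) * F.k w (F.h i) (F.e a)) := ⟨_, rfl⟩
  obtain ⟨M4, hM4⟩ : ∃ M4, M4 = ∑ a, F.ε a * ∑ i, F.δ i *
    (F.k (F.h i) u (F.e a) * F.k (F.h i) w (F.e a)) := ⟨_, rfl⟩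
  obtain ⟨X1, hX1⟩ : ∃ X1, X1 = ∑ a, F.ε a * (F.k u w (F.e a) * F.df (F.e a)) := ⟨_, rfl⟩
  obtain ⟨X2, hX2⟩ : ∃ X2, X2 = ∑ a, F.ε a * (F.k w u (F.e a) * F.df (F.e a)) := ⟨_, rfl⟩
  obtain ⟨E1, hE1⟩ : ∃ E1, E1 = ∑ a, F.ε a * (F.k u w (F.e a) * F.divH (F.e a)) := ⟨_, rfl⟩
  obtain ⟨E2, hE2⟩ : ∃ E2, E2 = ∑ a, F.ε a * (F.k w u (F.e a) * F.divH (F.e a)) := ⟨_, rfl⟩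
  obtain ⟨N1, hN1⟩ : ∃ N1, N1 = ∑ a, F.ε a * F.N (F.e a) u w (F.e a) := ⟨_, rfl⟩
  obtain ⟨N2, hN2⟩ : ∃ N2, N2 = ∑ a, F.ε a * F.N (F.e a) w u (F.e a) := ⟨_, rfl⟩
  have hE1' : E1 = ∑ a, F.ε a * ∑ i, F.δ i * (F.k u w (F.e a) * F.k (F.h i) (F.h i) (F.e a)) := by
    rw [hE1]
    refine Finset.sum_congr rfl fun a _ => ?_
    rw [divH, Finset.mul_sum]
    exact congrArg _ (Finset.sum_congr rfl fun i _ => by ring)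
  have hE2' : E2 = ∑ a, F.ε a * ∑ i, F.δ i * (F.k w u (F.e a) * F.k (F.h i) (F.h i) (F.e a)) := by
    rw [hE2]
    refine Finset.sum_congr rfl fun a _ => ?_
    rw [divH, Finset.mul_sum]
    exact congrArg _ (Finset.sum_congr rfl fun i _ => by ring)
  have B1V : ∑ a, r ^ 2 * F.ε a * ((F.D r (F.e a) u w (F.e a) + F.D r (F.e a) w u (F.e a) -
      F.D r (F.e a) (F.e a) u w - F.D r u w (F.e a) (F.e a)) / 2) =
      1 / r * F.df u * F.divV w + 1 / r * F.df w * F.divV u + -1 / r * X1 + -1 / r * X2 +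
      (1 - r ^ 2) / 2 * N1 + (1 - r ^ 2) / 2 * N2 + (r ^ 2 - 1) * P1 + (1 - r ^ 2) * M1 +
      (1 / r * F.hs u w - 3 / r ^ 2 * (F.df u * F.df w)) * Fintype.card ι := by
    -- `P` and `M` stand for the inner sums that `n1` and `n2` produce; kept arbitrary, they let the
    -- comparison be made for each `a` separately.
    have key : ∀ (P M : ι → ℝ), ∑ a, r ^ 2 * F.ε a * ((-2 / r ^ 3 * F.df u * F.k (F.e a) (F.e a) w +
        -2 / r ^ 3 * F.df (F.e a) * F.k u w (F.e a) + (1 / r ^ 2 - 1) * F.N (F.e a) u w (F.e a) +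
        (-2 / r ^ 3 * F.df w * F.k (F.e a) (F.e a) u +
        -2 / r ^ 3 * F.df (F.e a) * F.k w u (F.e a) + (1 / r ^ 2 - 1) * F.N (F.e a) w u (F.e a)) -
        (1 / r ^ 2 - 1) * (2 * P a) - ((-2 / r ^ 3 * F.hs u w + 6 / r ^ 4 * (F.df u * F.df w)) *
          F.p (F.e a) (F.e a) + (1 / r ^ 2 - 1) * (-2 * M a))) / 2) =
        1 / r * F.df u * F.divV w + 1 / r * F.df w * F.divV u + -1 / r * X1 + -1 / r * X2 +
      (1 - r ^ 2) / 2 * N1 + (1 - r ^ 2) / 2 * N2 + (r ^ 2 - 1) * ∑ a, F.ε a * P a +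
      (1 - r ^ 2) * ∑ a, F.ε a * M a +
      (1 / r * F.hs u w - 3 / r ^ 2 * (F.df u * F.df w)) * Fintype.card ι := by
      intro P M
      rw [mul_comm _ (Fintype.card ι : ℝ), ← F.sum_eps_p_frame]
      simp only [divV, hX1, hX2, hN1, hN2, Finset.mul_sum, ← Finset.sum_add_distrib]
      refine Finset.sum_congr rfl fun a _ => ?_
      field_simp
      ring
    rw [hP1, hM1, ← key]
    refine Finset.sum_congr rfl fun a _ => ?_
    -- Here and in `n2` a diagonal block of `∇²P` is replaced by its quadratic expression.
    have n1 : F.N (F.e a) (F.e a) u w =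
        2 * ∑ b, F.ε b * (F.k (F.e a) (F.e b) u * F.k (F.e a) (F.e b) w) := by
      rw [F.N_H _ _ _ hu _ hw, Finset.mul_sum]
      refine Finset.sum_congr rfl fun b _ => ?_
      rw [F.k_symm _ u, F.k_symm _ w]; ring
    have n2 : F.N u w (F.e a) (F.e a) =
        -2 * ∑ i, F.δ i * (F.k u (F.h i) (F.e a) * F.k w (F.h i) (F.e a)) := by
      rw [F.N_V _ _ _ (F.e_mem a) _ (F.e_mem a), Finset.mul_sum, ← Finset.sum_neg_distrib]
      refine Finset.sum_congr rfl fun b _ => ?_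
      rw [F.k_symm _ (F.e a), F.k_symm _ (F.e a)]; ring
    simp only [D, hpu, hpw, n1, n2, F.k_H _ u hu w hw, F.k_V _ _ (F.e_mem a) _ (F.e_mem a)]
    rw [F.k_symm _ u (F.e a), F.k_symm _ w (F.e a)]
    ring
  -- All second derivatives of `P` in this sum have both last arguments in `H`, so they are
  -- quadratic in `∇P` and no `Q` remains.
  have B1H : ∑ i, F.δ i * ((F.D r (F.h i) u w (F.h i) + F.D r (F.h i) w u (F.h i) -
      F.D r (F.h i) (F.h i) u w - F.D r u w (F.h i) (F.h i)) / 2) =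
      (1 / r ^ 2 - 1) / 2 * E1 + (1 / r ^ 2 - 1) / 2 * E2 + (1 / r ^ 2 - 1) / 2 * M2 +
      (1 / r ^ 2 - 1) / 2 * M3 + -(1 / r ^ 2 - 1) * M4 + -(1 / r ^ 2 - 1) * M1 := by
    have h1 : ∀ i, (F.D r (F.h i) u w (F.h i) + F.D r (F.h i) w u (F.h i) -
      F.D r (F.h i) (F.h i) u w - F.D r u w (F.h i) (F.h i)) / 2 = ∑ a, F.ε a *
      ((1 / r ^ 2 - 1) / 2 * (F.k u w (F.e a) * F.k (F.h i) (F.h i) (F.e a) +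
        F.k w u (F.e a) * F.k (F.h i) (F.h i) (F.e a) + F.k u (F.h i) (F.e a) * F.k (F.h i) w (F.e a)
        + F.k (F.h i) u (F.e a) * F.k w (F.h i) (F.e a)
        - 2 * (F.k (F.h i) u (F.e a) * F.k (F.h i) w (F.e a))
        - 2 * (F.k u (F.h i) (F.e a) * F.k w (F.h i) (F.e a)))) := by
      intro i
      have hi := F.h_mem i
      simp only [D, hpu, hpw, F.p_perp _ hi, F.k_H _ u hu w hw, F.k_H _ u hu _ hi,
        F.k_H _ w hw _ hi, F.k_H _ _ hi _ hi, F.N_H _ _ _ hi _ hi, F.N_H _ _ _ hu _ hi,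
        F.N_H _ _ _ hw _ hi, F.N_H _ _ _ hu _ hw]
      simp only [mul_zero, zero_add, Finset.mul_sum, ← Finset.sum_add_distrib,
        ← Finset.sum_sub_distrib, Finset.sum_div]
      refine Finset.sum_congr rfl fun a _ => ?_
      ring
    simp only [h1]
    rw [F.sum_swap]
    simp only [hE1', hE2', hM1, hM2, hM3, hM4, Finset.mul_sum, ← Finset.sum_add_distrib]
    refine Finset.sum_congr rfl fun a _ => Finset.sum_congr rfl fun i _ => ?_
    ring
  have B2V : ∑ a, r ^ 2 * F.ε a * (firstKind (F.T r) u w (F.e a) *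
      (-(Fintype.card ι - 2) / r * F.df (F.e a) - (1 / r ^ 2 - 1) * F.divH (F.e a))) =
      -(1 - r ^ 2) * (Fintype.card ι - 2) / (2 * r) * X1 +
      -(1 - r ^ 2) * (Fintype.card ι - 2) / (2 * r) * X2 +
      -(1 - r ^ 2) * (1 / r ^ 2 - 1) / 2 * E1 + -(1 - r ^ 2) * (1 / r ^ 2 - 1) / 2 * E2 := by
    simp only [hE1, hE2, hX1, hX2, Finset.mul_sum, ← Finset.sum_add_distrib]
    refine Finset.sum_congr rfl fun a _ => ?_
    rw [firstKind, F.T_HV r hw, F.T_HV r hu, F.T_HH r hu hw, F.k_symm _ (F.e a) w,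
      F.k_symm _ (F.e a) u]
    field_simp
    ring
  have B2H : ∑ i, F.δ i * (firstKind (F.T r) u w (F.h i) *
      (-Fintype.card ι / r * F.df (F.h i) + (1 - r ^ 2) * F.divV (F.h i))) = 0 := by
    refine Finset.sum_eq_zero fun i _ => ?_
    rw [firstKind, F.T_HH r hw (F.h_mem i), F.T_HH r hu (F.h_mem i), F.T_HH r hu hw]
    ring
  have B3V : ∑ a, F.ε a * ∑ b, F.ε b * (r ^ 4 *
      (firstKind (F.T r) (F.e a) w (F.e b) * firstKind (F.T r) u (F.e a) (F.e b))) =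
      (1 - r ^ 2) ^ 2 / 2 * P1 + -(1 - r ^ 2) ^ 2 / 2 * P2 +
      1 / r ^ 2 * (F.df u * F.df w) * Fintype.card ι := by
    -- The part of the product containing `p(e_a, e_b)` lives on the diagonal `a = b`, where the
    -- differences of `k` vanish and only the `df ⊗ df` term is left.
    have h1 : ∑ a, F.ε a * ∑ b, F.ε b * (F.p (F.e a) (F.e b) *
        (-(r * (1 / r ^ 2 - 1) / 2) * (F.df u * (F.k (F.e a) (F.e b) w - F.k (F.e b) (F.e a) w)
         + F.df w * (F.k (F.e a) (F.e b) u - F.k (F.e b) (F.e a) u)) +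
         1 / r ^ 2 * (F.df u * F.df w) * F.p (F.e a) (F.e b))) =
        1 / r ^ 2 * (F.df u * F.df w) * Fintype.card ι := by
      rw [F.sum_p_frame, mul_comm _ (Fintype.card ι : ℝ), ← F.sum_eps_p_frame]
      refine Finset.sum_congr rfl fun a _ => ?_
      ring
    -- Half of each sum is written with exchanged indices, since the expanded product contains both
    -- orders.
    have e1 : (1 - r ^ 2) ^ 2 / 2 * P1 = (1 - r ^ 2) ^ 2 / 4 * P1 + (1 - r ^ 2) ^ 2 / 4 * P1 := by
      ring
    have e2 : -(1 - r ^ 2) ^ 2 / 2 * P2 =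
        -(1 - r ^ 2) ^ 2 / 4 * P2 + -(1 - r ^ 2) ^ 2 / 4 * P2 := by
      ring
    rw [← h1, e1, e2]
    nth_rewrite 1 [hP1]
    rw [hP1']
    nth_rewrite 1 [hP2]
    rw [hP2']
    simp only [Finset.mul_sum, ← Finset.sum_add_distrib]
    refine Finset.sum_congr rfl fun a _ => Finset.sum_congr rfl fun b _ => ?_
    rw [firstKind, firstKind, F.T_HV r hw, F.T_VH r _ hw, F.T_HV r hu, F.T_HV r hu,
      F.T_VV r (F.e_mem _) (F.e_mem _), F.T_VV r (F.e_mem _) (F.e_mem _)]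
    field_simp
    ring
  have B3M : ∑ a, F.ε a * ∑ i, F.δ i * (r ^ 2 *
      (firstKind (F.T r) (F.e a) w (F.h i) * firstKind (F.T r) u (F.e a) (F.h i) +
       firstKind (F.T r) (F.h i) w (F.e a) * firstKind (F.T r) u (F.h i) (F.e a))) =
      (1 - r ^ 2) * (1 / r ^ 2 - 1) / 2 * M1 + (1 - r ^ 2) * (1 / r ^ 2 - 1) / 2 * M4 := by
    simp only [hM1, hM4, Finset.mul_sum, ← Finset.sum_add_distrib]
    refine Finset.sum_congr rfl fun a _ => Finset.sum_congr rfl fun i _ => ?_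
    have hi := F.h_mem i
    simp only [firstKind, F.T_HH r hw hi, F.T_HH r hu hi, F.T_HH r hi hw,
      F.T_HV r hw, F.T_HV r hu, F.T_HV r hi, F.T_VH r _ hw, F.T_VH r _ hi,
      F.k_symm _ (F.e a) w, F.k_symm _ (F.e a) u, F.k_symm _ (F.e a) (F.h i)]
    field_simp
    ring
  have B3H : ∑ i, F.δ i * ∑ j, F.δ j *
      (firstKind (F.T r) (F.h i) w (F.h j) * firstKind (F.T r) u (F.h i) (F.h j)) = 0 := by
    refine Finset.sum_eq_zero fun i _ => ?_
    rw [Finset.sum_eq_zero, mul_zero]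
    intro j _
    rw [firstKind, F.T_HH r hw (F.h_mem j), F.T_HH r (F.h_mem i) (F.h_mem j),
      F.T_HH r (F.h_mem i) hw]
    ring
  have R1 : ∑ a, F.ε a * (F.swH u w (F.e a) * F.df (F.e a)) = -1 * X1 + -1 * X2 := by
    simp only [hX1, hX2, Finset.mul_sum, ← Finset.sum_add_distrib, swH]
    exact Finset.sum_congr rfl fun a _ => by ring
  have R2 : ∑ a, F.ε a * ∑ b, F.ε b * (F.twV (F.e a) (F.e b) u * F.twV (F.e a) (F.e b) w) =
      P1 + -1 * P2 + P1 + -1 * P2 := by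
    nth_rewrite 1 [hP1]
    rw [hP1']
    nth_rewrite 1 [hP2]
    rw [hP2']
    simp only [Finset.mul_sum, ← Finset.sum_add_distrib, twV]
    exact Finset.sum_congr rfl fun a _ => Finset.sum_congr rfl fun b _ => by ring
  have R3 : ∑ a, F.ε a * (-F.N (F.e a) u w (F.e a) + -F.N (F.e a) w u (F.e a)) =
      -1 * N1 + -1 * N2 := by
    simp only [hN1, hN2, Finset.mul_sum, ← Finset.sum_add_distrib]
    exact Finset.sum_congr rfl fun a _ => by ring
  have R4 : ∑ a, F.ε a * (F.swH u w (F.e a) * F.divH (F.e a)) = -1 * E1 + -1 * E2 := by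
    simp only [hE1, hE2, Finset.mul_sum, ← Finset.sum_add_distrib, swH]
    exact Finset.sum_congr rfl fun a _ => by ring
  have R5 : ∑ a, F.ε a * ∑ b, F.ε b * (F.swV (F.e a) (F.e b) u * F.swV (F.e a) (F.e b) w) =
      P1 + P2 + P1 + P2 := by
    nth_rewrite 1 [hP1]
    rw [hP1']
    nth_rewrite 1 [hP2]
    rw [hP2']
    simp only [Finset.mul_sum, ← Finset.sum_add_distrib, swV]
    exact Finset.sum_congr rfl fun a _ => Finset.sum_congr rfl fun b _ => by ring
  -- This trace is zero, as `Sw_V` is symmetric and `Tw_V` antisymmetric in the summation indices;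
  -- the two halves of the right side use the two orders of `P1`.
  have R6 : ∑ a, F.ε a * ∑ b, F.ε b * (F.swV (F.e a) (F.e b) u * F.twV (F.e a) (F.e b) w +
      F.swV (F.e a) (F.e b) w * F.twV (F.e a) (F.e b) u) = 2 * P1 + -2 * P1 := by
    nth_rewrite 1 [hP1]
    rw [hP1']
    simp only [Finset.mul_sum, ← Finset.sum_add_distrib, swV, twV]
    exact Finset.sum_congr rfl fun a _ => Finset.sum_congr rfl fun b _ => by ring
  have R7 : ∑ a, F.ε a * ∑ i, F.δ i * (F.swH u (F.h i) (F.e a) * F.twH w (F.h i) (F.e a) +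
      F.swH w (F.h i) (F.e a) * F.twH u (F.h i) (F.e a)) = 2 * M1 + -2 * M4 := by
    simp only [hM1, hM4, Finset.mul_sum, ← Finset.sum_add_distrib, swH, twH]
    exact Finset.sum_congr rfl fun a _ => Finset.sum_congr rfl fun b _ => by ring
  have R8 : ∑ a, F.ε a * ∑ i, F.δ i * (F.twH u (F.h i) (F.e a) * F.twH w (F.h i) (F.e a)) =
      M1 + -1 * M2 + -1 * M3 + M4 := by
    simp only [hM1, hM2, hM3, hM4, Finset.mul_sum, ← Finset.sum_add_distrib, twH]
    exact Finset.sum_congr rfl fun a _ => Finset.sum_congr rfl fun b _ => by ring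
  rw [F.ricciDiff_eq r hr, B1V, B1H, B2V, B2H, B3V, B3M, B3H, R1, R2, R3, R4, R5, R6, R7, R8]
  field_simp
  ring

end Frame

end Coord

end

/-! ### The algebraic identity for two arguments in `V`. -/

section

namespace Coord

namespace Frame

variable {E ι κ : Type*} [Fintype ι] [Fintype κ] [DecidableEq ι] [DecidableEq κ]
  (F : Frame E ι κ) (r : ℝ)

/-- The partial Laplacian over `V`. -/
def lapV : ℝ := ∑ a, F.ε a * (F.hs (F.e a) (F.e a) +
  ∑ i, F.δ i * (F.k (F.e a) (F.e a) (F.h i) * F.df (F.h i)))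

/-- The partial Laplacian over `H`. -/
def lapH : ℝ := ∑ i, F.δ i * (F.hs (F.h i) (F.h i) -
  ∑ a, F.ε a * (F.k (F.h i) (F.h i) (F.e a) * F.df (F.e a)))

theorem divH_expand {u : E} (hu : u ∈ F.V) :
    ∑ a, F.ε a * (F.p u (F.e a) * F.divH (F.e a)) = F.divH u := by
  have h : ∀ a, F.p u (F.e a) * F.divH (F.e a) =
      ∑ i, F.δ i * (F.p u (F.e a) * F.k (F.h i) (F.e a) (F.h i)) := by
    intro a
    rw [divH, Finset.mul_sum]
    refine Finset.sum_congr rfl fun i _ => ?_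
    rw [F.k_symm _ (F.h i)]
    ring
  simp only [h]
  rw [← F.sum_swap]
  simp only [F.k_expand₂ u hu]
  exact Finset.sum_congr rfl fun i _ => by rw [F.k_symm]

theorem sum_mul_divV (X : κ → ℝ) : ∑ i, F.δ i * (X i * F.divV (F.h i)) =
    ∑ a, F.ε a * ∑ i, F.δ i * (-(X i * F.k (F.e a) (F.e a) (F.h i))) := by
  rw [← F.sum_swap]
  refine Finset.sum_congr rfl fun i _ => ?_
  rw [divV, Finset.mul_sum]
  exact congrArg _ (Finset.sum_congr rfl fun a _ => by ring)

theorem sum_mul_divH (X : ι → ℝ) : ∑ a, F.ε a * (X a * F.divH (F.e a)) =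
    ∑ a, F.ε a * ∑ i, F.δ i * (X a * F.k (F.h i) (F.h i) (F.e a)) := by
  refine Finset.sum_congr rfl fun a _ => ?_
  rw [divH, Finset.mul_sum]
  exact congrArg _ (Finset.sum_congr rfl fun i _ => by ring)

/-- The first-order part of the Laplacian is `df` of the `H`-vector `∑ ε_a (∇_{e_a} P) e_a`, which
is the negative of the vector dual to `div^V`. -/
theorem lapV_eq : F.lapV = ∑ a, F.ε a * F.hs (F.e a) (F.e a) -
    ∑ i, F.δ i * (F.divV (F.h i) * F.df (F.h i)) := by
  have h : ∀ i, F.divV (F.h i) * F.df (F.h i) = F.df (F.h i) * F.divV (F.h i) :=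
    fun i => mul_comm _ _
  simp only [h]
  rw [F.sum_mul_divV, ← Finset.sum_sub_distrib, lapV]
  refine Finset.sum_congr rfl fun a _ => ?_
  rw [mul_add, sub_eq_add_neg, ← mul_neg, ← Finset.sum_neg_distrib]
  congr 2
  exact Finset.sum_congr rfl fun i _ => by ring

theorem lapH_eq : F.lapH = ∑ i, F.δ i * F.hs (F.h i) (F.h i) -
    ∑ a, F.ε a * (F.divH (F.e a) * F.df (F.e a)) := by
  have h : ∀ i, F.divH (F.e i) * F.df (F.e i) = F.df (F.e i) * F.divH (F.e i) :=
    fun i => mul_comm _ _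
  simp only [h]
  rw [F.sum_mul_divH, ← F.sum_swap, ← Finset.sum_sub_distrib, lapH]
  refine Finset.sum_congr rfl fun i _ => ?_
  rw [mul_sub]
  congr 2
  exact Finset.sum_congr rfl fun i _ => by ring

theorem sum_VV_prod (X Y : ι → ℝ) : ∑ a, F.ε a * ∑ b, F.ε b * (X a * Y b) =
    (∑ a, F.ε a * X a) * ∑ b, F.ε b * Y b := by
  rw [Finset.sum_mul]
  refine Finset.sum_congr rfl fun a _ => ?_
  rw [mul_assoc]
  congr 1
  rw [Finset.mul_sum]
  exact Finset.sum_congr rfl fun b _ => by ring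

/-- The factor `r²` comes from stretching both arguments by `f`. Now the mixed block of `∇²P` occurs
only in the trace over `H`, while the trace over `V` is quadratic in `∇P`. New compared with `H` are
the terms with `p`, contracted by the expansion of `u` and `w` in the frame of `V`. -/
theorem ricciDiff_VV (hr : r ≠ 0) {u w : E} (hu : u ∈ F.V) (hw : w ∈ F.V) :
    r ^ 2 * F.ricciDiff r u w =
      (Fintype.card ι - 2) * r * F.hs u w
      + r * F.lapV * F.p u w
      + 1 / r * F.lapH * F.p u w
      + 1 / r * (∑ i, F.δ i * (F.divV (F.h i) * F.df (F.h i))) * F.p u w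
      + r * (∑ a, F.ε a * (F.divH (F.e a) * F.df (F.e a))) * F.p u w
      - r * (F.divH w * F.df u)
      - r * (F.divH u * F.df w)
      - 1 / r * ∑ i, F.δ i * (F.swV u w (F.h i) * F.df (F.h i))
      - (Fintype.card ι - 1) * (∑ a, F.ε a * (F.df (F.e a) * F.df (F.e a))) * F.p u w
      - (Fintype.card ι + 1) / r ^ 2 * (∑ i, F.δ i * (F.df (F.h i) * F.df (F.h i))) * F.p u w
      - (Fintype.card ι - 2) * (1 - r ^ 2) / (2 * r) *
          ∑ i, F.δ i * (F.swV u w (F.h i) * F.df (F.h i))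
      + (1 - r ^ 2) / 2 * ∑ i, F.δ i * (F.swV u w (F.h i) * F.divV (F.h i))
      - (1 - r ^ 2) / 2 *
          ∑ i, F.δ i * (-F.N (F.h i) w (F.h i) u + -F.N (F.h i) u (F.h i) w)
      - (1 - r ^ 2) / 4 *
          ∑ i, F.δ i * ∑ a, F.ε a * (F.swV u (F.e a) (F.h i) * F.twV w (F.e a) (F.h i) +
            F.swV w (F.e a) (F.h i) * F.twV u (F.e a) (F.h i))
      + (1 - r ^ 2) / 4 *
          ∑ i, F.δ i * ∑ j, F.δ j * (F.swH (F.h i) (F.h j) u * F.swH (F.h i) (F.h j) w)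
      + (1 - r ^ 2) / 4 *
          ∑ i, F.δ i * ∑ j, F.δ j * (F.swH (F.h i) (F.h j) u * F.twH (F.h i) (F.h j) w +
            F.swH (F.h i) (F.h j) w * F.twH (F.h i) (F.h j) u)
      + r ^ 2 * (1 - r ^ 2) / 2 *
          ∑ i, F.δ i * ∑ a, F.ε a * (F.twV u (F.e a) (F.h i) * F.twV w (F.e a) (F.h i))
      + (1 - r ^ 2) / (4 * r ^ 2) *
          ∑ i, F.δ i * ∑ j, F.δ j * (F.twH (F.h i) (F.h j) w * F.twH (F.h i) (F.h j) u) := by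
  obtain ⟨L1, hL1⟩ : ∃ L1, L1 = ∑ i, F.δ i * ∑ j, F.δ j *
    (F.k (F.h i) (F.h j) u * F.k (F.h i) (F.h j) w) := ⟨_, rfl⟩
  obtain ⟨L2, hL2⟩ : ∃ L2, L2 = ∑ i, F.δ i * ∑ j, F.δ j *
    (F.k (F.h i) (F.h j) u * F.k (F.h j) (F.h i) w) := ⟨_, rfl⟩
  have hL1' : L1 = ∑ i, F.δ i * ∑ j, F.δ j *
    (F.k (F.h j) (F.h i) u * F.k (F.h j) (F.h i) w) := by rw [hL1, ← F.sum_swap_HH]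
  have hL2' : L2 = ∑ i, F.δ i * ∑ j, F.δ j *
    (F.k (F.h j) (F.h i) u * F.k (F.h i) (F.h j) w) := by rw [hL2, ← F.sum_swap_HH]
  obtain ⟨M1, hM1⟩ : ∃ M1, M1 = ∑ a, F.ε a * ∑ i, F.δ i *
    (F.k u (F.e a) (F.h i) * F.k w (F.e a) (F.h i)) := ⟨_, rfl⟩
  obtain ⟨M2, hM2⟩ : ∃ M2, M2 = ∑ a, F.ε a * ∑ i, F.δ i *
    (F.k u (F.e a) (F.h i) * F.k (F.e a) w (F.h i)) := ⟨_, rfl⟩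
  obtain ⟨M3, hM3⟩ : ∃ M3, M3 = ∑ a, F.ε a * ∑ i, F.δ i *
    (F.k (F.e a) u (F.h i) * F.k w (F.e a) (F.h i)) := ⟨_, rfl⟩
  obtain ⟨M4, hM4⟩ : ∃ M4, M4 = ∑ a, F.ε a * ∑ i, F.δ i *
    (F.k (F.e a) u (F.h i) * F.k (F.e a) w (F.h i)) := ⟨_, rfl⟩
  obtain ⟨J1, hJ1⟩ : ∃ J, J = ∑ i, F.δ i * (F.k u w (F.h i) * F.df (F.h i)) := ⟨_, rfl⟩
  obtain ⟨J2, hJ2⟩ : ∃ J, J = ∑ i, F.δ i * (F.k w u (F.h i) * F.df (F.h i)) := ⟨_, rfl⟩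
  obtain ⟨J3, hJ3⟩ : ∃ J, J = ∑ i, F.δ i * (F.divV (F.h i) * F.df (F.h i)) := ⟨_, rfl⟩
  obtain ⟨J4, hJ4⟩ : ∃ J, J = ∑ a, F.ε a * (F.divH (F.e a) * F.df (F.e a)) := ⟨_, rfl⟩
  obtain ⟨J5, hJ5⟩ : ∃ J, J = ∑ i, F.δ i * (F.k u w (F.h i) * F.divV (F.h i)) := ⟨_, rfl⟩
  obtain ⟨J6, hJ6⟩ : ∃ J, J = ∑ i, F.δ i * (F.k w u (F.h i) * F.divV (F.h i)) := ⟨_, rfl⟩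
  obtain ⟨DV, hDV⟩ : ∃ J, J = ∑ a, F.ε a * (F.df (F.e a) * F.df (F.e a)) := ⟨_, rfl⟩
  obtain ⟨DH, hDH⟩ : ∃ J, J = ∑ i, F.δ i * (F.df (F.h i) * F.df (F.h i)) := ⟨_, rfl⟩
  obtain ⟨SV, hSV⟩ : ∃ J, J = ∑ a, F.ε a * F.hs (F.e a) (F.e a) := ⟨_, rfl⟩
  obtain ⟨SH, hSH⟩ : ∃ J, J = ∑ i, F.δ i * F.hs (F.h i) (F.h i) := ⟨_, rfl⟩
  obtain ⟨N1, hN1⟩ : ∃ J, J = ∑ i, F.δ i * F.N (F.h i) u w (F.h i) := ⟨_, rfl⟩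
  obtain ⟨N2, hN2⟩ : ∃ J, J = ∑ i, F.δ i * F.N (F.h i) w u (F.h i) := ⟨_, rfl⟩
  have hJ5' := hJ5
  rw [F.sum_mul_divV] at hJ5'
  have hJ6' := hJ6
  rw [F.sum_mul_divV] at hJ6'
  have B1V : ∑ a, r ^ 2 * F.ε a * ((F.D r (F.e a) u w (F.e a) + F.D r (F.e a) w u (F.e a) -
      F.D r (F.e a) (F.e a) u w - F.D r u w (F.e a) (F.e a)) / 2) =
      (-1 / r * F.hs u w + 3 / r ^ 2 * (F.df u * F.df w)) +
      (-1 / r * F.hs u w + 3 / r ^ 2 * (F.df u * F.df w)) +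
      F.p u w / r * SV + -3 * F.p u w / r ^ 2 * DV +
      (1 / r * F.hs u w - 3 / r ^ 2 * (F.df u * F.df w)) * Fintype.card ι +
      (1 - r ^ 2) / 2 * (J5 + -1 * M2 + J6 + -1 * M3 + 2 * M4 + 2 * M1) := by
    have h1 : J5 + -1 * M2 + J6 + -1 * M3 + 2 * M4 + 2 * M1 = ∑ a, F.ε a *
        (F.N (F.e a) u w (F.e a) + F.N (F.e a) w u (F.e a) -
      F.N (F.e a) (F.e a) u w - F.N u w (F.e a) (F.e a)) := by
      have h2 : ∀ a, F.N (F.e a) u w (F.e a) + F.N (F.e a) w u (F.e a) -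
          F.N (F.e a) (F.e a) u w - F.N u w (F.e a) (F.e a) = ∑ i, F.δ i *
          (-(F.k u w (F.h i) * F.k (F.e a) (F.e a) (F.h i)) -
            F.k (F.e a) w (F.h i) * F.k u (F.e a) (F.h i) -
            F.k w u (F.h i) * F.k (F.e a) (F.e a) (F.h i) -
            F.k (F.e a) u (F.h i) * F.k w (F.e a) (F.h i) +
            2 * (F.k (F.e a) u (F.h i) * F.k (F.e a) w (F.h i)) +
            2 * (F.k u (F.e a) (F.h i) * F.k w (F.e a) (F.h i))) := by
        intro a
        have ha := F.e_mem a
        rw [F.N_V _ _ _ hw _ ha, F.N_V _ _ _ hu _ ha, F.N_V _ _ _ hu _ hw, F.N_V _ _ _ ha _ ha]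
        simp only [← Finset.sum_neg_distrib, ← Finset.sum_add_distrib, ← Finset.sum_sub_distrib]
        exact Finset.sum_congr rfl fun i _ => by ring
      simp only [h2, hJ5', hJ6', hM1, hM2, hM3, hM4, Finset.mul_sum, ← Finset.sum_add_distrib]
      exact Finset.sum_congr rfl fun a _ => Finset.sum_congr rfl fun b _ => by ring
    have h3 := F.hs_expand w hw u
    have h4 := F.hs_expand u hu w
    have h5 := F.df_expand u hu
    have h6 := F.df_expand w hw
    -- The same quantity is expanded along `w` here and along `u` in `e2`, matching the two terms of
    -- `D` with these vectors in exchanged slots.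
    have e1 : -1 / r * F.hs u w + 3 / r ^ 2 * (F.df u * F.df w) =
      ∑ a, F.ε a * (-1 / r * (F.p w (F.e a) * F.hs (F.e a) u) +
        3 / r ^ 2 * F.df u * (F.p w (F.e a) * F.df (F.e a))) := by
      rw [F.hs_symm u w, ← h3]
      nth_rewrite 1 [← h6]
      simp only [Finset.mul_sum, ← Finset.sum_add_distrib]
      exact Finset.sum_congr rfl fun a _ => by ring
    have e2 : -1 / r * F.hs u w + 3 / r ^ 2 * (F.df u * F.df w) =
      ∑ a, F.ε a * (-1 / r * (F.p u (F.e a) * F.hs (F.e a) w) +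
        3 / r ^ 2 * F.df w * (F.p u (F.e a) * F.df (F.e a))) := by
      rw [← h4]
      nth_rewrite 1 [← h5]
      simp only [Finset.mul_sum, Finset.sum_mul, ← Finset.sum_add_distrib]
      exact Finset.sum_congr rfl fun a _ => by ring
    rw [h1]
    nth_rewrite 1 [e1]
    rw [e2, mul_comm _ (Fintype.card ι : ℝ), ← F.sum_eps_p_frame]
    simp only [hSV, hDV, Finset.mul_sum, ← Finset.sum_add_distrib]
    refine Finset.sum_congr rfl fun a _ => ?_
    have ha := F.e_mem a
    simp only [D, F.k_V _ u hu w hw, F.k_V _ u hu _ ha, F.k_V _ w hw _ ha, F.k_V _ _ ha _ ha]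
    field_simp
    ring
  have B1H : ∑ i, F.δ i * ((F.D r (F.h i) u w (F.h i) + F.D r (F.h i) w u (F.h i) -
      F.D r (F.h i) (F.h i) u w - F.D r u w (F.h i) (F.h i)) / 2) =
      -1 / r ^ 3 * F.df u * F.divH w + -1 / r ^ 3 * F.df w * F.divH u + -1 / r ^ 3 * J1 +
      -1 / r ^ 3 * J2 + (1 / r ^ 2 - 1) / 2 * N1 + (1 / r ^ 2 - 1) / 2 * N2 +
      F.p u w / r ^ 3 * SH + -3 * F.p u w / r ^ 4 * DH + (1 / r ^ 2 - 1) * L1 +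
      -(1 / r ^ 2 - 1) * M1 := by
    have key : ∀ (L M : κ → ℝ), ∑ i, F.δ i * ((-2 / r ^ 3 * F.df u * F.k (F.h i) (F.h i) w +
        -2 / r ^ 3 * F.df (F.h i) * F.k u w (F.h i) + (1 / r ^ 2 - 1) * F.N (F.h i) u w (F.h i) +
        (-2 / r ^ 3 * F.df w * F.k (F.h i) (F.h i) u +
        -2 / r ^ 3 * F.df (F.h i) * F.k w u (F.h i) + (1 / r ^ 2 - 1) * F.N (F.h i) w u (F.h i)) -
        ((-2 / r ^ 3 * F.hs (F.h i) (F.h i) + 6 / r ^ 4 * (F.df (F.h i) * F.df (F.h i))) * F.p u w +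
        (1 / r ^ 2 - 1) * (-2 * L i)) - (1 / r ^ 2 - 1) * (2 * M i)) / 2) =
        -1 / r ^ 3 * F.df u * F.divH w + -1 / r ^ 3 * F.df w * F.divH u + -1 / r ^ 3 * J1 +
      -1 / r ^ 3 * J2 + (1 / r ^ 2 - 1) / 2 * N1 + (1 / r ^ 2 - 1) / 2 * N2 +
      F.p u w / r ^ 3 * SH + -3 * F.p u w / r ^ 4 * DH + (1 / r ^ 2 - 1) * ∑ i, F.δ i * L i +
      -(1 / r ^ 2 - 1) * ∑ i, F.δ i * M i := by
      intro L M
      simp only [divH, hJ1, hJ2, hN1, hN2, hSH, hDH, Finset.mul_sum, ← Finset.sum_add_distrib]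
      exact Finset.sum_congr rfl fun i _ => by ring
    rw [hL1, hM1, ← F.sum_swap, ← key]
    refine Finset.sum_congr rfl fun i _ => ?_
    have hi := F.h_mem i
    have n1 : F.N (F.h i) (F.h i) u w =
        -2 * ∑ j, F.δ j * (F.k (F.h i) (F.h j) u * F.k (F.h i) (F.h j) w) := by
      rw [F.N_V _ _ _ hu _ hw, Finset.mul_sum, ← Finset.sum_neg_distrib]
      refine Finset.sum_congr rfl fun b _ => ?_
      rw [F.k_symm _ u, F.k_symm _ w]; ring
    have n2 : F.N u w (F.h i) (F.h i) =
        2 * ∑ a, F.ε a * (F.k u (F.e a) (F.h i) * F.k w (F.e a) (F.h i)) := by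
      rw [F.N_H _ _ _ hi _ hi, Finset.mul_sum]
      refine Finset.sum_congr rfl fun b _ => ?_
      rw [F.k_symm _ (F.h i), F.k_symm _ (F.h i)]; ring
    simp only [D, F.p_perp' hi, n1, n2, F.k_V _ u hu w hw, F.k_H _ _ hi _ hi]
    rw [F.k_symm _ u (F.h i), F.k_symm _ w (F.h i)]
    ring
  have B2V : ∑ a, r ^ 2 * F.ε a * (firstKind (F.T r) u w (F.e a) *
      (-(Fintype.card ι - 2) / r * F.df (F.e a) - (1 / r ^ 2 - 1) * F.divH (F.e a))) =
      2 * (Fintype.card ι - 2) / r ^ 2 * (F.df u * F.df w) +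
      (1 / r ^ 2 - 1) / r * (F.df u * F.divH w + F.df w * F.divH u) +
      -(Fintype.card ι - 2) / r ^ 2 * F.p u w * DV + -(1 / r ^ 2 - 1) / r * F.p u w * J4 := by
    -- One copy of `df u * df w` comes from contracting `w` with the frame, the other from
    -- contracting `u`.
    have e1 : 2 * (Fintype.card ι - 2) / r ^ 2 * (F.df u * F.df w) =
        (Fintype.card ι - 2) / r ^ 2 * F.df u * (∑ a, F.ε a * (F.p w (F.e a) * F.df (F.e a))) +
        (Fintype.card ι - 2) / r ^ 2 * F.df w * (∑ a, F.ε a * (F.p u (F.e a) * F.df (F.e a))) := by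
      rw [F.df_expand u hu, F.df_expand w hw]; ring
    rw [e1, ← F.divH_expand hu, ← F.divH_expand hw]
    simp only [hDV, hJ4, Finset.mul_sum, ← Finset.sum_add_distrib]
    refine Finset.sum_congr rfl fun a _ => ?_
    have ha := F.e_mem a
    simp only [firstKind, F.T_VV r hu ha, F.T_VV r hw ha, F.T_VV r hu hw]
    field_simp
    ring
  have B2H : ∑ i, F.δ i * (firstKind (F.T r) u w (F.h i) *
      (-Fintype.card ι / r * F.df (F.h i) + (1 - r ^ 2) * F.divV (F.h i))) =
      -Fintype.card ι * (1 / r ^ 2 - 1) / (2 * r) * J1 +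
      -Fintype.card ι * (1 / r ^ 2 - 1) / (2 * r) * J2 +
      (1 / r ^ 2 - 1) * (1 - r ^ 2) / 2 * J5 + (1 / r ^ 2 - 1) * (1 - r ^ 2) / 2 * J6 +
      -Fintype.card ι / r ^ 4 * F.p u w * DH + (1 - r ^ 2) / r ^ 3 * F.p u w * J3 := by
    simp only [hJ1, hJ2, hJ3, hJ5, hJ6, hDH, Finset.mul_sum, ← Finset.sum_add_distrib]
    refine Finset.sum_congr rfl fun i _ => ?_
    have hi := F.h_mem i
    simp only [firstKind, F.T_VH r _ hi, F.T_VV r hu hw]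
    field_simp
    ring
  have B3V : ∑ a, F.ε a * ∑ b, F.ε b * (r ^ 4 *
      (firstKind (F.T r) (F.e a) w (F.e b) * firstKind (F.T r) u (F.e a) (F.e b))) =
      2 / r ^ 2 * F.p u w * DV + (Fintype.card ι - 2) / r ^ 2 * (F.df u * F.df w) := by
    -- The terms of the product containing `p(e_a, e_b)` collapse to the diagonal; the four linear
    -- in it cancel there and its square contributes `q`. The remaining terms factor into products
    -- of single sums, handled by `h2` to `h5`.
    have h1 : ∑ a, F.ε a * ∑ b, F.ε b * (F.p (F.e a) (F.e b) *
        (F.df u * (F.p w (F.e b) * F.df (F.e a)) + F.df w * (F.p u (F.e b) * F.df (F.e a)) -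
          F.df w * (F.p u (F.e a) * F.df (F.e b)) - F.df u * (F.p w (F.e a) * F.df (F.e b)) +
          F.df u * F.df w * F.p (F.e a) (F.e b))) =
        Fintype.card ι * (F.df u * F.df w) := by
      rw [F.sum_p_frame, ← F.sum_eps_p_frame]
      exact Finset.sum_congr rfl fun a _ => by ring
    obtain ⟨c, hc⟩ : ∃ c, c = Fintype.card ι * (F.df u * F.df w) := ⟨_, rfl⟩
    rw [← hc] at h1
    have h2 := F.sum_VV_prod (fun a => F.df (F.e a) * F.df (F.e a))
      (fun b => F.p u (F.e b) * F.p w (F.e b))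
    have h3 := F.sum_VV_prod (fun b => F.p u (F.e b) * F.p w (F.e b))
      (fun a => F.df (F.e a) * F.df (F.e a))
    have h4 := F.sum_VV_prod (fun a => F.p u (F.e a) * F.df (F.e a))
      (fun a => F.p w (F.e a) * F.df (F.e a))
    have h5 := F.sum_VV_prod (fun a => F.p w (F.e a) * F.df (F.e a))
      (fun a => F.p u (F.e a) * F.df (F.e a))
    simp only [F.p_expand u hu, F.df_expand u hu, F.df_expand w hw, ← hDV] at h2 h3 h4 h5
    have e : 2 / r ^ 2 * F.p u w * DV + (Fintype.card ι - 2) / r ^ 2 * (F.df u * F.df w) =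
        1 / r ^ 2 * c + 1 / r ^ 2 * (DV * F.p u w) +
        1 / r ^ 2 * (F.p u w * DV) + -1 / r ^ 2 * (F.df u * F.df w) +
        -1 / r ^ 2 * (F.df w * F.df u) := by
      rw [hc]; ring
    rw [e, ← h4, ← h5, ← h2, ← h3, ← h1]
    simp only [Finset.mul_sum, ← Finset.sum_add_distrib]
    refine Finset.sum_congr rfl fun a _ => Finset.sum_congr rfl fun b _ => ?_
    have ha := F.e_mem a
    have hb := F.e_mem b
    simp only [firstKind, F.T_VV r hw hb, F.T_VV r ha hb, F.T_VV r ha hw, F.T_VV r hu hb,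
      F.T_VV r hu ha, F.p_symm (F.e a) w]
    field_simp
    ring
  have B3M : ∑ a, F.ε a * ∑ i, F.δ i * (r ^ 2 *
      (firstKind (F.T r) (F.e a) w (F.h i) * firstKind (F.T r) u (F.e a) (F.h i) +
       firstKind (F.T r) (F.h i) w (F.e a) * firstKind (F.T r) u (F.h i) (F.e a))) =
      (1 - r ^ 2) * (1 / r ^ 2 - 1) / 2 * M1 + (1 - r ^ 2) * (1 / r ^ 2 - 1) / 2 * M4 +
      2 / r ^ 4 * (F.p u w * DH) + (1 / r ^ 2 - 1) / r * J1 + (1 / r ^ 2 - 1) / r * J2 := by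
    -- Inserting the expansion of `u` in the frame of `V` turns a single sum over `H` into a double
    -- sum comparable with the product of the `firstKind` terms; `h2` and `h3` are analogous.
    have h1 : J1 = ∑ a, F.ε a * ∑ i, F.δ i *
        (F.p u (F.e a) * F.k (F.e a) w (F.h i) * F.df (F.h i)) := by
      rw [← F.sum_swap, hJ1]
      refine Finset.sum_congr rfl fun i _ => ?_
      rw [← F.k_expand₁ u hu, Finset.sum_mul]
      exact congrArg _ (Finset.sum_congr rfl fun a _ => by ring)
    have h2 : J2 = ∑ a, F.ε a * ∑ i, F.δ i *
        (F.p w (F.e a) * F.k (F.e a) u (F.h i) * F.df (F.h i)) := by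
      rw [← F.sum_swap, hJ2]
      refine Finset.sum_congr rfl fun i _ => ?_
      rw [← F.k_expand₁ w hw, Finset.sum_mul]
      exact congrArg _ (Finset.sum_congr rfl fun a _ => by ring)
    have h3 : F.p u w * DH = ∑ a, F.ε a * ∑ i, F.δ i *
        (F.p u (F.e a) * F.p w (F.e a) * (F.df (F.h i) * F.df (F.h i))) := by
      rw [← F.sum_swap, hDH, Finset.mul_sum]
      refine Finset.sum_congr rfl fun i _ => ?_
      rw [← F.p_expand u hu, Finset.sum_mul, Finset.mul_sum]
      exact Finset.sum_congr rfl fun a _ => by ring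
    rw [h1, h2, h3]
    simp only [hM1, hM4, Finset.mul_sum, ← Finset.sum_add_distrib]
    refine Finset.sum_congr rfl fun a _ => Finset.sum_congr rfl fun i _ => ?_
    have ha := F.e_mem a
    have hi := F.h_mem i
    simp only [firstKind, F.T_VV r ha hw, F.T_VV r hu ha, F.T_VV r hw ha, F.T_VH r _ hi,
      F.T_HV r hi, F.p_symm (F.e a) w]
    field_simp
    ring
  have B3H : ∑ i, F.δ i * ∑ j, F.δ j *
      (firstKind (F.T r) (F.h i) w (F.h j) * firstKind (F.T r) u (F.h i) (F.h j)) =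
      (1 / r ^ 2 - 1) ^ 2 / 4 * (L1 + L1 + -1 * L2 + -1 * L2) := by
    nth_rewrite 1 [hL1]
    rw [hL1']
    nth_rewrite 1 [hL2]
    rw [hL2']
    simp only [Finset.mul_sum, ← Finset.sum_add_distrib]
    refine Finset.sum_congr rfl fun i _ => Finset.sum_congr rfl fun j _ => ?_
    have hi := F.h_mem i
    have hj := F.h_mem j
    simp only [firstKind, F.T_HH r hi hj, F.T_VH r w hj, F.T_VH r u hj, F.T_VH r u hi, F.T_HV r hi,
      F.k_symm _ w (F.h j), F.k_symm _ u (F.h j), F.k_symm _ w (F.h i), F.k_symm _ u (F.h i)]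
    ring
  have R1 : ∑ i, F.δ i * (F.swV u w (F.h i) * F.df (F.h i)) = J1 + J2 := by
    simp only [hJ1, hJ2, ← Finset.sum_add_distrib, swV]
    exact Finset.sum_congr rfl fun a _ => by ring
  have R2 : ∑ i, F.δ i * (F.swV u w (F.h i) * F.divV (F.h i)) = J5 + J6 := by
    simp only [hJ5, hJ6, ← Finset.sum_add_distrib, swV]
    exact Finset.sum_congr rfl fun a _ => by ring
  have R3 : ∑ i, F.δ i * (-F.N (F.h i) w (F.h i) u + -F.N (F.h i) u (F.h i) w) =
      -1 * N1 + -1 * N2 := by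
    simp only [hN1, hN2, Finset.mul_sum, ← Finset.sum_add_distrib]
    refine Finset.sum_congr rfl fun i _ => ?_
    rw [F.N_symm _ _ (F.h i), F.N_symm _ _ (F.h i)]
    ring
  have R4 : ∑ i, F.δ i * ∑ a, F.ε a * (F.swV u (F.e a) (F.h i) * F.twV w (F.e a) (F.h i) +
      F.swV w (F.e a) (F.h i) * F.twV u (F.e a) (F.h i)) = 2 * M1 + -2 * M4 := by
    rw [F.sum_swap]
    simp only [hM1, hM4, Finset.mul_sum, ← Finset.sum_add_distrib, swV, twV]
    exact Finset.sum_congr rfl fun a _ => Finset.sum_congr rfl fun b _ => by ring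
  have R5 : ∑ i, F.δ i * ∑ j, F.δ j * (F.swH (F.h i) (F.h j) u * F.swH (F.h i) (F.h j) w) =
      L1 + L1 + L2 + L2 := by
    nth_rewrite 1 [hL1]
    rw [hL1']
    nth_rewrite 1 [hL2]
    rw [hL2']
    simp only [Finset.mul_sum, ← Finset.sum_add_distrib, swH]
    exact Finset.sum_congr rfl fun a _ => Finset.sum_congr rfl fun b _ => by ring
  -- Again zero, by the symmetry of `Sw_H` and the antisymmetry of `Tw_H`.
  have R6 : ∑ i, F.δ i * ∑ j, F.δ j * (F.swH (F.h i) (F.h j) u * F.twH (F.h i) (F.h j) w +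
      F.swH (F.h i) (F.h j) w * F.twH (F.h i) (F.h j) u) = 2 * L1 + -2 * L1 := by
    nth_rewrite 1 [hL1]
    rw [hL1']
    simp only [Finset.mul_sum, ← Finset.sum_add_distrib, swH, twH]
    exact Finset.sum_congr rfl fun a _ => Finset.sum_congr rfl fun b _ => by ring
  have R7 : ∑ i, F.δ i * ∑ a, F.ε a * (F.twV u (F.e a) (F.h i) * F.twV w (F.e a) (F.h i)) =
      M1 + -1 * M2 + -1 * M3 + M4 := by
    rw [F.sum_swap]
    simp only [hM1, hM2, hM3, hM4, Finset.mul_sum, ← Finset.sum_add_distrib, twV]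
    exact Finset.sum_congr rfl fun a _ => Finset.sum_congr rfl fun b _ => by ring
  have R8 : ∑ i, F.δ i * ∑ j, F.δ j * (F.twH (F.h i) (F.h j) w * F.twH (F.h i) (F.h j) u) =
      L1 + L1 + -1 * L2 + -1 * L2 := by
    nth_rewrite 1 [hL1]
    rw [hL1']
    nth_rewrite 1 [hL2]
    rw [hL2']
    simp only [Finset.mul_sum, ← Finset.sum_add_distrib, twH]
    exact Finset.sum_congr rfl fun a _ => Finset.sum_congr rfl fun b _ => by ring
  rw [F.ricciDiff_eq r hr, B1V, B1H, B2V, B2H, B3V, B3M, B3H, R1, R2, R3, R4, R5, R6, R7, R8,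
    F.lapV_eq, F.lapH_eq, ← hSV, ← hSH, ← hJ3, ← hJ4, ← hDV, ← hDH]
  field_simp
  ring

end Frame

end Coord

end

/-! ### The algebraic identity for mixed arguments. -/

section

namespace Coord

namespace Frame

variable {E ι κ : Type*} [Fintype ι] [Fintype κ] [DecidableEq ι] [DecidableEq κ]
  (F : Frame E ι κ) (r : ℝ)

/-- Only `u` is stretched, hence a single factor `r`. Both traces now contain mixed and diagonal
blocks of `∇²P`: the mixed ones give the `Q^V` and `Q^H` differences, the diagonal ones contribute
products of `∇P` to the remaining traces. -/
theorem ricciDiff_VH (hr : r ≠ 0) {u w : E} (hu : u ∈ F.V) (hw : w ∈ F.H) :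
    r * F.ricciDiff r u w =
      (1 - r ^ 2) / (2 * r) *
          ∑ i, F.δ i * (-F.N (F.h i) (F.h i) w u - -F.N (F.h i) w (F.h i) u)
      + r * (1 - r ^ 2) / 2 *
          ∑ a, F.ε a * (F.N (F.e a) u (F.e a) w - F.N (F.e a) (F.e a) u w)
      - 1 / 2 * ∑ i, F.δ i * (F.swH w (F.h i) u * F.df (F.h i))
      + 1 / 2 * ∑ a, F.ε a * (F.swV u (F.e a) w * F.df (F.e a))
      + (Fintype.card ι - 1) * F.hs u w
      - (Fintype.card ι - 1) / r * (F.df u * F.df w)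
      + F.divV w * F.df u
      - F.divH u * F.df w
      - ((Fintype.card ι - 1) * (1 - r ^ 2) + 3 * r ^ 2) / 2 *
          ∑ a, F.ε a * (F.twV u (F.e a) w * F.df (F.e a))
      + ((Fintype.card ι - 1) * (1 - r ^ 2) + 3) / (2 * r ^ 2) *
          ∑ i, F.δ i * (F.twH w (F.h i) u * F.df (F.h i))
      + (1 - r ^ 2) / (4 * r) * ∑ a, F.ε a * (F.swV u (F.e a) w * F.divH (F.e a))
      - (1 - r ^ 2) * (1 - 2 * r ^ 2) / (4 * r) *
          ∑ a, F.ε a * (F.twV u (F.e a) w * F.divH (F.e a))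
      - r * (1 - r ^ 2) / 4 * ∑ i, F.δ i * (F.swH (F.h i) w u * F.divV (F.h i))
      + (1 - r ^ 2) * (2 - r ^ 2) / (4 * r) *
          ∑ i, F.δ i * (F.twH (F.h i) w u * F.divV (F.h i))
      + (1 - r ^ 2) ^ 2 / (8 * r) *
          ∑ a, F.ε a * ∑ i, F.δ i * (3 * (F.twH w (F.h i) (F.e a) * F.twV u (F.e a) (F.h i)) +
            F.swH w (F.h i) (F.e a) * F.swV u (F.e a) (F.h i))
      + (1 - r ^ 4) / (8 * r) *
          ∑ a, F.ε a * ∑ i, F.δ i * (F.twH w (F.h i) (F.e a) * F.swV u (F.e a) (F.h i) -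
            F.swH w (F.h i) (F.e a) * F.twV u (F.e a) (F.h i)) := by
  have hpw := F.p_perp w hw
  have hpw' := F.p_perp' hw
  obtain ⟨M1, hM1⟩ : ∃ M1, M1 = ∑ a, F.ε a * ∑ i, F.δ i *
    (F.k u (F.e a) (F.h i) * F.k w (F.h i) (F.e a)) := ⟨_, rfl⟩
  obtain ⟨M2, hM2⟩ : ∃ M2, M2 = ∑ a, F.ε a * ∑ i, F.δ i *
    (F.k u (F.e a) (F.h i) * F.k (F.h i) w (F.e a)) := ⟨_, rfl⟩
  obtain ⟨M3, hM3⟩ : ∃ M3, M3 = ∑ a, F.ε a * ∑ i, F.δ i *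
    (F.k (F.e a) u (F.h i) * F.k w (F.h i) (F.e a)) := ⟨_, rfl⟩
  obtain ⟨M4, hM4⟩ : ∃ M4, M4 = ∑ a, F.ε a * ∑ i, F.δ i *
    (F.k (F.e a) u (F.h i) * F.k (F.h i) w (F.e a)) := ⟨_, rfl⟩
  obtain ⟨A1, hA1⟩ : ∃ J, J = ∑ a, F.ε a * (F.k u (F.e a) w * F.df (F.e a)) := ⟨_, rfl⟩
  obtain ⟨A2, hA2⟩ : ∃ J, J = ∑ a, F.ε a * (F.k (F.e a) u w * F.df (F.e a)) := ⟨_, rfl⟩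
  obtain ⟨A3, hA3⟩ : ∃ J, J = ∑ a, F.ε a * (F.k u (F.e a) w * F.divH (F.e a)) := ⟨_, rfl⟩
  obtain ⟨A4, hA4⟩ : ∃ J, J = ∑ a, F.ε a * (F.k (F.e a) u w * F.divH (F.e a)) := ⟨_, rfl⟩
  obtain ⟨C1, hC1⟩ : ∃ J, J = ∑ i, F.δ i * (F.k w (F.h i) u * F.df (F.h i)) := ⟨_, rfl⟩
  obtain ⟨C2, hC2⟩ : ∃ J, J = ∑ i, F.δ i * (F.k (F.h i) w u * F.df (F.h i)) := ⟨_, rfl⟩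
  obtain ⟨C3, hC3⟩ : ∃ J, J = ∑ i, F.δ i * (F.k w (F.h i) u * F.divV (F.h i)) := ⟨_, rfl⟩
  obtain ⟨C4, hC4⟩ : ∃ J, J = ∑ i, F.δ i * (F.k (F.h i) w u * F.divV (F.h i)) := ⟨_, rfl⟩
  obtain ⟨N1, hN1⟩ : ∃ J, J = ∑ a, F.ε a * F.N (F.e a) u (F.e a) w := ⟨_, rfl⟩
  obtain ⟨N2, hN2⟩ : ∃ J, J = ∑ a, F.ε a * F.N (F.e a) (F.e a) u w := ⟨_, rfl⟩
  obtain ⟨N3, hN3⟩ : ∃ J, J = ∑ i, F.δ i * F.N (F.h i) (F.h i) w u := ⟨_, rfl⟩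
  obtain ⟨N4, hN4⟩ : ∃ J, J = ∑ i, F.δ i * F.N (F.h i) w (F.h i) u := ⟨_, rfl⟩
  have hA3' := hA3
  rw [F.sum_mul_divH] at hA3'
  have hC3' := hC3
  rw [F.sum_mul_divV] at hC3'
  have B1V : ∑ a, r ^ 2 * F.ε a * ((F.D r (F.e a) u w (F.e a) + F.D r (F.e a) w u (F.e a) -
      F.D r (F.e a) (F.e a) u w - F.D r u w (F.e a) (F.e a)) / 2) =
      1 / r * F.df u * F.divV w + -1 / r * A1 + 2 / r * A2 +
      (-1 / r * F.hs u w + 3 / r ^ 2 * (F.df u * F.df w)) +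
      (1 / r * F.hs u w - 3 / r ^ 2 * (F.df u * F.df w)) * Fintype.card ι +
      (1 - r ^ 2) / 2 * N1 + -(1 - r ^ 2) / 2 * N2 +
      (1 - r ^ 2) / 2 * (C3 + -1 * M3 + 2 * M1) := by
    -- The two diagonal `V`-blocks of `∇²P` in this trace; the other two blocks are mixed and are
    -- kept as `N1` and `N2`.
    have h1 : C3 + -1 * M3 + 2 * M1 = ∑ a, F.ε a *
        (F.N (F.e a) w u (F.e a) - F.N u w (F.e a) (F.e a)) := by
      have h2 : ∀ a, F.N (F.e a) w u (F.e a) - F.N u w (F.e a) (F.e a) = ∑ i, F.δ i *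
          (-(F.k w (F.h i) u * F.k (F.e a) (F.e a) (F.h i)) -
            F.k (F.e a) u (F.h i) * F.k w (F.h i) (F.e a) +
            2 * (F.k u (F.e a) (F.h i) * F.k w (F.h i) (F.e a))) := by
        intro a
        have ha := F.e_mem a
        rw [F.N_V _ _ _ hu _ ha, F.N_V _ _ _ ha _ ha]
        simp only [← Finset.sum_neg_distrib, ← Finset.sum_sub_distrib]
        refine Finset.sum_congr rfl fun i _ => ?_
        rw [F.k_symm w u, F.k_symm w (F.e a)]
        ring
      simp only [h2, hC3', hM1, hM3, Finset.mul_sum, ← Finset.sum_add_distrib]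
      exact Finset.sum_congr rfl fun a _ => Finset.sum_congr rfl fun b _ => by ring
    have e1 : -1 / r * F.hs u w + 3 / r ^ 2 * (F.df u * F.df w) =
      ∑ a, F.ε a * (-1 / r * (F.p u (F.e a) * F.hs (F.e a) w) +
        3 / r ^ 2 * F.df w * (F.p u (F.e a) * F.df (F.e a))) := by
      rw [← F.hs_expand u hu]
      nth_rewrite 1 [← F.df_expand u hu]
      simp only [Finset.mul_sum, Finset.sum_mul, ← Finset.sum_add_distrib]
      exact Finset.sum_congr rfl fun a _ => by ring
    rw [h1, e1, mul_comm _ (Fintype.card ι : ℝ), ← F.sum_eps_p_frame]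
    simp only [hA1, hA2, hN1, hN2, divV, Finset.mul_sum, ← Finset.sum_add_distrib]
    refine Finset.sum_congr rfl fun a _ => ?_
    have ha := F.e_mem a
    simp only [D, hpw, hpw', F.k_V _ u hu _ ha, F.k_V _ _ ha _ ha, F.k_symm _ w (F.e a),
      F.N_symm _ _ w (F.e a)]
    field_simp
    ring
  have B1H : ∑ i, F.δ i * ((F.D r (F.h i) u w (F.h i) + F.D r (F.h i) w u (F.h i) -
      F.D r (F.h i) (F.h i) u w - F.D r u w (F.h i) (F.h i)) / 2) =
      -1 / r ^ 3 * F.df w * F.divH u + -1 / r ^ 3 * C1 + 2 / r ^ 3 * C2 +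
      (1 / r ^ 2 - 1) / 2 * N4 + -(1 / r ^ 2 - 1) / 2 * N3 +
      (1 / r ^ 2 - 1) / 2 * (A3 + M2 + -2 * M1) := by
    -- The two diagonal `H`-blocks; the mixed ones are `N3` and `N4`.
    have h1 : A3 + M2 + -2 * M1 = ∑ i, F.δ i *
        (F.N (F.h i) u w (F.h i) - F.N u w (F.h i) (F.h i)) := by
      have h2 : ∀ i, F.N (F.h i) u w (F.h i) - F.N u w (F.h i) (F.h i) = ∑ a, F.ε a *
          (F.k u (F.e a) w * F.k (F.h i) (F.h i) (F.e a) +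
            F.k u (F.e a) (F.h i) * F.k (F.h i) w (F.e a) -
            2 * (F.k u (F.e a) (F.h i) * F.k w (F.h i) (F.e a))) := by
        intro i
        have hi := F.h_mem i
        rw [F.N_H _ _ _ hw _ hi, F.N_H _ _ _ hi _ hi]
        simp only [← Finset.sum_sub_distrib]
        refine Finset.sum_congr rfl fun a _ => ?_
        rw [F.k_symm u (F.e a), F.k_symm u (F.e a)]
        ring
      simp only [h2]
      rw [F.sum_swap]
      simp only [hA3', hM1, hM2, Finset.mul_sum, ← Finset.sum_add_distrib]
      exact Finset.sum_congr rfl fun a _ => Finset.sum_congr rfl fun b _ => by ring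
    rw [h1]
    simp only [hC1, hC2, hN3, hN4, divH, Finset.mul_sum, ← Finset.sum_add_distrib]
    refine Finset.sum_congr rfl fun i _ => ?_
    have hi := F.h_mem i
    simp only [D, hpw, hpw', F.p_perp _ hi, F.p_perp' hi, F.k_H _ w hw _ hi, F.k_H _ _ hi _ hi,
      F.k_symm _ u w, F.k_symm _ u (F.h i), F.N_symm _ _ u (F.h i)]
    rw [F.N_symm (F.h i) (F.h i) u w]
    ring
  have B2V : ∑ a, r ^ 2 * F.ε a * (firstKind (F.T r) u w (F.e a) *
      (-(Fintype.card ι - 2) / r * F.df (F.e a) - (1 / r ^ 2 - 1) * F.divH (F.e a))) =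
      -(1 - r ^ 2) * (Fintype.card ι - 2) / (2 * r) * A1 +
      (1 - r ^ 2) * (Fintype.card ι - 2) / (2 * r) * A2 +
      -(1 - r ^ 2) * (1 / r ^ 2 - 1) / 2 * A3 + (1 - r ^ 2) * (1 / r ^ 2 - 1) / 2 * A4 +
      (Fintype.card ι - 2) / r ^ 2 * F.df w * F.df u +
      (1 / r ^ 2 - 1) / r * F.df w * F.divH u := by
    rw [← F.divH_expand hu, ← F.df_expand u hu]
    simp only [hA1, hA2, hA3, hA4, Finset.mul_sum, ← Finset.sum_add_distrib]
    refine Finset.sum_congr rfl fun a _ => ?_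
    have ha := F.e_mem a
    simp only [firstKind, F.T_HV r hw, F.T_VH r _ hw, F.T_VV r hu ha]
    field_simp
    ring
  have B2H : ∑ i, F.δ i * (firstKind (F.T r) u w (F.h i) *
      (-Fintype.card ι / r * F.df (F.h i) + (1 - r ^ 2) * F.divV (F.h i))) =
      -Fintype.card ι * (1 / r ^ 2 - 1) / (2 * r) * C1 +
      Fintype.card ι * (1 / r ^ 2 - 1) / (2 * r) * C2 +
      (1 / r ^ 2 - 1) * (1 - r ^ 2) / 2 * C3 + -(1 / r ^ 2 - 1) * (1 - r ^ 2) / 2 * C4 := by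
    simp only [hC1, hC2, hC3, hC4, Finset.mul_sum, ← Finset.sum_add_distrib]
    refine Finset.sum_congr rfl fun i _ => ?_
    have hi := F.h_mem i
    simp only [firstKind, F.T_HH r hw hi, F.T_VH r u hi, F.T_VH r u hw, F.k_symm _ u]
    field_simp
    ring
  have B3V : ∑ a, F.ε a * ∑ b, F.ε b * (r ^ 4 *
      (firstKind (F.T r) (F.e a) w (F.e b) * firstKind (F.T r) u (F.e a) (F.e b))) =
      r * (1 / r ^ 2 - 1) / 2 * (A1 + A1 + -1 * A2 + -1 * A2) +
      1 / r ^ 2 * (Fintype.card ι * (F.df u * F.df w)) := by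
    have h1 : ∑ a, F.ε a * ∑ b, F.ε b * (F.p (F.e a) (F.e b) *
        (F.df w * (F.p u (F.e b) * F.df (F.e a)) - F.df w * (F.p u (F.e a) * F.df (F.e b)) +
          F.df u * F.df w * F.p (F.e a) (F.e b) +
          -(r ^ 3 * (1 / r ^ 2 - 1) / 2) * F.df u *
            (F.k (F.e a) (F.e b) w - F.k (F.e b) (F.e a) w))) =
        Fintype.card ι * (F.df u * F.df w) := by
      rw [F.sum_p_frame, ← F.sum_eps_p_frame]
      exact Finset.sum_congr rfl fun a _ => by ring
    -- With `u` expanded in the frame, `A1` and `A2` become double sums; both index orders are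
    -- needed because `df` may be evaluated at either index.
    have a1 : A1 = ∑ a, F.ε a * ∑ b, F.ε b *
        (F.p u (F.e b) * F.k (F.e b) (F.e a) w * F.df (F.e a)) := by
      rw [hA1]
      refine Finset.sum_congr rfl fun a _ => ?_
      rw [← F.k_expand₁ u hu, Finset.sum_mul]
      exact congrArg _ (Finset.sum_congr rfl fun b _ => by ring)
    have a2 : A2 = ∑ a, F.ε a * ∑ b, F.ε b *
        (F.p u (F.e b) * F.k (F.e a) (F.e b) w * F.df (F.e a)) := by
      rw [hA2]
      refine Finset.sum_congr rfl fun a _ => ?_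
      rw [← F.k_expand₂ u hu, Finset.sum_mul]
      exact congrArg _ (Finset.sum_congr rfl fun b _ => by ring)
    have a1' : A1 = ∑ a, F.ε a * ∑ b, F.ε b *
        (F.p u (F.e a) * F.k (F.e a) (F.e b) w * F.df (F.e b)) := by rw [a1, ← F.sum_swap_VV]
    have a2' : A2 = ∑ a, F.ε a * ∑ b, F.ε b *
        (F.p u (F.e a) * F.k (F.e b) (F.e a) w * F.df (F.e b)) := by rw [a2, ← F.sum_swap_VV]
    rw [← h1]
    nth_rewrite 1 [a1]
    rw [a1']
    nth_rewrite 1 [a2]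
    rw [a2']
    simp only [Finset.mul_sum, ← Finset.sum_add_distrib]
    refine Finset.sum_congr rfl fun a _ => Finset.sum_congr rfl fun b _ => ?_
    have ha := F.e_mem a
    have hb := F.e_mem b
    simp only [firstKind, F.T_HV r hw, F.T_VH r _ hw, F.T_VV r ha hb, F.T_VV r hu hb,
      F.T_VV r hu ha]
    field_simp
    ring
  have B3M : ∑ a, F.ε a * ∑ i, F.δ i * (r ^ 2 *
      (firstKind (F.T r) (F.e a) w (F.h i) * firstKind (F.T r) u (F.e a) (F.h i) +
       firstKind (F.T r) (F.h i) w (F.e a) * firstKind (F.T r) u (F.h i) (F.e a))) =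
      (1 - r ^ 2) * (1 / r ^ 2 - 1) / 2 * M1 + -(1 - r ^ 2) * (1 / r ^ 2 - 1) / 2 * M4 +
      -(1 / r ^ 2 - 1) / r * C2 := by
    have h1 : C2 = ∑ a, F.ε a * ∑ i, F.δ i *
        (F.p u (F.e a) * F.k (F.h i) w (F.e a) * F.df (F.h i)) := by
      rw [← F.sum_swap, hC2]
      refine Finset.sum_congr rfl fun i _ => ?_
      rw [F.k_symm, ← F.k_expand₂ u hu, Finset.sum_mul]
      refine congrArg _ (Finset.sum_congr rfl fun a _ => ?_)
      rw [F.k_symm _ w]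
      ring
    rw [h1]
    simp only [hM1, hM4, Finset.mul_sum, ← Finset.sum_add_distrib]
    refine Finset.sum_congr rfl fun a _ => Finset.sum_congr rfl fun i _ => ?_
    have ha := F.e_mem a
    have hi := F.h_mem i
    simp only [firstKind, F.T_HH r hw hi, F.T_HH r hi hw, F.T_VV r hu ha, F.T_VH r _ hi,
      F.T_VH r _ hw, F.T_HV r hi, F.T_HV r hw, F.k_symm _ (F.e a) w, F.k_symm w (F.e a) (F.h i)]
    field_simp
    ring
  have B3H : ∑ i, F.δ i * ∑ j, F.δ j *
      (firstKind (F.T r) (F.h i) w (F.h j) * firstKind (F.T r) u (F.h i) (F.h j)) = 0 := by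
    refine Finset.sum_eq_zero fun i _ => ?_
    rw [Finset.sum_eq_zero, mul_zero]
    intro j _
    rw [firstKind, F.T_HH r hw (F.h_mem j), F.T_HH r (F.h_mem i) (F.h_mem j),
      F.T_HH r (F.h_mem i) hw]
    ring
  have R1 : ∑ i, F.δ i * (-F.N (F.h i) (F.h i) w u - -F.N (F.h i) w (F.h i) u) =
      -1 * N3 + N4 := by
    simp only [hN3, hN4, Finset.mul_sum, ← Finset.sum_add_distrib]
    exact Finset.sum_congr rfl fun i _ => by ring
  have R2 : ∑ a, F.ε a * (F.N (F.e a) u (F.e a) w - F.N (F.e a) (F.e a) u w) =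
      N1 + -1 * N2 := by
    simp only [hN1, hN2, Finset.mul_sum, ← Finset.sum_add_distrib]
    exact Finset.sum_congr rfl fun i _ => by ring
  have R3 : ∑ i, F.δ i * (F.swH w (F.h i) u * F.df (F.h i)) = -1 * C1 + -1 * C2 := by
    simp only [hC1, hC2, Finset.mul_sum, ← Finset.sum_add_distrib, swH]
    exact Finset.sum_congr rfl fun i _ => by ring
  have R4 : ∑ a, F.ε a * (F.swV u (F.e a) w * F.df (F.e a)) = A1 + A2 := by
    simp only [hA1, hA2, ← Finset.sum_add_distrib, swV]
    exact Finset.sum_congr rfl fun i _ => by ring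
  have R5 : ∑ a, F.ε a * (F.twV u (F.e a) w * F.df (F.e a)) = A1 + -1 * A2 := by
    simp only [hA1, hA2, Finset.mul_sum, ← Finset.sum_add_distrib, twV]
    exact Finset.sum_congr rfl fun i _ => by ring
  have R6 : ∑ i, F.δ i * (F.twH w (F.h i) u * F.df (F.h i)) = -1 * C1 + C2 := by
    simp only [hC1, hC2, Finset.mul_sum, ← Finset.sum_add_distrib, twH]
    exact Finset.sum_congr rfl fun i _ => by ring
  have R7 : ∑ a, F.ε a * (F.swV u (F.e a) w * F.divH (F.e a)) = A3 + A4 := by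
    simp only [hA3, hA4, ← Finset.sum_add_distrib, swV]
    exact Finset.sum_congr rfl fun i _ => by ring
  have R8 : ∑ a, F.ε a * (F.twV u (F.e a) w * F.divH (F.e a)) = A3 + -1 * A4 := by
    simp only [hA3, hA4, Finset.mul_sum, ← Finset.sum_add_distrib, twV]
    exact Finset.sum_congr rfl fun i _ => by ring
  have R9 : ∑ i, F.δ i * (F.swH (F.h i) w u * F.divV (F.h i)) = -1 * C3 + -1 * C4 := by
    simp only [hC3, hC4, Finset.mul_sum, ← Finset.sum_add_distrib, swH]
    exact Finset.sum_congr rfl fun i _ => by ring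
  have R10 : ∑ i, F.δ i * (F.twH (F.h i) w u * F.divV (F.h i)) = C3 + -1 * C4 := by
    simp only [hC3, hC4, Finset.mul_sum, ← Finset.sum_add_distrib, twH]
    exact Finset.sum_congr rfl fun i _ => by ring
  have R11 : ∑ a, F.ε a * ∑ i, F.δ i * (3 * (F.twH w (F.h i) (F.e a) * F.twV u (F.e a) (F.h i)) +
      F.swH w (F.h i) (F.e a) * F.swV u (F.e a) (F.h i)) =
      -4 * M1 + 2 * M2 + 2 * M3 + -4 * M4 := by
    simp only [hM1, hM2, hM3, hM4, Finset.mul_sum, ← Finset.sum_add_distrib, swH, swV, twH, twV]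
    exact Finset.sum_congr rfl fun a _ => Finset.sum_congr rfl fun b _ => by ring
  have R12 : ∑ a, F.ε a * ∑ i, F.δ i * (F.twH w (F.h i) (F.e a) * F.swV u (F.e a) (F.h i) -
      F.swH w (F.h i) (F.e a) * F.twV u (F.e a) (F.h i)) =
      2 * M2 + -2 * M3 := by
    simp only [hM2, hM3, Finset.mul_sum, ← Finset.sum_add_distrib, swH, swV, twH, twV]
    exact Finset.sum_congr rfl fun a _ => Finset.sum_congr rfl fun b _ => by ring
  rw [F.ricciDiff_eq r hr, B1V, B1H, B2V, B2H, B3V, B3M, B3H, R1, R2, R3, R4, R5, R6, R7, R8, R9,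
    R10, R11, R12]
  field_simp
  ring

end Frame

end Coord

end

/-! ### Orthonormal bases and orthogonal projections for indefinite forms. -/

section

section Algebra

variable {F : Type*} [AddCommGroup F] [Module ℝ F] [TopologicalSpace F]
  {B : F →L[ℝ] F →L[ℝ] ℝ} {U : Submodule ℝ F}

/-- `B` is nondegenerate on `U`. -/
def NondegenerateOn (B : F →L[ℝ] F →L[ℝ] ℝ) (U : Submodule ℝ F) : Prop :=
  ∀ u ∈ U, (∀ w ∈ U, B u w = 0) → u = 0

theorem NondegenerateOn.of_neg (h : ∀ v ∈ U, v ≠ 0 → B v v < 0) : NondegenerateOn B U := by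
  intro u hu h0
  by_contra hne
  exact (h u hu hne).ne (h0 u hu)

/-- Take an orthogonal basis for the restricted form. No basis vector is null, since it would be
orthogonal to all of `U`; so each can be rescaled. -/
theorem exists_isOrthonormalBasis (hB : ∀ u v, B u v = B v u) [FiniteDimensional ℝ U]
    (hU : NondegenerateOn B U) :
    ∃ e : Module.Basis (Fin (Module.finrank ℝ U)) ℝ U, IsOrthonormalBasis B U e := by
  let β : U →ₗ[ℝ] U →ₗ[ℝ] ℝ := LinearMap.mk₂ ℝ (fun u v => B u v)
    (by intros; simp) (by intros; simp) (by intros; simp) (by intros; simp)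
  have hβ : ∀ u v, β u v = B u v := fun _ _ => rfl
  have hs : β.IsSymm := ⟨fun u v => hB u v⟩
  obtain ⟨b, hb⟩ := LinearMap.BilinForm.exists_orthogonal_basis (B := β) hs
  have hoff : ∀ i j, i ≠ j → B (b i) (b j) = 0 := fun i j hij => hb hij
  have hnd : ∀ i, B (b i) (b i) ≠ 0 := by
    intro i h0
    have : (b i : F) = 0 := by
      refine hU _ (b i).2 fun w hw => ?_
      have h : (⟨w, hw⟩ : U) = ∑ j, b.repr ⟨w, hw⟩ j • b j := (b.sum_repr _).symm
      have : β (b i) ⟨w, hw⟩ = 0 := by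
        rw [h]
        simp only [map_sum, map_smul, smul_eq_mul]
        refine Finset.sum_eq_zero fun j _ => ?_
        by_cases hij : i = j
        · subst hij
          rw [hβ, h0, mul_zero]
        · rw [hβ, hoff i j hij, mul_zero]
      exact this
    exact b.ne_zero i (Subtype.ext this)
  have hpos : ∀ i, 0 < √|B (b i) (b i)| := fun i => Real.sqrt_pos.2 (abs_pos.2 (hnd i))
  refine ⟨b.isUnitSMul (w := fun i => (√|B (b i) (b i)|)⁻¹)
    fun i => (inv_ne_zero (hpos i).ne').isUnit, fun i => ?_, fun i j hij => ?_⟩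
  · simp only [Module.Basis.isUnitSMul_apply, Submodule.coe_smul, map_smul, _root_.smul_apply,
      smul_eq_mul, abs_mul, abs_inv, abs_of_pos (hpos i)]
    have := Real.mul_self_sqrt (abs_nonneg (B (b i) (b i)))
    have h1 := (hpos i).ne'
    field_simp
    rw [pow_two]
    exact this.symm
  · simp [Module.Basis.isUnitSMul_apply, hoff i j hij]

theorem IsOrthonormalBasis.mul_self {r : ℕ} {e : Module.Basis (Fin r) ℝ U}
    (he : IsOrthonormalBasis B U e) (i : Fin r) : B (e i) (e i) * B (e i) (e i) = 1 := by
  rw [← abs_mul_abs_self, he.1 i, one_mul]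

theorem IsOrthonormalBasis.sum_smul {r : ℕ} {e : Module.Basis (Fin r) ℝ U}
    (he : IsOrthonormalBasis B U e) {w : F} (hw : w ∈ U) :
    ∑ i, (B (e i) (e i) * B w (e i)) • (e i : F) = w := by
  have h : w = ∑ i, e.repr ⟨w, hw⟩ i • (e i : F) := by
    have := congrArg Subtype.val (e.sum_repr ⟨w, hw⟩)
    push_cast at this
    exact this.symm
  have hc : ∀ i, B w (e i) = e.repr ⟨w, hw⟩ i * B (e i) (e i) := by
    intro i
    conv_lhs => rw [h]
    simp only [map_sum, map_smul, _root_.sum_apply, _root_.smul_apply, smul_eq_mul]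
    rw [Finset.sum_eq_single i]
    · intro j _ hj
      rw [he.2 j i hj, mul_zero]
    · simp
  conv_rhs => rw [h]
  refine Finset.sum_congr rfl fun i _ => ?_
  rw [hc i, mul_left_comm, he.mul_self, mul_one]

/-- The orthonormal basis in the definition of `trOn` does not depend on the integrand. -/
theorem exists_trOn_eq (hB : ∀ u v, B u v = B v u) [FiniteDimensional ℝ U]
    (hU : NondegenerateOn B U) :
    ∃ e : Module.Basis (Fin (Module.finrank ℝ U)) ℝ U, IsOrthonormalBasis B U e ∧
      ∀ T : F → ℝ, trOn B U T = ∑ ν, B (e ν) (e ν) * T (e ν) := by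
  have h := exists_isOrthonormalBasis hB hU
  exact ⟨h.choose, h.choose_spec, fun T => by rw [trOn, dif_pos h]⟩

/-- Two candidates differ by a vector of `U` orthogonal to `U`, so the choice in the definition is
immaterial. -/
theorem orthProj_eq (hU : NondegenerateOn B U) {P : F →L[ℝ] F}
    (hP : ∀ u, P u ∈ U ∧ ∀ w ∈ U, B (u - P u) w = 0) : orthProj B U = P := by
  have h : ∃ P : F →L[ℝ] F, ∀ u, P u ∈ U ∧ ∀ w ∈ U, B (u - P u) w = 0 := ⟨P, hP⟩
  rw [orthProj, dif_pos h]
  ext u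
  have h1 := h.choose_spec u
  refine sub_eq_zero.1 (hU _ (U.sub_mem h1.1 (hP u).1) fun w hw => ?_)
  have h2 := h1.2 w hw
  have h3 := (hP u).2 w hw
  simp only [map_sub, _root_.sub_apply] at h2 h3 ⊢
  linarith

/-- Existence is given by `u ↦ ∑ ε_i B(e_i, u) e_i` for an orthonormal basis of `U`. -/
theorem orthProj_spec [ContinuousAdd F] [ContinuousSMul ℝ F]
    (hB : ∀ u v, B u v = B v u) [FiniteDimensional ℝ U] (hU : NondegenerateOn B U) (u : F) :
    orthProj B U u ∈ U ∧ ∀ w ∈ U, B (u - orthProj B U u) w = 0 := by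
  obtain ⟨e, he⟩ := exists_isOrthonormalBasis hB hU
  have hP : ∀ u, (∑ i, (B (e i)).smulRight (B (e i) (e i) • (e i : F))) u ∈ U ∧
      ∀ w ∈ U, B (u - (∑ i, (B (e i)).smulRight (B (e i) (e i) • (e i : F))) u) w = 0 := by
    intro u
    simp only [_root_.sum_apply, ContinuousLinearMap.smulRight_apply]
    refine ⟨U.sum_mem fun i _ => U.smul_mem _ (U.smul_mem _ (e i).2), fun w hw => ?_⟩
    have h := congrArg (B u) (he.sum_smul hw)
    simp only [map_sum, map_smul, smul_eq_mul] at h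
    simp only [map_sub, map_sum, map_smul, _root_.sub_apply, _root_.sum_apply, _root_.smul_apply,
      smul_eq_mul]
    rw [← h, sub_eq_zero]
    refine Finset.sum_congr rfl fun i _ => ?_
    rw [hB u, hB w]
    ring
  rw [orthProj_eq hU hP]
  exact hP u

section
variable [ContinuousAdd F] [ContinuousSMul ℝ F] [FiniteDimensional ℝ U]

theorem orthProj_of_mem (hB : ∀ u v, B u v = B v u) (hU : NondegenerateOn B U) {u : F}
    (hu : u ∈ U) : orthProj B U u = u := by
  have h := orthProj_spec hB hU u
  exact (sub_eq_zero.1 (hU _ (U.sub_mem hu h.1) h.2)).symm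

theorem sub_orthProj_mem (hB : ∀ u v, B u v = B v u) (hU : NondegenerateOn B U) (u : F) :
    u - orthProj B U u ∈ perp B U := (orthProj_spec hB hU u).2

theorem orthProj_of_mem_perp (hB : ∀ u v, B u v = B v u) (hU : NondegenerateOn B U) {u : F}
    (hu : u ∈ perp B U) : orthProj B U u = 0 := by
  have h := orthProj_spec hB hU u
  refine hU _ h.1 fun w hw => ?_
  have h2 := h.2 w hw
  rw [map_sub, _root_.sub_apply, hu w hw] at h2
  linarith

theorem orthProj_selfAdj (hB : ∀ u v, B u v = B v u) (hU : NondegenerateOn B U) (u v : F) :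
    B (orthProj B U u) v = B u (orthProj B U v) := by
  have h1 := (orthProj_spec hB hU u).2 _ (orthProj_spec hB hU v).1
  have h2 := (orthProj_spec hB hU v).2 _ (orthProj_spec hB hU u).1
  rw [hB] at h2
  simp only [map_sub, _root_.sub_apply] at h1 h2
  linarith

/-- A vector of the complement that is orthogonal to the complement is orthogonal to both summands
of every vector. -/
theorem NondegenerateOn.perp (hB : ∀ u v, B u v = B v u) (hU : NondegenerateOn B U)
    (h : ∀ u, (∀ v, B u v = 0) → u = 0) : NondegenerateOn B (perp B U) := by
  intro u hu h0
  refine h u fun v => ?_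
  have h1 := hu _ (orthProj_spec hB hU v).1
  have h2 := h0 _ (sub_orthProj_mem hB hU v)
  rw [map_sub] at h2
  linarith

theorem isCompl_perp (hB : ∀ u v, B u v = B v u) (hU : NondegenerateOn B U) :
    IsCompl U (_root_.perp B U) := by
  refine IsCompl.of_eq ?_ ?_
  · rw [eq_bot_iff]
    exact fun u hu => hU u hu.1 hu.2
  · rw [eq_top_iff]
    intro u _
    rw [Submodule.mem_sup]
    exact ⟨_, (orthProj_spec hB hU u).1, _, sub_orthProj_mem hB hU u, by abel⟩

end

theorem orthProj_perp [IsTopologicalAddGroup F] [ContinuousSMul ℝ F] [FiniteDimensional ℝ U]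
    (hB : ∀ u v, B u v = B v u) (hU : NondegenerateOn B U)
    (h : ∀ u, (∀ v, B u v = 0) → u = 0) :
    orthProj B (perp B U) = ContinuousLinearMap.id ℝ F - orthProj B U := by
  refine orthProj_eq (hU.perp hB h) fun u => ⟨sub_orthProj_mem hB hU u, fun w hw => ?_⟩
  simp only [_root_.sub_apply, ContinuousLinearMap.id_apply, sub_sub_cancel]
  rw [hB]
  exact hw _ (orthProj_spec hB hU u).1

/-- Orthonormal bases of `U` and of `perp B U`, put together. -/
def sumBasis {m n : ℕ} (h : IsCompl U (perp B U)) (e : Module.Basis (Fin m) ℝ U)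
    (e' : Module.Basis (Fin n) ℝ (perp B U)) : Module.Basis (Fin m ⊕ Fin n) ℝ F :=
  (e.prod e').map (Submodule.prodEquivOfIsCompl _ _ h)

theorem sumBasis_apply {m n : ℕ} (h : IsCompl U (perp B U)) (e : Module.Basis (Fin m) ℝ U)
    (e' : Module.Basis (Fin n) ℝ (perp B U)) :
    ⇑(sumBasis h e e') = Sum.elim (fun i => (e i : F)) (fun i => (e' i : F)) := by
  ext i
  cases i <;> simp [sumBasis]

end Algebra

end

/-! ### Smoothness of the projection. -/

section

theorem contDiffAt_clm_apply_iff {E F D : Type*} [NormedAddCommGroup E] [NormedSpace ℝ E]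
    [FiniteDimensional ℝ E] [NormedAddCommGroup F]
    [NormedSpace ℝ F] [NormedAddCommGroup D] [NormedSpace ℝ D] {A : D → E →L[ℝ] F} {y : D} :
    ContDiffAt ℝ ∞ A y ↔ ∀ v, ContDiffAt ℝ ∞ (fun y' => A y' v) y := by
  refine ⟨fun h v => h.clm_apply contDiffAt_const, fun h => ?_⟩
  have hd : Module.finrank ℝ E = Module.finrank ℝ (Fin (Module.finrank ℝ E) → ℝ) :=
    (Module.finrank_fin_fun ℝ).symm
  let e₁ := ContinuousLinearEquiv.ofFinrankEq hd
  let e₂ := (e₁.arrowCongr (1 : F ≃L[ℝ] F)).trans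
    (ContinuousLinearEquiv.piRing (Fin (Module.finrank ℝ E)))
  rw [← Function.id_comp A, ← e₂.symm_comp_self]
  exact e₂.symm.contDiff.contDiffAt.comp y (contDiffAt_pi.mpr fun i => h _)

namespace Coord

variable {E : Type*} [NormedAddCommGroup E] [NormedSpace ℝ E]
  {G : E → E →L[ℝ] E →L[ℝ] ℝ} {y : E} {U : E → Submodule ℝ E}

/-- If `T` sends coefficients to combinations of the local frame, then the projection is `T A⁻¹ Tᵗ
G`, where `A = Tᵗ G T` is the Gram matrix. Definiteness on `U` makes `A` invertible, and inversion
is smooth. -/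
theorem contDiffAt_orthProj {q : ℕ} {S : Fin q → E → E} (hG : ContDiffAt ℝ ∞ G y)
    (hS : ∀ i, ContDiffAt ℝ ∞ (S i) y)
    (hU : ∀ᶠ y' in 𝓝 y, U y' = Submodule.span ℝ (Set.range fun i => S i y'))
    (hq : ∀ᶠ y' in 𝓝 y, Module.finrank ℝ (U y') = q)
    (hneg : ∀ᶠ y' in 𝓝 y, ∀ v ∈ U y', v ≠ 0 → G y' v v < 0) :
    ContDiffAt ℝ ∞ (fun y' => orthProj (G y') (U y')) y := by
  let T : E → (Fin q → ℝ) →L[ℝ] E := fun y' =>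
    ∑ i, (ContinuousLinearMap.proj i : (Fin q → ℝ) →L[ℝ] ℝ).smulRight (S i y')
  let L : E → E →L[ℝ] (Fin q → ℝ) →L[ℝ] ℝ := fun y' =>
    ((ContinuousLinearMap.compL ℝ (Fin q → ℝ) E ℝ).flip (T y')).comp (G y')
  let A : E → (Fin q → ℝ) →L[ℝ] (Fin q → ℝ) →L[ℝ] ℝ := fun y' => (L y').comp (T y')
  have hT_apply : ∀ y' c, T y' c = ∑ i, c i • S i y' := by
    intro y' c
    simp [T, _root_.sum_apply]
  have hT : ContDiffAt ℝ ∞ T y := by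
    refine contDiffAt_clm_apply_iff.2 fun c => ?_
    simp only [hT_apply]
    exact ContDiffAt.sum fun i _ => contDiffAt_const.smul (hS i)
  have hL : ContDiffAt ℝ ∞ L y :=
    ContDiffAt.clm_comp (g := fun y' => (ContinuousLinearMap.compL ℝ (Fin q → ℝ) E ℝ).flip (T y'))
      (contDiffAt_const.clm_apply hT) hG
  have hA : ContDiffAt ℝ ∞ A y := hL.clm_comp hT
  have hinv : ∀ᶠ y' in 𝓝 y, (∀ c, T y' c ∈ U y') ∧ (∀ w ∈ U y', ∃ c, T y' c = w) ∧
      (A y').IsInvertible := by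
    filter_upwards [hU, hq, hneg] with y' h1 h2 h3
    have hmem : ∀ c, T y' c ∈ U y' := by
      intro c
      rw [h1, hT_apply]
      exact Submodule.sum_mem _ fun i _ => Submodule.smul_mem _ _
        (Submodule.subset_span (Set.mem_range_self i))
    -- `q` vectors spanning a space of dimension `q` are independent, so `T` is injective.
    have hli : LinearIndependent ℝ (fun i => S i y') := by
      rw [linearIndependent_iff_card_eq_finrank_span, Set.finrank, ← h1, h2, Fintype.card_fin]
    refine ⟨hmem, fun w hw => ?_, Coord.isInvertible_of_nondegenerate fun c hc => ?_⟩
    · rw [h1, Submodule.mem_span_range_iff_exists_fun] at hw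
      obtain ⟨c, hc⟩ := hw
      exact ⟨c, (hT_apply y' c).trans hc⟩
    · have h4 : T y' c = 0 := by
        by_contra hne
        exact (h3 _ (hmem c) hne).ne (hc c)
      rw [hT_apply] at h4
      exact funext (Fintype.linearIndependent_iff.1 hli c h4)
  have hAinv : ContDiffAt ℝ ∞ (fun y' => (A y').inverse) y := by
    obtain ⟨e, he⟩ := hinv.self_of_nhds.2.2
    have := contDiffAt_map_inverse (n := ∞) e
    rw [he] at this
    exact this.comp y hA
  refine (hT.clm_comp (hAinv.clm_comp hL)).congr_of_eventuallyEq ?_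
  filter_upwards [hinv, hneg] with y' ⟨h1, h2, h3⟩ h4
  refine orthProj_eq (.of_neg h4) fun u => ⟨h1 _, fun w hw => ?_⟩
  obtain ⟨c, rfl⟩ := h2 w hw
  have h5 : A y' ((A y').inverse (L y' u)) = L y' u := by
    obtain ⟨e, he⟩ := h3
    rw [← he, ContinuousLinearMap.inverse_equiv]
    simp
  have h6 := DFunLike.congr_fun h5 c
  change G y' (T y' ((A y').inverse (L y' u))) (T y' c) = G y' u (T y' c) at h6
  rw [map_sub, _root_.sub_apply, ContinuousLinearMap.comp_apply, ContinuousLinearMap.comp_apply,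
    h6, sub_self]

end Coord

/-! ### Metrics, distributions and stretching in the preferred chart. -/

section Manifold

variable {E : Type*} [NormedAddCommGroup E] [NormedSpace ℝ E]
  {M : Type*} [TopologicalSpace M] [ChartedSpace E M] [IsManifold 𝓘(ℝ, E) ∞ M]

/-- The tangent space at `x` is `E`, identified by means of the preferred chart at `x` itself. -/
theorem dChart_apply (x : M) (u : TangentSpace 𝓘(ℝ, E) x) : dChart x u = u := by
  have h : dChart x = ContinuousLinearMap.id ℝ E := mfderiv_extChartAt_self (I := 𝓘(ℝ, E))
  rw [h]
  rfl

theorem dChartSymm_self (x : M) :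
    dChartSymm x (extChartAt 𝓘(ℝ, E) x x) = ContinuousLinearMap.id ℝ E := by
  have h := mfderivWithin_range_extChartAt_symm (I := 𝓘(ℝ, E)) (x := x)
  rw [modelWithCornersSelf_coe, Set.range_id, mfderivWithin_univ] at h
  exact h

theorem isInvertible_dChartSymm (x : M) {y : E} (hy : y ∈ (extChartAt 𝓘(ℝ, E) x).target) :
    (dChartSymm x y).IsInvertible := by
  have h := isInvertible_mfderivWithin_extChartAt_symm (I := 𝓘(ℝ, E)) hy
  rw [modelWithCornersSelf_coe, Set.range_id, mfderivWithin_univ] at h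
  exact h

theorem contMDiffAt_extChartAt_symm' (x : M) {y : E} (hy : y ∈ (extChartAt 𝓘(ℝ, E) x).target) :
    ContMDiffAt 𝓘(ℝ, E) 𝓘(ℝ, E) ∞ (extChartAt 𝓘(ℝ, E) x).symm y :=
  (contMDiffOn_extChartAt_symm x).contMDiffAt ((isOpen_extChartAt_target x).mem_nhds hy)

theorem contMDiffAt_dChartSymm (x : M) {y : E} (hy : y ∈ (extChartAt 𝓘(ℝ, E) x).target) (v : E) :
    ContMDiffAt 𝓘(ℝ, E) 𝓘(ℝ, E).tangent ∞ (fun y' =>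
      (⟨(extChartAt 𝓘(ℝ, E) x).symm y', dChartSymm x y' v⟩ : TangentBundle 𝓘(ℝ, E) M)) y := by
  have ho := isOpen_extChartAt_target (I := 𝓘(ℝ, E)) x
  have h := (contMDiffOn_extChartAt_symm (I := 𝓘(ℝ, E)) (n := ∞) x).contMDiffOn_tangentMapWithin
    (m := ∞) (by simp) ho.uniqueMDiffOn
  have hv : ContMDiffAt 𝓘(ℝ, E) 𝓘(ℝ, E).tangent ∞
      (fun y' : E => (⟨y', v⟩ : TangentBundle 𝓘(ℝ, E) E)) y :=
    (contMDiffAt_vectorSpace_iff_contDiffAt (V := fun _ => v)).2 contDiffAt_const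
  have h2 := ((h.contMDiffAt ((ho.preimage (FiberBundle.continuous_proj E
    (TangentSpace 𝓘(ℝ, E) (M := E)))).mem_nhds hy)).comp y hv)
  refine h2.congr_of_eventuallyEq ?_
  filter_upwards [ho.mem_nhds hy] with y' hy'
  simp only [Function.comp, tangentMapWithin, mfderivWithin_of_isOpen ho hy']
  rfl

theorem contDiffAt_chartForm [FiniteDimensional ℝ E] {q : ℕ} (g : SemiRiemannianMetric E M q) (x : M)
    {y : E} (hy : y ∈ (extChartAt 𝓘(ℝ, E) x).target) :
    ContDiffAt ℝ ∞ (chartForm g.form x) y := by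
  rw [contDiffAt_clm_apply_iff]
  intro u
  rw [contDiffAt_clm_apply_iff]
  intro v
  rw [← contMDiffAt_iff_contDiffAt]
  have h := ContMDiffAt.clm_bundle_apply₂ (𝕜 := ℝ) (F₁ := E) (F₂ := E) (F₃ := ℝ)
    (E₃ := fun _ => ℝ)
    ((g.smooth.contMDiffAt).comp y (contMDiffAt_extChartAt_symm' x hy)) (contMDiffAt_dChartSymm x hy u)
    (contMDiffAt_dChartSymm x hy v)
  rw [Bundle.contMDiffAt_totalSpace] at h
  exact h.2

theorem contDiffAt_chartField (x : M) {y : E} (hy : y ∈ (extChartAt 𝓘(ℝ, E) x).target)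
    {O : Set M} (hO : IsOpen O) (hyO : (extChartAt 𝓘(ℝ, E) x).symm y ∈ O)
    {s : ∀ y : M, TangentSpace 𝓘(ℝ, E) y} [CompleteSpace E]
    (hs : ContMDiffOn 𝓘(ℝ, E) 𝓘(ℝ, E).tangent ∞
        (fun y => (⟨y, s y⟩ : TangentBundle 𝓘(ℝ, E) M)) O) :
    ContDiffAt ℝ ∞ (F := E)
      (fun y' => (dChartSymm x y').inverse (s ((extChartAt 𝓘(ℝ, E) x).symm y'))) y := by
  have h : ContMDiffAt 𝓘(ℝ, E) 𝓘(ℝ, E).tangent ∞ (fun y' => (⟨y', VectorField.mpullback 𝓘(ℝ, E) 𝓘(ℝ, E)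
      (extChartAt 𝓘(ℝ, E) x).symm s y'⟩ : TangentBundle 𝓘(ℝ, E) E)) y :=
    ContMDiffAt.mpullback_vectorField_preimage (n := ∞) (m := ∞)
      (hs.contMDiffAt (hO.mem_nhds hyO))
      (contMDiffAt_extChartAt_symm' x hy) (isInvertible_dChartSymm (E := E) x hy) (by simp)
  exact contMDiffAt_vectorSpace_iff_contDiffAt.1 h

theorem chartForm_self (g : BilinField E M) (x : M) :
    chartForm g x (extChartAt 𝓘(ℝ, E) x x) = g x := by
  -- The chart inverse returns `x` only up to a propositional equality; generalising the base point
  -- avoids transport between tangent spaces.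
  have h : ∀ x', x' = x → (pullForm (F := E) (g x') (ContinuousLinearMap.id ℝ E) :
      E →L[ℝ] E →L[ℝ] ℝ) = g x := by
    rintro _ rfl
    rfl
  rw [chartForm, dChartSymm_self]
  exact h _ (extChartAt_to_inv x)

theorem chartDist_self (U : SubspaceField E M) (x : M) :
    chartDist U x (extChartAt 𝓘(ℝ, E) x x) = U x := by
  have h : ∀ x', x' = x → Submodule.comap (M₂ := E) (ContinuousLinearMap.id ℝ E).toLinearMap (U x') =
      U x := by
    rintro _ rfl
    rfl
  rw [chartDist, dChartSymm_self]
  exact h _ (extChartAt_to_inv x)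

omit [IsManifold 𝓘(ℝ, E) ∞ M] in
theorem chartFun_self (f : M → ℝ) (x : M) : chartFun f x (extChartAt 𝓘(ℝ, E) x x) = f x := by
  rw [chartFun, extChartAt_to_inv]

omit [IsManifold 𝓘(ℝ, E) ∞ M] in
theorem mem_chartDist {U : SubspaceField E M} {x : M} {y u : E} :
    u ∈ chartDist U x y ↔ dChartSymm x y u ∈ U ((extChartAt 𝓘(ℝ, E) x).symm y) := Iff.rfl

theorem dChartSymm_surjective (x : M) {y : E} (hy : y ∈ (extChartAt 𝓘(ℝ, E) x).target) :
    Function.Surjective (dChartSymm x y) := by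
  obtain ⟨e, he⟩ := isInvertible_dChartSymm x hy
  rw [← he]
  exact e.surjective

theorem dChartSymm_injective (x : M) {y : E} (hy : y ∈ (extChartAt 𝓘(ℝ, E) x).target) :
    Function.Injective (dChartSymm x y) := by
  obtain ⟨e, he⟩ := isInvertible_dChartSymm x hy
  rw [← he]
  exact e.injective

theorem eq_zero_of_dChartSymm_eq_zero (x : M) {y : E} (hy : y ∈ (extChartAt 𝓘(ℝ, E) x).target)
    {u : E} (h : dChartSymm x y u = 0) : u = 0 :=
  dChartSymm_injective x hy (h.trans (map_zero _).symm)

theorem finrank_chartDist (U : SubspaceField E M) (x : M) {y : E}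
    (hy : y ∈ (extChartAt 𝓘(ℝ, E) x).target) :
    Module.finrank ℝ (chartDist U x y) =
      Module.finrank ℝ (U ((extChartAt 𝓘(ℝ, E) x).symm y)) := by
  obtain ⟨e, he⟩ := isInvertible_dChartSymm x hy
  have h : chartDist U x y = (U ((extChartAt 𝓘(ℝ, E) x).symm y)).map
      (e.symm.toLinearEquiv : _ →ₗ[ℝ] E) := by
    rw [chartDist, ← he]
    exact Submodule.comap_equiv_eq_map_symm e.toLinearEquiv _
  rw [h]
  exact LinearEquiv.finrank_map_eq e.symm.toLinearEquiv _

theorem chartDist_span (U : SubspaceField E M) (x : M) {y : E}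
    (hy : y ∈ (extChartAt 𝓘(ℝ, E) x).target) {q : ℕ} {s : Fin q → ∀ y : M, TangentSpace 𝓘(ℝ, E) y}
    (hs : U ((extChartAt 𝓘(ℝ, E) x).symm y) =
      Submodule.span ℝ (Set.range fun i => s i ((extChartAt 𝓘(ℝ, E) x).symm y))) :
    chartDist U x y = Submodule.span (M := E) ℝ (Set.range fun i =>
      (dChartSymm x y).inverse (s i ((extChartAt 𝓘(ℝ, E) x).symm y))) := by
  obtain ⟨e, he⟩ := isInvertible_dChartSymm x hy
  have h : chartDist U x y = (U ((extChartAt 𝓘(ℝ, E) x).symm y)).map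
      (e.symm.toLinearEquiv : _ →ₗ[ℝ] E) := by
    rw [chartDist, ← he]
    exact Submodule.comap_equiv_eq_map_symm e.toLinearEquiv _
  rw [h, hs, Submodule.map_span, ← he, ContinuousLinearMap.inverse_equiv, ← Set.range_comp]
  rfl

section Metric

variable [FiniteDimensional ℝ E] {q : ℕ} (g : SemiRiemannianMetric E M q) (x : M)

omit [FiniteDimensional ℝ E] in
theorem chartForm_nondegenerate {y : E} (hy : y ∈ (extChartAt 𝓘(ℝ, E) x).target) (u : E)
    (hu : ∀ v, chartForm g.form x y u v = 0) : u = 0 := by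
  refine eq_zero_of_dChartSymm_eq_zero x hy (g.nondegenerate _ _ fun v => ?_)
  obtain ⟨v, rfl⟩ := dChartSymm_surjective x hy v
  exact hu v

theorem metricAt_chartForm {y : E} (hy : y ∈ (extChartAt 𝓘(ℝ, E) x).target) :
    Coord.MetricAt (chartForm g.form x) y where
  smooth := contDiffAt_chartForm g x hy
  symm _ _ := g.symm _ _ _
  inv := Coord.isInvertible_of_nondegenerate (chartForm_nondegenerate g x hy)

variable {g} {V : PlaneDistribution E M q} (hV : IsTimeDistribution g V)
include hV

omit [FiniteDimensional ℝ E] in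
theorem chartForm_neg {y : E} (hy : y ∈ (extChartAt 𝓘(ℝ, E) x).target) :
    ∀ v ∈ chartDist V.fibre x y, v ≠ 0 → chartForm g.form x y v v < 0 := fun _ hv hne =>
  hV _ _ hv fun h => hne (eq_zero_of_dChartSymm_eq_zero x hy h)

theorem projAt_orthProj {y : E} (hy : y ∈ (extChartAt 𝓘(ℝ, E) x).target) :
    Coord.ProjAt (chartForm g.form x)
      (fun y' => orthProj (chartForm g.form x y') (chartDist V.fibre x y')) y := by
  have := FiniteDimensional.complete ℝ E
  have hn := chartForm_neg x hV hy
  have hs := (metricAt_chartForm g x hy).symm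
  refine ⟨?_, fun u => orthProj_of_mem hs (.of_neg hn) (orthProj_spec hs (.of_neg hn) u).1,
    orthProj_selfAdj hs (.of_neg hn)⟩
  obtain ⟨O, hO, hyO, s, hs, hspan⟩ := V.smooth ((extChartAt 𝓘(ℝ, E) x).symm y)
  have hev : ∀ᶠ y' in 𝓝 y, y' ∈ (extChartAt 𝓘(ℝ, E) x).target :=
    (isOpen_extChartAt_target x).mem_nhds hy
  refine Coord.contDiffAt_orthProj (contDiffAt_chartForm g x hy)
    (fun i => contDiffAt_chartField x hy hO hyO (hs i)) ?_ ?_ (hev.mono fun y' => chartForm_neg x hV)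
  · have := (contMDiffAt_extChartAt_symm' x hy).continuousAt (hO.mem_nhds hyO)
    filter_upwards [this, hev] with y' h1 h2
    exact chartDist_span _ x h2 (hspan _ h1)
  · exact hev.mono fun y' h => (finrank_chartDist _ x h).trans (V.finrank_eq _)

omit hV [FiniteDimensional ℝ E] in
theorem chartDist_perpField {y : E} (hy : y ∈ (extChartAt 𝓘(ℝ, E) x).target)
    (U : SubspaceField E M) : chartDist (perpField g.form U) x y =
      perp (chartForm g.form x y) (chartDist U x y) := by
  ext v
  refine ⟨fun h w hw => h _ hw, fun h w hw => ?_⟩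
  obtain ⟨w, rfl⟩ := dChartSymm_surjective x hy w
  exact h w hw

theorem orthProj_chartDist_perpField {y : E} (hy : y ∈ (extChartAt 𝓘(ℝ, E) x).target) :
    orthProj (chartForm g.form x y) (chartDist (perpField g.form V.fibre) x y) =
      Coord.compl (fun y' => orthProj (chartForm g.form x y') (chartDist V.fibre x y')) y := by
  rw [chartDist_perpField x hy]
  exact orthProj_perp (metricAt_chartForm g x hy).symm (.of_neg (chartForm_neg x hV hy))
    (chartForm_nondegenerate g x hy)

omit [FiniteDimensional ℝ E] in
theorem nondegenerateOn_fibre : NondegenerateOn (g.form x) (V.fibre x) := .of_neg (hV x)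

/-- Metric and distribution in the chart are pullbacks, so the chart differential carries the two
components of `u` to the corresponding components. -/
theorem orthProj_dChartSymm {y : E} (hy : y ∈ (extChartAt 𝓘(ℝ, E) x).target) (u : E) :
    orthProj (g.form ((extChartAt 𝓘(ℝ, E) x).symm y)) (V.fibre ((extChartAt 𝓘(ℝ, E) x).symm y))
      (dChartSymm x y u) =
      dChartSymm x y (orthProj (chartForm g.form x y) (chartDist V.fibre x y) u) := by
  have hs := (metricAt_chartForm g x hy).symm
  have hn := NondegenerateOn.of_neg (chartForm_neg x hV hy)
  have hfd : FiniteDimensional ℝ (TangentSpace 𝓘(ℝ, E) ((extChartAt 𝓘(ℝ, E) x).symm y)) :=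
    inferInstanceAs (FiniteDimensional ℝ E)
  have h1 : dChartSymm x y u = dChartSymm x y (orthProj (chartForm g.form x y) (chartDist V.fibre x y) u)
      + dChartSymm x y (u - orthProj (chartForm g.form x y) (chartDist V.fibre x y) u) := by
    rw [← map_add, add_sub_cancel]
  rw [h1, map_add, orthProj_of_mem (g.symm _) (nondegenerateOn_fibre _ hV)
    (mem_chartDist.1 (orthProj_spec hs hn u).1), orthProj_of_mem_perp (g.symm _) (nondegenerateOn_fibre _ hV), add_zero]
  have h2 := sub_orthProj_mem hs hn u
  rw [← chartDist_perpField x hy] at h2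
  exact h2

/-- By self-adjointness and idempotency, `g(P u, P v) = g(P u, v)`; the coefficient of this term is
`1 / f² - 1`. -/
theorem chartForm_stretch (f : M → ℝ) {y : E} (hy : y ∈ (extChartAt 𝓘(ℝ, E) x).target) :
    chartForm (stretch g.form f V.fibre) x y = Coord.stretchForm (chartForm g.form x)
      (fun y' => orthProj (chartForm g.form x y') (chartDist V.fibre x y'))
      (fun y' => 1 / chartFun f x y' ^ 2 - 1) y := by
  have hP := projAt_orthProj x hV hy
  ext u v
  have h : chartForm (stretch g.form f V.fibre) x y u v = 1 / chartFun f x y ^ 2 *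
      chartForm g.form x y (orthProj (chartForm g.form x y) (chartDist V.fibre x y) u)
        (orthProj (chartForm g.form x y) (chartDist V.fibre x y) v) +
      chartForm g.form x y (u - orthProj (chartForm g.form x y) (chartDist V.fibre x y) u)
        (v - orthProj (chartForm g.form x y) (chartDist V.fibre x y) v) := by
    have h0 : chartForm (stretch g.form f V.fibre) x y u v = 1 / chartFun f x y ^ 2 *
      g.form _ (orthProj (g.form _) (V.fibre _) (dChartSymm x y u))
        (orthProj (g.form _) (V.fibre _) (dChartSymm x y v)) +
      g.form _ (dChartSymm x y u - orthProj (g.form _) (V.fibre _) (dChartSymm x y u))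
        (dChartSymm x y v - orthProj (g.form _) (V.fibre _) (dChartSymm x y v)) := rfl
    rw [h0, orthProj_dChartSymm x hV hy, orthProj_dChartSymm x hV hy, ← map_sub, ← map_sub]
    rfl
  have h1 := hP.selfAdj u v
  have h2 := hP.selfAdj (orthProj (chartForm g.form x y) (chartDist V.fibre x y) u) v
  have h3 := hP.idem u
  rw [h3] at h2
  rw [h, Coord.stretchForm_apply]
  simp only [map_sub, _root_.sub_apply, ← h1, ← h2]
  ring

end Metric

end Manifold

end

/-! ### Realisation of the abstract frame by covariant derivatives. -/

section

namespace Coord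

variable {E : Type*} [NormedAddCommGroup E] [NormedSpace ℝ E] [FiniteDimensional ℝ E]
  {G : E → E →L[ℝ] E →L[ℝ] ℝ} {y : E} {P : E → E →L[ℝ] E} {φ : E → ℝ}

omit [FiniteDimensional ℝ E] in
theorem hess_symm (hG : ∀ᶠ y' in 𝓝 y, MetricAt G y') (hφ : ContDiffAt ℝ ∞ φ y) (u v : E) :
    hess G φ y u v = hess G φ y v u := by
  have h : IsSymmSndFDerivAt ℝ φ y := hφ.isSymmSndFDerivAt (by
    simpa using WithTop.coe_le_coe.2 (le_top : (2 : ℕ∞) ≤ ⊤))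
  rw [hess, hess, h.eq, ← christoffelL_apply, ← christoffelL_apply, christoffelL_symm hG]

variable (G φ y) in
/-- The Hessian of `φ` as a linear form in its first argument. -/
def hessL (v : E) : E →L[ℝ] ℝ :=
  (fderiv ℝ (fderiv ℝ φ) y).flip v - (fderiv ℝ φ y).comp ((christoffelL G y).flip v)

omit [FiniteDimensional ℝ E] in
theorem hessL_apply (u v : E) : hessL G y φ v u = hess G φ y u v := by
  simp [hessL, hess, christoffelL_apply]

variable (G y P) in
/-- An orthonormal basis of `E` which is adapted to the projection `P`. -/
structure AdaptedBasis (ι κ : Type*) [DecidableEq ι] [DecidableEq κ] where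
  basis : Module.Basis (ι ⊕ κ) ℝ E
  sign : ι ⊕ κ → ℝ
  sign_sq : ∀ z, sign z * sign z = 1
  form_basis : ∀ z z', G y (basis z) (basis z') = if z = z' then sign z else 0
  proj_inl : ∀ a, P y (basis (Sum.inl a)) = basis (Sum.inl a)
  proj_inr : ∀ i, P y (basis (Sum.inr i)) = 0

namespace AdaptedBasis

variable {ι κ : Type*} [Fintype ι] [Fintype κ] [DecidableEq ι] [DecidableEq κ]
  (b : AdaptedBasis G y P ι κ)

omit [FiniteDimensional ℝ E] [Fintype ι] [Fintype κ] in
theorem sign_mul_form (z z' : ι ⊕ κ) :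
    b.sign z * G y (b.basis z') (b.basis z) = if z' = z then 1 else 0 := by
  rw [b.form_basis]
  split_ifs with h
  · rw [h, b.sign_sq]
  · rw [mul_zero]

omit [FiniteDimensional ℝ E] in
theorem expand_of_proj_eq_self (hP : ProjAt G P y) {u : E} (hu : P y u = u) :
    u = ∑ a, (b.sign (Sum.inl a) * G y u (b.basis (Sum.inl a))) • b.basis (Sum.inl a) := by
  conv_lhs => rw [sum_expand b.basis b.sign b.sign_mul_form u]
  rw [Fintype.sum_sum_type, add_eq_left]
  refine Finset.sum_eq_zero fun i _ => ?_
  rw [← hu, hP.selfAdj, b.proj_inr, map_zero, mul_zero, zero_smul]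

omit [FiniteDimensional ℝ E] in
theorem expand_of_proj_eq_zero (hP : ProjAt G P y) {u : E} (hu : P y u = 0) :
    u = ∑ i, (b.sign (Sum.inr i) * G y u (b.basis (Sum.inr i))) • b.basis (Sum.inr i) := by
  conv_lhs => rw [sum_expand b.basis b.sign b.sign_mul_form u]
  rw [Fintype.sum_sum_type, add_eq_right]
  refine Finset.sum_eq_zero fun a _ => ?_
  rw [← b.proj_inl, ← hP.selfAdj, hu, map_zero, _root_.zero_apply, mul_zero, zero_smul]

omit [FiniteDimensional ℝ E] in
theorem sum_inl (hP : ProjAt G P y) {u : E} (hu : P y u = u) (L : E →L[ℝ] ℝ) :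
    ∑ a, b.sign (Sum.inl a) * (G y u (b.basis (Sum.inl a)) * L (b.basis (Sum.inl a))) = L u := by
  conv_rhs => rw [b.expand_of_proj_eq_self hP hu]
  rw [map_sum]
  refine Finset.sum_congr rfl fun a _ => ?_
  rw [map_smul, smul_eq_mul, mul_assoc]

omit [FiniteDimensional ℝ E] in
theorem sum_inr (hP : ProjAt G P y) {u : E} (hu : P y u = 0) (L : E →L[ℝ] ℝ) :
    ∑ i, b.sign (Sum.inr i) * (G y u (b.basis (Sum.inr i)) * L (b.basis (Sum.inr i))) = L u := by
  conv_rhs => rw [b.expand_of_proj_eq_zero hP hu]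
  rw [map_sum]
  refine Finset.sum_congr rfl fun a _ => ?_
  rw [map_smul, smul_eq_mul, mul_assoc]

end AdaptedBasis

section

omit [FiniteDimensional ℝ E] in
theorem covEnd_of_proj_eq_self (hP : ∀ᶠ y' in 𝓝 y, ProjAt G P y') (x : E) {u : E} (hu : P y u = u) :
    P y (covEnd G P y x u) = 0 := covEnd_range hP x hu

omit [FiniteDimensional ℝ E] in
theorem covEnd_of_proj_eq_zero (hP : ∀ᶠ y' in 𝓝 y, ProjAt G P y') (x : E) {u : E} (hu : P y u = 0) :
    P y (covEnd G P y x u) = covEnd G P y x u := by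
  have h := covEnd_idem hP x u
  rwa [hu, map_zero, zero_add] at h

end

/-- The covariant derivatives of `P` and of `φ` in an adapted basis. -/
def AdaptedBasis.frame {ι κ : Type*} [Fintype ι] [Fintype κ] [DecidableEq ι] [DecidableEq κ]
    (b : AdaptedBasis G y P ι κ) (hG : ∀ᶠ y' in 𝓝 y, MetricAt G y')
    (hP : ∀ᶠ y' in 𝓝 y, ProjAt G P y') (hφ : ContDiffAt ℝ ∞ φ y) : Frame E ι κ where
  V := {u | P y u = u}
  H := {u | P y u = 0}
  e a := b.basis (Sum.inl a)
  h i := b.basis (Sum.inr i)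
  ε a := b.sign (Sum.inl a)
  δ i := b.sign (Sum.inr i)
  p u v := G y (P y u) v
  k x u v := G y (covEnd G P y x u) v
  N η x u v := G y (covBilin G (covEnd G P) y η x u) v
  df u := fderiv ℝ φ y u
  hs u v := hess G φ y u v
  e_mem := b.proj_inl
  h_mem := b.proj_inr
  eps_sq a := b.sign_sq _
  p_symm u v := by rw [hP.self_of_nhds.selfAdj, hG.self_of_nhds.symm]
  p_frame a c := by simp [b.proj_inl, b.form_basis]
  p_perp u hu v := by
    rw [Set.mem_ofPred_eq] at hu
    rw [hu, map_zero, _root_.zero_apply]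
  k_symm x u v := by rw [covEnd_selfAdj hG hP, hG.self_of_nhds.symm]
  k_V x u hu v hv := by
    rw [Set.mem_ofPred_eq] at hu hv
    rw [← hv, ← hP.self_of_nhds.selfAdj, covEnd_of_proj_eq_self hP x hu, map_zero, _root_.zero_apply]
  k_H x u hu v hv := by
    rw [Set.mem_ofPred_eq] at hu hv
    rw [← covEnd_of_proj_eq_zero hP x hu, hP.self_of_nhds.selfAdj, hv, map_zero]
  N_symm η x u v := by rw [covBilin_selfAdj hG hP, hG.self_of_nhds.symm]
  N_V η x u hu v hv := by
    rw [Set.mem_ofPred_eq] at hu hv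
    have h := covBilin_idem hG hP η x u
    rw [hu] at h
    -- For `u ∈ V` the first term of the twice differentiated `P² = P` cancels the right side,
    -- leaving the `V`-component of `(∇²P) u`.
    have h1 : P y (covBilin G (covEnd G P) y η x u) =
        -(covEnd G P y x (covEnd G P y η u) + covEnd G P y η (covEnd G P y x u)) := by
      linear_combination (norm := module) h
    conv_lhs => rw [← hv, ← hP.self_of_nhds.selfAdj, h1, map_neg, _root_.neg_apply, map_add,
      _root_.add_apply, covEnd_selfAdj hG hP x (covEnd G P y η u), covEnd_selfAdj hG hP η (covEnd G P y x u),
      hG.self_of_nhds.symm _ (covEnd G P y x v), hG.self_of_nhds.symm _ (covEnd G P y η v)]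
    -- `∇P` maps `V` into `H`, so the products are expanded in the frame of `H`.
    rw [← b.sum_inr hP.self_of_nhds (covEnd_of_proj_eq_self hP η hu),
      ← b.sum_inr hP.self_of_nhds (covEnd_of_proj_eq_self hP x hu), ← Finset.sum_add_distrib]
    congr 1
    refine Finset.sum_congr rfl fun i _ => ?_
    ring
  N_H η x u hu v hv := by
    rw [Set.mem_ofPred_eq] at hu hv
    have h := covBilin_idem hG hP η x u
    have h0 : covBilin G (covEnd G P) y η x 0 = 0 := by simp [covBilin]
    rw [hu, h0, zero_add] at h
    -- For `u ∈ H` the first term vanishes, and the term in the range of `P` is orthogonal to `v ∈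
    -- H`.
    conv_lhs => rw [← h, map_add, map_add, _root_.add_apply, _root_.add_apply,
      hP.self_of_nhds.form_proj _ hv, add_zero, covEnd_selfAdj hG hP x (covEnd G P y η u), covEnd_selfAdj hG hP η (covEnd G P y x u),
      hG.self_of_nhds.symm _ (covEnd G P y x v), hG.self_of_nhds.symm _ (covEnd G P y η v)]
    rw [← b.sum_inl hP.self_of_nhds (covEnd_of_proj_eq_zero hP η hu),
      ← b.sum_inl hP.self_of_nhds (covEnd_of_proj_eq_zero hP x hu), ← Finset.sum_add_distrib]
    refine Finset.sum_congr rfl fun i _ => ?_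
    ring
  hs_symm := hess_symm hG hφ
  df_expand u hu := by
    rw [Set.mem_ofPred_eq] at hu
    rw [hu]
    exact b.sum_inl hP.self_of_nhds hu _
  p_expand u hu w := by
    rw [Set.mem_ofPred_eq] at hu
    rw [hu, b.sum_inl hP.self_of_nhds hu, hG.self_of_nhds.symm, ← hP.self_of_nhds.selfAdj, hu]
  hs_expand u hu x := by
    rw [Set.mem_ofPred_eq] at hu
    simp only [hu, ← hessL_apply]
    exact b.sum_inl hP.self_of_nhds hu _
  k_expand₁ u hu x z := by
    rw [Set.mem_ofPred_eq] at hu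
    rw [hu]
    exact b.sum_inl hP.self_of_nhds hu (((G y).flip z).comp ((covEnd G P y).flip x))
  k_expand₂ u hu x z := by
    rw [Set.mem_ofPred_eq] at hu
    rw [hu]
    exact b.sum_inl hP.self_of_nhds hu (((G y).comp (covEnd G P y x)).flip z)

end Coord

end

/-! ### The Ricci difference and the classical tensors in an adapted basis. -/

section

namespace Coord

variable {E : Type*} [NormedAddCommGroup E] [NormedSpace ℝ E] [FiniteDimensional ℝ E]
  {G G' : E → E →L[ℝ] E →L[ℝ] ℝ} {y : E} {P : E → E →L[ℝ] E} {φ : E → ℝ}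

theorem ricci_congr (h : G =ᶠ[𝓝 y] G') (u v : E) : ricci G y u v = ricci G' y u v := by
  have hn : ∀ᶠ y' in 𝓝 y, ∀ X v, nabla G X y' v = nabla G' X y' v := by
    filter_upwards [h.eventuallyEq_nhds] with y' h' X v
    rw [nabla, nabla, christoffel, christoffel, h'.fderiv_eq, h'.self_of_nhds]
  have hc : ∀ w v z, nabla G (fun y' => nabla G (fun _ => w) y' v) y z =
      nabla G' (fun y' => nabla G' (fun _ => w) y' v) y z := by
    intro w v z
    rw [hn.self_of_nhds]
    exact nabla_congr (hn.mono fun y' h' => h' _ _) z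
  simp only [ricci, curvature, hc]

theorem ricci_smul_left (hG : MetricAt G y) (c : ℝ) (u v : E) :
    ricci G y (c • u) v = c * ricci G y u v := by
  have hΓ := (contDiffAt_christoffelL hG).differentiableAt (by simp)
  simp only [ricci, Finset.mul_sum]
  refine Finset.sum_congr rfl fun i _ => ?_
  rw [← smul_eq_mul, ← map_smul]
  congr 1
  simp only [curvature_eq hΓ, map_smul, _root_.smul_apply, smul_add, smul_sub]

theorem ricci_smul_right (hG : MetricAt G y) (c : ℝ) (u v : E) :
    ricci G y u (c • v) = c * ricci G y u v := by
  have hΓ := (contDiffAt_christoffelL hG).differentiableAt (by simp)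
  simp only [ricci, Finset.mul_sum]
  refine Finset.sum_congr rfl fun i _ => ?_
  rw [← smul_eq_mul, ← map_smul]
  congr 1
  simp only [curvature_eq hΓ, map_smul, smul_add, smul_sub]

namespace AdaptedBasis

variable {ι κ : Type*} [Fintype ι] [Fintype κ] [DecidableEq ι] [DecidableEq κ]
  (b : AdaptedBasis G y P ι κ) (hG : ∀ᶠ y' in 𝓝 y, MetricAt G y')
  (hP : ∀ᶠ y' in 𝓝 y, ProjAt G P y') (hφ : ContDiffAt ℝ ∞ φ y)

theorem frame_b : (b.frame hG hP hφ).b = b.basis := by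
  ext z
  cases z <;> rfl

/-- The general comparison of Ricci tensors is applied with `λ = 1 / f² - 1`, whose first and second
derivatives supply the coefficients in `Frame.T` and `Frame.D`. -/
theorem ricci_stretchForm (hφ' : ∀ᶠ y' in 𝓝 y, ContDiffAt ℝ ∞ φ y') (h0 : ∀ᶠ y' in 𝓝 y, φ y' ≠ 0)
    (u w : E) :
    ricci (stretchForm G P fun y' => 1 / φ y' ^ 2 - 1) y u w =
      ricci G y u w + (b.frame hG hP hφ).ricciDiff (φ y) u w := by
  have hr := h0.self_of_nhds
  have hl : ∀ᶠ y' in 𝓝 y, ContDiffAt ℝ ∞ (fun y' => 1 / φ y' ^ 2 - 1) y' := by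
    filter_upwards [hφ', h0] with y' h1 h2
    exact contDiffAt_lam h1 h2
  have hG' : ∀ᶠ y' in 𝓝 y, MetricAt (stretchForm G P fun y' => 1 / φ y' ^ 2 - 1) y' := by
    filter_upwards [hG, hP, hl, h0] with y' h1 h2 h3 h4
    refine h1.stretchForm h2 h3 ?_
    rw [add_sub_cancel]
    positivity
  rw [← sub_eq_iff_eq_add', ricci_sub_ricci hG hG' b.basis ((b.frame hG hP hφ).wt (φ y)) ?_
    (T := (b.frame hG hP hφ).T (φ y)) ?_ (D := (b.frame hG hP hφ).D (φ y)) ?_, Frame.ricciDiff,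
    frame_b]
  -- The stretched metric takes the value `ε / f²` on a frame vector of `V`, which explains the
  -- weight `f² ε`.
  · intro z z'
    rw [stretchForm_apply, hG.self_of_nhds.symm, hP.self_of_nhds.selfAdj,
      hG.self_of_nhds.symm _ (P y (b.basis z)), ← b.sign_mul_form]
    rcases z with a | i
    · have : (b.frame hG hP hφ).wt (φ y) (Sum.inl a) = φ y ^ 2 * b.sign (Sum.inl a) := rfl
      rw [b.proj_inl, this, hG.self_of_nhds.symm _ (b.basis (Sum.inl a))]
      field_simp
      ring
    · have : (b.frame hG hP hφ).wt (φ y) (Sum.inr i) = b.sign (Sum.inr i) := rfl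
      rw [b.proj_inr, this, hG.self_of_nhds.symm _ (b.basis (Sum.inr i))]
      simp
  · intro x u v
    rw [covForm_stretchForm hG hP hl.self_of_nhds, fderiv_lam hφ hr]
    rfl
  · intro η x u v
    rw [covTri_stretchForm hG hP hl, fderiv_lam hφ hr, fderiv_lam hφ hr, hess_lam hφ' h0]
    rfl

section

variable {U U' : E → Submodule ℝ E} (hU : ∀ᶠ y' in 𝓝 y, orthProj (G y') (U y') = P y')
  (hU' : ∀ᶠ y' in 𝓝 y, orthProj (G y') (U' y') = compl P y')
include hU

theorem sw_eq_swV (u v : E) {w : E} (hw : P y w = 0) :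
    sw G U y u v w = (b.frame hG hP hφ).swV u v w := sw_eq hU hP u v hw

theorem tw_eq_twV {u v w : E} (hu : P y u = u) (hv : P y v = v) (hw : P y w = 0) :
    tw G U y u v w = (b.frame hG hP hφ).twV u v w := tw_eq hG hU hP hu hv hw

theorem quiem_eq_N (x η : E) {z w : E} (hz : P y z = z) (hw : P y w = 0) :
    quiem G U y x η z w = (b.frame hG hP hφ).N η x z w := quiem_eq hG hU hP x η hz hw

theorem divArg_eq_neg_k (v : E) {a : E} (ha : P y a = a) :
    divArg G U y v a = -(b.frame hG hP hφ).k a a v := divArg_eq hG hU hP v ha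

theorem laplaceArg_eq_V {a : E} (ha : P y a = a) :
    laplaceArg G U φ y a = (b.frame hG hP hφ).hs a a + ∑ i, (b.frame hG hP hφ).δ i *
      ((b.frame hG hP hφ).k a a ((b.frame hG hP hφ).h i) *
        (b.frame hG hP hφ).df ((b.frame hG hP hφ).h i)) := by
  rw [laplaceArg_eq hG hU hP hφ ha,
    ← b.sum_inr hP.self_of_nhds (covEnd_of_proj_eq_self hP a ha) (fderiv ℝ φ y)]
  rfl

omit hU
include hU'

theorem sw_eq_swH (u v : E) {w : E} (hw : P y w = w) :
    sw G U' y u v w = (b.frame hG hP hφ).swH u v w := by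
  rw [sw_eq hU' (hP.mono fun _ h => h.compl) u v (by rw [compl_apply, hw, sub_self]), covEnd_compl]
  simp only [_root_.neg_apply, map_neg, ← sub_eq_add_neg]
  rfl

theorem tw_eq_twH {u v w : E} (hu : P y u = 0) (hv : P y v = 0) (hw : P y w = w) :
    tw G U' y u v w = (b.frame hG hP hφ).twH u v w := by
  rw [tw_eq hG hU' (hP.mono fun _ h => h.compl) (by rw [compl_apply, hu, sub_zero])
    (by rw [compl_apply, hv, sub_zero]) (by rw [compl_apply, hw, sub_self]), covEnd_compl]
  simp only [_root_.neg_apply, map_neg, neg_sub_neg]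
  rfl

theorem quiem_eq_neg_N (x η : E) {z w : E} (hz : P y z = 0) (hw : P y w = w) :
    quiem G U' y x η z w = -(b.frame hG hP hφ).N η x z w := by
  rw [quiem_eq hG hU' (hP.mono fun _ h => h.compl) x η (by rw [compl_apply, hz, sub_zero])
    (by rw [compl_apply, hw, sub_self]), covBilin_compl]
  simp only [_root_.neg_apply, map_neg]
  rfl

theorem divArg_eq_k (v : E) {a : E} (ha : P y a = 0) :
    divArg G U' y v a = (b.frame hG hP hφ).k a a v := by
  rw [divArg_eq hG hU' (hP.mono fun _ h => h.compl) v (by rw [compl_apply, ha, sub_zero]),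
    covEnd_compl]
  simp only [_root_.neg_apply, map_neg, neg_neg]
  rfl

theorem laplaceArg_eq_H {a : E} (ha : P y a = 0) :
    laplaceArg G U' φ y a = (b.frame hG hP hφ).hs a a - ∑ i, (b.frame hG hP hφ).ε i *
      ((b.frame hG hP hφ).k a a ((b.frame hG hP hφ).e i) *
        (b.frame hG hP hφ).df ((b.frame hG hP hφ).e i)) := by
  rw [laplaceArg_eq hG hU' (hP.mono fun _ h => h.compl) hφ (by rw [compl_apply, ha, sub_zero]),
    covEnd_compl]
  simp only [_root_.neg_apply, map_neg, ← sub_eq_add_neg]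
  rw [← b.sum_inl hP.self_of_nhds (covEnd_of_proj_eq_zero hP a ha) (fderiv ℝ φ y)]
  rfl

end

end AdaptedBasis

end Coord

end

/-! ### Existence of the frame on the manifold. -/

section

namespace Coord

/-- Orthonormal bases of `U` and of its orthogonal complement, as in the definition of the trace,
form a basis adapted to the orthogonal projection onto `U`. -/
theorem exists_adaptedBasis {E : Type*} [NormedAddCommGroup E] [NormedSpace ℝ E]
    [FiniteDimensional ℝ E] {G : E → E →L[ℝ] E →L[ℝ] ℝ} {y : E} {P : E → E →L[ℝ] E}
    {B : E →L[ℝ] E →L[ℝ] ℝ} {U : Submodule ℝ E} (hs : ∀ u v, B u v = B v u)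
    (hnd : ∀ u, (∀ v, B u v = 0) → u = 0) (hn : NondegenerateOn B U)
    (hG : G y = B) (hP : P y = orthProj B U) :
    ∃ b : AdaptedBasis G y P (Fin (Module.finrank ℝ U)) (Fin (Module.finrank ℝ (perp B U))),
      (∀ T, trOn B U T = ∑ a, b.sign (Sum.inl a) * T (b.basis (Sum.inl a))) ∧
      (∀ T, trOn B (perp B U) T = ∑ i, b.sign (Sum.inr i) * T (b.basis (Sum.inr i))) := by
  subst hG
  have hc := isCompl_perp hs hn
  -- These are the bases chosen inside `trOn`, so traces of arbitrary functions become sums and no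
  -- bilinearity of the integrands has to be checked.
  obtain ⟨e, he, hte⟩ := exists_trOn_eq hs hn
  obtain ⟨h, hh, hth⟩ := exists_trOn_eq hs (hn.perp hs hnd)
  have hb := sumBasis_apply hc e h
  refine ⟨⟨sumBasis hc e h, fun z => G y (sumBasis hc e h z) (sumBasis hc e h z), ?_, ?_, ?_, ?_⟩,
    ?_, ?_⟩
  · rintro (a | i)
    · simpa only [hb] using! he.mul_self a
    · simpa only [hb] using! hh.mul_self i
  · rintro (a | i) (c | j)
    · by_cases hac : a = c
      · subst hac
        simp
      · simp [hac, hb, he.2 _ _ hac]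
    · simp only [reduceCtorEq, if_false, hb]
      rw [hs]
      exact (h j).2 _ (e a).2
    · simp only [reduceCtorEq, if_false, hb]
      exact (h i).2 _ (e c).2
    · by_cases hac : i = j
      · subst hac
        simp
      · simp [hac, hb, hh.2 _ _ hac]
  · intro a
    simp only [hP, hb]
    exact orthProj_of_mem hs hn (e a).2
  · intro i
    simp only [hP, hb]
    exact orthProj_of_mem_perp hs hn (h i).2
  · intro T
    simp only [hb]
    exact hte T
  · intro T
    simp only [hb]
    exact hth T

end Coord

section Manifold

variable {E : Type*} [NormedAddCommGroup E] [NormedSpace ℝ E] [FiniteDimensional ℝ E]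
  {M : Type*} [TopologicalSpace M] [ChartedSpace E M] [IsManifold 𝓘(ℝ, E) ∞ M]

/-- The frame `F` of the tangent space at `x` consists of orthonormal bases of `V` and `⊥V`, and
its forms are those of `g`, `V` and `f`. -/
structure IsFrameOf {ι κ : Type*} [Fintype ι] [Fintype κ] [DecidableEq ι] [DecidableEq κ]
    (g : BilinField E M) (V H : SubspaceField E M) (f : M → ℝ) (x : M)
    (F : Coord.Frame (TangentSpace 𝓘(ℝ, E) x) ι κ) : Prop where
  mem_V : ∀ u ∈ V x, u ∈ F.V
  mem_H : ∀ u ∈ H x, u ∈ F.H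
  tr_V : ∀ T, tr g V x T = ∑ a, F.ε a * T (F.e a)
  tr_H : ∀ T, tr g H x T = ∑ i, F.δ i * T (F.h i)
  form_eq : ∀ u ∈ F.V, ∀ v, g x u v = F.p u v
  dfun_eq : ∀ u, dfun f x u = F.df u
  hess_eq : ∀ u v, Hess g f x u v = F.hs u v
  sw_V : ∀ u v, ∀ w ∈ F.H, Sw g V x u v w = F.swV u v w
  tw_V : ∀ u ∈ F.V, ∀ v ∈ F.V, ∀ w ∈ F.H, Tw g V x u v w = F.twV u v w
  quiem_V : ∀ u v, ∀ z ∈ F.V, ∀ w ∈ F.H, Quiem g V x u v z w = F.N v u z w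
  divg_V : ∀ v, divg g V x v = F.divV v
  laplace_V : laplace g V f x = F.lapV
  sw_H : ∀ u v, ∀ w ∈ F.V, Sw g H x u v w = F.swH u v w
  tw_H : ∀ u ∈ F.H, ∀ v ∈ F.H, ∀ w ∈ F.V, Tw g H x u v w = F.twH u v w
  quiem_H : ∀ u v, ∀ z ∈ F.H, ∀ w ∈ F.V, Quiem g H x u v z w = -F.N v u z w
  divg_H : ∀ v, divg g H x v = F.divH v
  laplace_H : laplace g H f x = F.lapH
  ric_stretch : ∀ u v, Ric (stretch g f V) x u v = Ric g x u v + F.ricciDiff (f x) u v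
  ric_stretch_smul_left : ∀ (c : ℝ) u v,
    Ric (stretch g f V) x (c • u) v = c * Ric (stretch g f V) x u v
  ric_stretch_smul_right : ∀ (c : ℝ) u v,
    Ric (stretch g f V) x u (c • v) = c * Ric (stretch g f V) x u v
  stretchVec_V : ∀ u ∈ V x, stretchVec g f V x u = f x • u
  stretchVec_H : ∀ u ∈ H x, stretchVec g f V x u = u

omit [FiniteDimensional ℝ E] [IsManifold 𝓘(ℝ, E) ∞ M] in
theorem dfun_eq_fderiv {f : M → ℝ} {x : M} (hf : MDifferentiableAt 𝓘(ℝ, E) 𝓘(ℝ, ℝ) f x)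
    (u : TangentSpace 𝓘(ℝ, E) x) :
    dfun f x u = fderiv ℝ (chartFun f x) (extChartAt 𝓘(ℝ, E) x x) u := by
  rw [dfun, hf.mfderiv, modelWithCornersSelf_coe, Set.range_id, fderivWithin_univ]
  rfl

variable {q : ℕ} {g : SemiRiemannianMetric E M q} {V : PlaneDistribution E M q}
  (hV : IsTimeDistribution g V)
include hV

/-- The bridge to the algebra: metric, projection and `f` satisfy the coordinate hypotheses on the
whole chart target, hence near the image of `x`, and only germs there matter. -/
theorem exists_frame {f : M → ℝ} (hf : ContMDiff 𝓘(ℝ, E) 𝓘(ℝ, ℝ) ∞ f) (hf_pos : ∀ x, 0 < f x)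
    (x : M) : ∃ F : Coord.Frame (TangentSpace 𝓘(ℝ, E) x) (Fin (Module.finrank ℝ (V.fibre x)))
      (Fin (Module.finrank ℝ (perpField g.form V.fibre x))),
      IsFrameOf g.form V.fibre (perpField g.form V.fibre) f x F := by
  have hfd : FiniteDimensional ℝ (TangentSpace 𝓘(ℝ, E) x) :=
    inferInstanceAs (FiniteDimensional ℝ E)
  have hs := g.symm x
  have hn := nondegenerateOn_fibre x hV
  have hev : ∀ᶠ y in 𝓝 (extChartAt 𝓘(ℝ, E) x x), y ∈ (extChartAt 𝓘(ℝ, E) x).target :=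
    extChartAt_target_mem_nhds x
  have hG := hev.mono fun y hy => metricAt_chartForm g x hy
  have hP := hev.mono fun y hy => projAt_orthProj x hV hy
  have hφ : ∀ᶠ y in 𝓝 (extChartAt 𝓘(ℝ, E) x x), ContDiffAt ℝ ∞ (chartFun f x) y :=
    hev.mono fun y hy => contMDiffAt_iff_contDiffAt.1
      (hf.contMDiffAt.comp y (contMDiffAt_extChartAt_symm' x hy))
  have h0 : ∀ᶠ y in 𝓝 (extChartAt 𝓘(ℝ, E) x x), chartFun f x y ≠ 0 :=
    .of_forall fun y => (hf_pos _).ne'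
  have hU : ∀ᶠ y in 𝓝 (extChartAt 𝓘(ℝ, E) x x), orthProj (chartForm g.form x y)
      (chartDist V.fibre x y) =
      (fun y => orthProj (chartForm g.form x y) (chartDist V.fibre x y)) y := .of_forall fun _ => rfl
  have hU' := hev.mono fun y hy => orthProj_chartDist_perpField x hV hy
  have hst : chartForm (stretch g.form f V.fibre) x =ᶠ[𝓝 (extChartAt 𝓘(ℝ, E) x x)] _ :=
    hev.mono fun y hy => chartForm_stretch x hV f hy
  have hGs : Coord.MetricAt (Coord.stretchForm (chartForm g.form x)
      (fun y' => orthProj (chartForm g.form x y') (chartDist V.fibre x y'))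
      (fun y' => 1 / chartFun f x y' ^ 2 - 1)) (extChartAt 𝓘(ℝ, E) x x) := by
    refine hG.self_of_nhds.stretchForm hP.self_of_nhds
      (Coord.contDiffAt_lam hφ.self_of_nhds h0.self_of_nhds) ?_
    rw [add_sub_cancel]
    have := h0.self_of_nhds
    positivity
  have hP0 : orthProj (chartForm g.form x (extChartAt 𝓘(ℝ, E) x x))
      (chartDist V.fibre x (extChartAt 𝓘(ℝ, E) x x)) = orthProj (g.form x) (V.fibre x) := by
    rw [chartForm_self, chartDist_self]
    rfl
  obtain ⟨b, hbV, hbH⟩ := Coord.exists_adaptedBasis (E := E) (G := chartForm g.form x)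
    (y := extChartAt 𝓘(ℝ, E) x x)
    (P := fun y => orthProj (chartForm g.form x y) (chartDist V.fibre x y)) (B := g.form x)
    (U := V.fibre x) hs (g.nondegenerate x) hn (chartForm_self g.form x) hP0
  have htV : ∀ T, tr g.form V.fibre x T = ∑ a, b.sign (Sum.inl a) * T (b.basis (Sum.inl a)) := hbV
  have htH : ∀ T, tr g.form (perpField g.form V.fibre) x T =
      ∑ i, b.sign (Sum.inr i) * T (b.basis (Sum.inr i)) := hbH
  have hd : ∀ u : TangentSpace 𝓘(ℝ, E) x, dChart x u = u := dChart_apply x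
  have hform : ∀ u ∈ (b.frame hG hP hφ.self_of_nhds).V, ∀ v : E,
      chartForm g.form x (extChartAt 𝓘(ℝ, E) x x) u v = (b.frame hG hP hφ.self_of_nhds).p u v := by
    intro u hu v
    have hu' : orthProj (chartForm g.form x (extChartAt 𝓘(ℝ, E) x x))
      (chartDist V.fibre x (extChartAt 𝓘(ℝ, E) x x)) u = u := hu
    conv_lhs => rw [← hu']
    rfl
  have hdivV : ∀ v : E, ∑ a, b.sign (Sum.inl a) * Coord.divArg (chartForm g.form x)
      (chartDist V.fibre x) (extChartAt 𝓘(ℝ, E) x x) v (b.basis (Sum.inl a)) =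
      (b.frame hG hP hφ.self_of_nhds).divV v := fun v => Finset.sum_congr rfl fun a _ =>
    congrArg (b.sign (Sum.inl a) * ·) (b.divArg_eq_neg_k hG hP _ hU v (b.proj_inl a))
  have hdivH : ∀ v : E, ∑ i, b.sign (Sum.inr i) * Coord.divArg (chartForm g.form x)
      (chartDist (perpField g.form V.fibre) x) (extChartAt 𝓘(ℝ, E) x x) v (b.basis (Sum.inr i)) =
      (b.frame hG hP hφ.self_of_nhds).divH v := fun v => Finset.sum_congr rfl fun i _ =>
    congrArg (b.sign (Sum.inr i) * ·) (b.divArg_eq_k hG hP _ hU' v (b.proj_inr i))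
  have hlapV : ∑ a, b.sign (Sum.inl a) * Coord.laplaceArg (chartForm g.form x)
      (chartDist V.fibre x) (chartFun f x) (extChartAt 𝓘(ℝ, E) x x) (b.basis (Sum.inl a)) =
      (b.frame hG hP hφ.self_of_nhds).lapV := Finset.sum_congr rfl fun a _ =>
    congrArg (b.sign (Sum.inl a) * ·) (b.laplaceArg_eq_V hG hP _ hU (b.proj_inl a))
  have hlapH : ∑ i, b.sign (Sum.inr i) * Coord.laplaceArg (chartForm g.form x)
      (chartDist (perpField g.form V.fibre) x) (chartFun f x) (extChartAt 𝓘(ℝ, E) x x)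
        (b.basis (Sum.inr i)) =
      (b.frame hG hP hφ.self_of_nhds).lapH := Finset.sum_congr rfl fun i _ =>
    congrArg (b.sign (Sum.inr i) * ·) (b.laplaceArg_eq_H hG hP _ hU' (b.proj_inr i))
  have hric : ∀ u v : E, Coord.ricci (chartForm (stretch g.form f V.fibre) x)
      (extChartAt 𝓘(ℝ, E) x x) u v =
      Coord.ricci (chartForm g.form x) (extChartAt 𝓘(ℝ, E) x x) u v +
        (b.frame hG hP hφ.self_of_nhds).ricciDiff (f x) u v := by
    intro u v
    rw [Coord.ricci_congr hst, ← chartFun_self (E := E) f x]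
    exact b.ricci_stretchForm hG hP hφ.self_of_nhds hφ h0 u v
  have hleft : ∀ (c : ℝ) (u v : E), Coord.ricci (chartForm (stretch g.form f V.fibre) x)
      (extChartAt 𝓘(ℝ, E) x x) (c • u) v = c * Coord.ricci (chartForm (stretch g.form f V.fibre) x)
      (extChartAt 𝓘(ℝ, E) x x) u v := by
    intro c u v
    rw [Coord.ricci_congr hst, Coord.ricci_congr hst]
    exact Coord.ricci_smul_left hGs c u v
  have hright : ∀ (c : ℝ) (u v : E), Coord.ricci (chartForm (stretch g.form f V.fibre) x)
      (extChartAt 𝓘(ℝ, E) x x) u (c • v) = c * Coord.ricci (chartForm (stretch g.form f V.fibre) x)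
      (extChartAt 𝓘(ℝ, E) x x) u v := by
    intro c u v
    rw [Coord.ricci_congr hst, Coord.ricci_congr hst]
    exact Coord.ricci_smul_right hGs c u v
  rw [chartForm_self] at hform
  refine ⟨b.frame hG hP hφ.self_of_nhds,
    { mem_V := fun u hu => (DFunLike.congr_fun hP0 u).trans (orthProj_of_mem hs hn hu)
      mem_H := fun u hu => (DFunLike.congr_fun hP0 u).trans (orthProj_of_mem_perp hs hn hu)
      tr_V := htV
      tr_H := htH
      form_eq := hform
      dfun_eq := fun u => dfun_eq_fderiv (hf.mdifferentiableAt (by simp)) u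
      hess_eq := ?_
      sw_V := ?_
      tw_V := ?_
      quiem_V := ?_
      divg_V := ?_
      laplace_V := ?_
      sw_H := ?_
      tw_H := ?_
      quiem_H := ?_
      divg_H := ?_
      laplace_H := ?_
      ric_stretch := ?_
      ric_stretch_smul_left := ?_
      ric_stretch_smul_right := ?_
      stretchVec_V := ?_
      stretchVec_H := ?_ }⟩
  · intro u v
    rw [Hess, hd, hd]
    rfl
  · intro u v w hw
    rw [Sw, hd, hd, hd]
    exact b.sw_eq_swV hG hP _ hU u v hw
  · intro u hu v hv w hw
    rw [Tw, hd, hd, hd]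
    exact b.tw_eq_twV hG hP _ hU hu hv hw
  · intro u v z hz w hw
    rw [Quiem, hd, hd, hd, hd]
    exact b.quiem_eq_N hG hP _ hU u v hz hw
  · intro v
    rw [divg, htV]
    refine (Finset.sum_congr rfl fun a _ => ?_).trans (hdivV v)
    exact congrArg (b.sign (Sum.inl a) * ·)
      (congrArg₂ (Coord.divArg (chartForm g.form x) (chartDist V.fibre x) _) (hd v) (hd _))
  · rw [laplace, htV]
    refine (Finset.sum_congr rfl fun a _ => ?_).trans hlapV
    exact congrArg (b.sign (Sum.inl a) * ·)
      (congrArg (Coord.laplaceArg (chartForm g.form x) (chartDist V.fibre x) _ _) (hd _))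
  · intro u v w hw
    rw [Sw, hd, hd, hd]
    exact b.sw_eq_swH hG hP _ hU' u v hw
  · intro u hu v hv w hw
    rw [Tw, hd, hd, hd]
    exact b.tw_eq_twH hG hP _ hU' hu hv hw
  · intro u v z hz w hw
    rw [Quiem, hd, hd, hd, hd]
    exact b.quiem_eq_neg_N hG hP _ hU' u v hz hw
  · intro v
    rw [divg, htH]
    refine (Finset.sum_congr rfl fun i _ => ?_).trans (hdivH v)
    exact congrArg (b.sign (Sum.inr i) * ·)
      (congrArg₂ (Coord.divArg (chartForm g.form x) (chartDist (perpField g.form V.fibre) x) _) (hd v) (hd _))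
  · rw [laplace, htH]
    refine (Finset.sum_congr rfl fun i _ => ?_).trans hlapH
    exact congrArg (b.sign (Sum.inr i) * ·)
      (congrArg (Coord.laplaceArg (chartForm g.form x) (chartDist (perpField g.form V.fibre) x) _ _) (hd _))
  · intro u v
    rw [Ric, Ric, hd, hd]
    exact hric u v
  · intro c u v
    rw [Ric, Ric, hd, hd, hd]
    exact hleft c u v
  · intro c u v
    rw [Ric, Ric, hd, hd, hd]
    exact hright c u v
  · intro u hu
    rw [stretchVec, orthProj_of_mem hs hn hu, sub_self, add_zero]
  · intro u hu
    rw [stretchVec, orthProj_of_mem_perp hs hn hu, smul_zero, zero_add, sub_zero]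

end Manifold

end

end

theorem proposition5p4
    {E : Type*} [NormedAddCommGroup E] [NormedSpace ℝ E] [FiniteDimensional ℝ E]
    {M : Type*} [TopologicalSpace M] [ChartedSpace E M] [IsManifold 𝓘(ℝ, E) ∞ M]
    {q : ℕ} (g : SemiRiemannianMetric E M q) (V : PlaneDistribution E M q)
    (hV : IsTimeDistribution g V)
    (f : M → ℝ) (hf : ContMDiff 𝓘(ℝ, E) 𝓘(ℝ, ℝ) ∞ f) (hf_pos : ∀ x, 0 < f x)
    (H : SubspaceField E M) (hH : H = perpField g.form V.fibre) :
    (∀ x, ∀ u ∈ H x, ∀ v ∈ H x,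
      Ric (stretch g.form f V.fibre) x
          (stretchVec g.form f V.fibre x u) (stretchVec g.form f V.fibre x v) =
        Ric g.form x u v
        + q / f x * Hess g.form f x u v
        - 2 * q / f x ^ 2 * (dfun f x u * dfun f x v)
        + (q * (1 - f x ^ 2) + 2 * f x ^ 2) / (2 * f x) * pair g.form V.fibre x (Sw g.form H x u v) (dfun f x)
        + 1 / f x * (divg g.form V.fibre x v * dfun f x u)
        - f x ^ 2 * (1 - f x ^ 2) / 4 *
            tr g.form V.fibre x (fun a => tr g.form V.fibre x fun b => Tw g.form V.fibre x a b u * Tw g.form V.fibre x a b v)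
        + 1 / f x * (divg g.form V.fibre x u * dfun f x v)
        - (1 - f x ^ 2) / 2 *
            tr g.form V.fibre x (fun a => Quiem g.form H x u a v a + Quiem g.form H x v a u a)
        - (1 - f x ^ 2) / 2 * pair g.form V.fibre x (Sw g.form H x u v) (divg g.form H x)
        - (1 - f x ^ 2) / 4 *
            tr g.form V.fibre x (fun a => tr g.form V.fibre x fun b => Sw g.form V.fibre x a b u * Sw g.form V.fibre x a b v)
        - (1 - f x ^ 2) / 4 *
            tr g.form V.fibre x (fun a => tr g.form V.fibre x fun b =>
              Sw g.form V.fibre x a b u * Tw g.form V.fibre x a b v + Sw g.form V.fibre x a b v * Tw g.form V.fibre x a b u)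
        + (1 - f x ^ 2) / 4 *
            tr g.form V.fibre x (fun a => tr g.form H x fun b =>
              Sw g.form H x u b a * Tw g.form H x v b a + Sw g.form H x v b a * Tw g.form H x u b a)
        - (1 - f x ^ 2) / (2 * f x ^ 2) *
            tr g.form V.fibre x (fun a => tr g.form H x fun b => Tw g.form H x u b a * Tw g.form H x v b a)) ∧
    (∀ x, ∀ u ∈ V.fibre x, ∀ v ∈ V.fibre x,
      Ric (stretch g.form f V.fibre) x
          (stretchVec g.form f V.fibre x u) (stretchVec g.form f V.fibre x v) =
        f x ^ 2 * Ric g.form x u v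
        + (q - 2) * f x * Hess g.form f x u v
        + f x * laplace g.form V.fibre f x * g.form x u v
        + 1 / f x * laplace g.form H f x * g.form x u v
        + 1 / f x * pair g.form H x (divg g.form V.fibre x) (dfun f x) * g.form x u v
        + f x * pair g.form V.fibre x (divg g.form H x) (dfun f x) * g.form x u v
        - f x * (divg g.form H x v * dfun f x u)
        - f x * (divg g.form H x u * dfun f x v)
        - 1 / f x * pair g.form H x (Sw g.form V.fibre x u v) (dfun f x)
        - (q - 1) * pair g.form V.fibre x (dfun f x) (dfun f x) * g.form x u v
        - (q + 1) / f x ^ 2 * pair g.form H x (dfun f x) (dfun f x) * g.form x u v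
        - (q - 2) * (1 - f x ^ 2) / (2 * f x) * pair g.form H x (Sw g.form V.fibre x u v) (dfun f x)
        + (1 - f x ^ 2) / 2 * pair g.form H x (Sw g.form V.fibre x u v) (divg g.form V.fibre x)
        - (1 - f x ^ 2) / 2 *
            tr g.form H x (fun a => Quiem g.form H x v a a u + Quiem g.form H x u a a v)
        - (1 - f x ^ 2) / 4 *
            tr g.form H x (fun a => tr g.form V.fibre x fun b =>
              Sw g.form V.fibre x u b a * Tw g.form V.fibre x v b a + Sw g.form V.fibre x v b a * Tw g.form V.fibre x u b a)
        + (1 - f x ^ 2) / 4 *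
            tr g.form H x (fun a => tr g.form H x fun b => Sw g.form H x a b u * Sw g.form H x a b v)
        + (1 - f x ^ 2) / 4 *
            tr g.form H x (fun a => tr g.form H x fun b =>
              Sw g.form H x a b u * Tw g.form H x a b v + Sw g.form H x a b v * Tw g.form H x a b u)
        + f x ^ 2 * (1 - f x ^ 2) / 2 *
            tr g.form H x (fun a => tr g.form V.fibre x fun b => Tw g.form V.fibre x u b a * Tw g.form V.fibre x v b a)
        + (1 - f x ^ 2) / (4 * f x ^ 2) *
            tr g.form H x (fun a => tr g.form H x fun b => Tw g.form H x a b v * Tw g.form H x a b u)) ∧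
    (∀ x, ∀ u ∈ V.fibre x, ∀ v ∈ H x,
      Ric (stretch g.form f V.fibre) x
          (stretchVec g.form f V.fibre x u) (stretchVec g.form f V.fibre x v) =
        f x * Ric g.form x u v
        + (1 - f x ^ 2) / (2 * f x) *
            tr g.form H x (fun a => Quiem g.form H x a a v u - Quiem g.form H x v a a u)
        + f x * (1 - f x ^ 2) / 2 *
            tr g.form V.fibre x (fun a => Quiem g.form V.fibre x u a a v - Quiem g.form V.fibre x a a u v)
        - 1 / 2 * pair g.form H x (fun a => Sw g.form H x v a u) (dfun f x)
        + 1 / 2 * pair g.form V.fibre x (fun a => Sw g.form V.fibre x u a v) (dfun f x)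
        + (q - 1) * Hess g.form f x u v
        - (q - 1) / f x * (dfun f x u * dfun f x v)
        + divg g.form V.fibre x v * dfun f x u
        - divg g.form H x u * dfun f x v
        - ((q - 1) * (1 - f x ^ 2) + 3 * f x ^ 2) / 2 *
            pair g.form V.fibre x (fun a => Tw g.form V.fibre x u a v) (dfun f x)
        + ((q - 1) * (1 - f x ^ 2) + 3) / (2 * f x ^ 2) *
            pair g.form H x (fun a => Tw g.form H x v a u) (dfun f x)
        + (1 - f x ^ 2) / (4 * f x) * pair g.form V.fibre x (fun a => Sw g.form V.fibre x u a v) (divg g.form H x)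
        - (1 - f x ^ 2) * (1 - 2 * f x ^ 2) / (4 * f x) *
            pair g.form V.fibre x (fun a => Tw g.form V.fibre x u a v) (divg g.form H x)
        - f x * (1 - f x ^ 2) / 4 * pair g.form H x (fun a => Sw g.form H x a v u) (divg g.form V.fibre x)
        + (1 - f x ^ 2) * (2 - f x ^ 2) / (4 * f x) *
            pair g.form H x (fun a => Tw g.form H x a v u) (divg g.form V.fibre x)
        + (1 - f x ^ 2) ^ 2 / (8 * f x) *
            tr g.form V.fibre x (fun a => tr g.form H x fun b =>
              3 * (Tw g.form H x v b a * Tw g.form V.fibre x u a b) + Sw g.form H x v b a * Sw g.form V.fibre x u a b)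
        + (1 - f x ^ 4) / (8 * f x) *
            tr g.form V.fibre x (fun a => tr g.form H x fun b =>
              Tw g.form H x v b a * Sw g.form V.fibre x u a b - Sw g.form H x v b a * Tw g.form V.fibre x u a b)) := by
  subst hH
  refine ⟨fun x u hu v hv => ?_, fun x u hu v hv => ?_, fun x u hu v hv => ?_⟩
  all_goals
    obtain ⟨F, h⟩ := exists_frame hV hf hf_pos x
    -- The number of frame vectors in `V` is its rank, which equals the index `q`.
    have hq : Fintype.card (Fin (Module.finrank ℝ (V.fibre x))) = q := by
      rw [Fintype.card_fin, V.finrank_eq]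
    have hr := (hf_pos x).ne'
  · have hu' := h.mem_H u hu
    have hv' := h.mem_H v hv
    rw [h.stretchVec_H u hu, h.stretchVec_H v hv, h.ric_stretch, F.ricciDiff_HH _ hr hu' hv', hq]
    simp only [pair, h.tr_V, h.tr_H, h.dfun_eq, h.hess_eq, h.divg_V, h.divg_H]
    simp only [h.sw_V _ _ _ hu', h.sw_V _ _ _ hv', h.sw_H _ _ _ (F.e_mem _),
      h.tw_V _ (F.e_mem _) _ (F.e_mem _) _ hu', h.tw_V _ (F.e_mem _) _ (F.e_mem _) _ hv',
      h.tw_H _ hu' _ (F.h_mem _) _ (F.e_mem _), h.tw_H _ hv' _ (F.h_mem _) _ (F.e_mem _),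
      h.quiem_H _ _ _ hu' _ (F.e_mem _), h.quiem_H _ _ _ hv' _ (F.e_mem _)]
    ring
  · have hu' := h.mem_V u hu
    have hv' := h.mem_V v hv
    -- Both arguments carry a factor `f`, and together they form the `r²` in `ricciDiff_VV`.
    rw [h.stretchVec_V u hu, h.stretchVec_V v hv, h.ric_stretch_smul_left,
      h.ric_stretch_smul_right, h.ric_stretch, ← mul_assoc, ← pow_two, mul_add,
      F.ricciDiff_VV _ hr hu' hv', hq]
    simp only [pair, h.tr_V, h.tr_H, h.dfun_eq, h.hess_eq, h.divg_V, h.divg_H, h.laplace_V,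
      h.laplace_H, h.form_eq u hu']
    simp only [h.sw_H _ _ _ hu', h.sw_H _ _ _ hv', h.sw_V _ _ _ (F.h_mem _),
      h.tw_H _ (F.h_mem _) _ (F.h_mem _) _ hu', h.tw_H _ (F.h_mem _) _ (F.h_mem _) _ hv',
      h.tw_V _ hu' _ (F.e_mem _) _ (F.h_mem _), h.tw_V _ hv' _ (F.e_mem _) _ (F.h_mem _),
      h.quiem_H _ _ _ (F.h_mem _) _ hu', h.quiem_H _ _ _ (F.h_mem _) _ hv']
    ring
  · have hu' := h.mem_V u hu
    have hv' := h.mem_H v hv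
    rw [h.stretchVec_V u hu, h.stretchVec_H v hv, h.ric_stretch_smul_left, h.ric_stretch, mul_add,
      F.ricciDiff_VH _ hr hu' hv', hq]
    simp only [pair, h.tr_V, h.tr_H, h.dfun_eq, h.hess_eq, h.divg_V, h.divg_H]
    simp only [h.sw_V _ _ _ hv', h.sw_H _ _ _ hu', h.sw_V _ _ _ (F.h_mem _),
      h.sw_H _ _ _ (F.e_mem _),
      h.tw_V _ hu' _ (F.e_mem _) _ hv', h.tw_V _ hu' _ (F.e_mem _) _ (F.h_mem _),
      h.tw_H _ hv' _ (F.h_mem _) _ hu', h.tw_H _ hv' _ (F.h_mem _) _ (F.e_mem _),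
      h.tw_H _ (F.h_mem _) _ hv' _ hu',
      h.quiem_H _ _ _ (F.h_mem _) _ hu', h.quiem_H _ _ _ hv' _ hu',
      h.quiem_V _ _ _ (F.e_mem _) _ hv', h.quiem_V _ _ _ hu' _ hv']
    ring
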